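/- An instance of Min ATSP consists of $n$ cities and non-negative rational distances $d(i,j)$, not necessarily symmetric, with $d(i,i)=0$ and $d(i,k)\le d(i,j)+d(j,k)$ for all $i,j,k$. A feasible solution is a closed tour that visits every city exactly once, and its length is to be minimised. An algorithm is a random access machine program with logarithmic cost; its input is an instance together with a rational parameter $r$ (all numbers in binary), and its output is a tour. A tour is a $\rho$-approximation if its length is at most $\rho$ times the minimum length of a tour. The notation $O^*(T)$ means at most $T$ times a fixed polynomial in the bit length of the input. **Theorem.** 1. There is an algorithm that, given any instance with $n$ cities and any rational $r$ with $1\le r\le n$, outputs a $(\lceil\log_2 r\rceil+1)$-approximate tour in time $O^*(2^{n/r})$. 2. There is an algorithm that, given any instance with $n$ cities and any rational $r$ with $2\le r\le n$, outputs a $(\log_2 r)$-approximate tour in time $O^*(16^{n/r})$. -/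

import Mathlib

/-! ## Random access machines with logarithmic cost

A machine has integer registers `reg 0, reg 1, …` and integer arrays `arr 0, arr 1, …` whose cells
are indexed by integers. A program is a fixed finite text, so it names finitely many registers and
arrays. Every instruction is charged the bit lengths of the values and array indices it handles. -/

namespace RAM

/-- Number of bits used for an integer (absolute value and sign). -/
def len (z : ℤ) : ℕ := Nat.size z.natAbs + 1

structure Store where
  reg : ℕ → ℤ
  arr : ℕ → ℤ → ℤ

def Store.setReg (s : Store) (x : ℕ) (v : ℤ) : Store :=
  { s with reg := Function.update s.reg x v }

def Store.setArr (s : Store) (a : ℕ) (i v : ℤ) : Store :=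
  { s with arr := Function.update s.arr a (Function.update (s.arr a) i v) }

inductive Op
  | plus
  | minus
  | times
  | quot

/-- The quotient is the Euclidean one, and it is `0` when the divisor is `0`. -/
def Op.eval : Op → ℤ → ℤ → ℤ
  | .plus, u, v => u + v
  | .minus, u, v => u - v
  | .times, u, v => u * v
  | .quot, u, v => u / v

/-- Structured programs: every one of them compiles to a RAM program with jumps, with constant
overhead. -/
inductive Prog
  /-- `reg x := c` -/
  | const (x : ℕ) (c : ℤ)
  /-- `reg x := reg y ∘ reg z` -/
  | arith (o : Op) (x y z : ℕ)
  /-- `reg x := arr a [reg y]` -/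
  | load (x a y : ℕ)
  /-- `arr a [reg x] := reg y` -/
  | store (a x y : ℕ)
  /-- first `p`, then `q` -/
  | seq (p q : Prog)
  /-- if `0 < reg x` then `p` else `q` -/
  | cond (x : ℕ) (p q : Prog)
  /-- while `0 < reg x` do `p` -/
  | loop (x : ℕ) (p : Prog)

/-- `Exec p s s' t`: started in the store `s`, the program `p` halts in the store `s'`, and the
total cost of the executed instructions is `t`. -/
inductive Exec : Prog → Store → Store → ℕ → Prop
  | const (x : ℕ) (c : ℤ) (s : Store) :
      Exec (.const x c) s (s.setReg x c) (1 + len c)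
  | arith (o : Op) (x y z : ℕ) (s : Store) :
      Exec (.arith o x y z) s (s.setReg x (o.eval (s.reg y) (s.reg z)))
        (1 + len (s.reg y) + len (s.reg z))
  | load (x a y : ℕ) (s : Store) :
      Exec (.load x a y) s (s.setReg x (s.arr a (s.reg y)))
        (1 + len (s.reg y) + len (s.arr a (s.reg y)))
  | store (a x y : ℕ) (s : Store) :
      Exec (.store a x y) s (s.setArr a (s.reg x) (s.reg y))
        (1 + len (s.reg x) + len (s.reg y))
  | seq {p q : Prog} {s₁ s₂ s₃ : Store} {t₁ t₂ : ℕ} :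
      Exec p s₁ s₂ t₁ → Exec q s₂ s₃ t₂ → Exec (.seq p q) s₁ s₃ (t₁ + t₂)
  | cond_pos {x : ℕ} {p q : Prog} {s s' : Store} {t : ℕ} :
      0 < s.reg x → Exec p s s' t → Exec (.cond x p q) s s' (1 + len (s.reg x) + t)
  | cond_neg {x : ℕ} {p q : Prog} {s s' : Store} {t : ℕ} :
      ¬ 0 < s.reg x → Exec q s s' t → Exec (.cond x p q) s s' (1 + len (s.reg x) + t)
  | loop_done {x : ℕ} {p : Prog} {s : Store} :
      ¬ 0 < s.reg x → Exec (.loop x p) s s (1 + len (s.reg x))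
  | loop_step {x : ℕ} {p : Prog} {s₁ s₂ s₃ : Store} {t₁ t₂ : ℕ} :
      0 < s₁.reg x → Exec p s₁ s₂ t₁ → Exec (.loop x p) s₂ s₃ t₂ →
        Exec (.loop x p) s₁ s₃ (1 + len (s₁.reg x) + t₁ + t₂)

/-- The initial store: the input stands in the cells `0, 1, 2, …` of array `0`, everything else
is `0`. -/
def init (input : List ℤ) : Store where
  reg := fun _ => 0
  arr := fun a i => if a = 0 ∧ 0 ≤ i then input.getD i.toNat 0 else 0

/-- Total bit length of an input. -/
def inputSize (input : List ℤ) : ℕ := (input.map len).sum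

end RAM

/-! ## The asymmetric travelling salesman problem with triangle inequality -/

/-- An instance of Min ATSP: `n` cities and non-negative rational distances, not necessarily
symmetric, that satisfy the triangle inequality. -/
structure ATSP where
  n : ℕ
  dist : Fin n → Fin n → ℚ
  nonneg : ∀ i j, 0 ≤ dist i j
  dist_self : ∀ i, dist i i = 0
  triangle : ∀ i j k, dist i k ≤ dist i j + dist j k

namespace ATSP

/-- The length of the closed tour `σ 0 → σ 1 → ⋯ → σ (n - 1) → σ 0`. -/
def tourLength (I : ATSP) (σ : Equiv.Perm (Fin I.n)) : ℚ :=
  ∑ i, I.dist (σ i) (σ (finRotate I.n i))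

/-- The length of a shortest tour. -/
def opt (I : ATSP) : ℚ :=
  (Finset.univ : Finset (Equiv.Perm (Fin I.n))).inf' Finset.univ_nonempty I.tourLength

/-- The input made of an instance and a rational parameter `r`: the number of cities, `r`, and the
distance matrix row by row, each rational as a reduced numerator and denominator. -/
def encode (I : ATSP) (r : ℚ) : List ℤ :=
  [(I.n : ℤ), r.num, (r.den : ℤ)] ++
    (List.finRange I.n).flatMap fun i =>
      (List.finRange I.n).flatMap fun j => [(I.dist i j).num, ((I.dist i j).den : ℤ)]

/-- There is one program which, given any instance with `n` cities and any rational `r` with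
`rmin ≤ r ≤ n`, writes in the first `n` cells of array `1` a tour of length at most `ρ r` times the
optimum, in time `O*(T n r)`: at most `T n r` times a polynomial in the bit length of the input. -/
def ApproximableInTime (rmin : ℚ) (ρ : ℚ → ℝ) (T : ℕ → ℚ → ℝ) : Prop :=
  ∃ (p : RAM.Prog) (C d : ℕ), ∀ (I : ATSP) (r : ℚ), rmin ≤ r → r ≤ I.n →
    ∃ (s : RAM.Store) (t : ℕ) (σ : Equiv.Perm (Fin I.n)),
      RAM.Exec p (RAM.init (I.encode r)) s t ∧
      (∀ i : Fin I.n, s.arr 1 (i : ℕ) = ((σ i : ℕ) : ℤ)) ∧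
      (I.tourLength σ : ℝ) ≤ ρ r * (I.opt : ℝ) ∧
      (t : ℝ) ≤ C * (RAM.inputSize (I.encode r) : ℝ) ^ d * T I.n r

end ATSP

/-! # Approximating the asymmetric travelling salesman problem

The algorithm repeats the cycle cover step of Frieze, Galbiati and Maffioli, but stops as soon as
few enough cities are left to solve the rest exactly. It keeps a permutation `g` of all cities
together with a set `A` of active cities that contains exactly one city of every cycle of `g`
(`Equiv.Perm.IsTransversal`); at the start `g = 1` and all cities are active. In a round, a
shortest fixed-point free permutation `π` of `A` is computed, `g` is replaced by `π * g`, and only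
the least city of every cycle of `π` stays active. By `IsTransversal.sameCycle_mul`, composing with
`π` concatenates cycles of `g` along the cycles of `π`, so the invariant is kept. No cycle of `π`
on `A` is trivial, so `|A|` at least halves (`two_mul_card_least_le`). By the triangle inequality a
tour of all cities can be shortcut to a tour of `A` (`IsDist.exists_isTourOn`), so `π` is not
longer than the optimum, and `permCost Z (π * g) ≤ permCost Z g + permCost Z π`.

Rounds are carried out while `|A| > c * n / r`. If there are `e ≥ 1` of them, then
`c * 2 ^ (e - 1) < r`, since the last one started with at most `n / 2 ^ (e - 1)` active cities
(`wp_mainLoop`). At the end a shortest tour `τ` of `A` is found by dynamic programming over subsets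
in time `O*(2 ^ |A|)`, and `τ * g` is a tour of all cities of length at most `(e + 1) * opt`. For
`c = 1` this gives the first part of the theorem, and for `c = 4` the second, where
`e + 1 ≤ log₂ r`.

A shortest fixed-point free permutation of `A` is found as an assignment of least cost: with a
penalty above the sum of all distances, an optimal assignment fixes exactly the cities outside of
`A` (`IsDist.of_penalized_minimal`). The assignment problem is solved by successive shortest paths
with potentials (`Search`, `Rotation`), and weak duality (`permCost_le_of_potential`) certifies the
result.

The program is written in a small language with counting loops (`TourProgram.Cmd`), which is
compiled to the machine. Weakest preconditions for that language (`wp`) give termination, the cost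
and correctness at the same time, provided that no intermediate value exceeds a bound `W` in
absolute value. The distances are multiplied by the product of all denominators, so that all
arithmetic is on integers; with `L` the bit length of the input, all values are at most
`2 ^ (L ^ 2 + 4 * L + 10)`, so every instruction costs `O(L ^ 2)`. -/

set_option linter.constructorNameAsVariable false

namespace RAM

theorem len_le_len {a b : ℤ} (h : |a| ≤ b) : len a ≤ len b := by
  unfold len
  have : a.natAbs ≤ b.natAbs := by
    rw [abs_le] at h
    omega
  have := Nat.size_le_size this
  omega

end RAM


namespace TourProgram

open RAM

/-! ### Variables and stores -/

/-- The integer variables of the program. -/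
inductive Var
  | n | nn | m | rn | rd | pr | big | cap | k | t | i | j | b | bv | x | y | z | f | a0 | mask | it
  deriving DecidableEq

/-- The arrays of the program. The order matters: `inp` is array `0`, where the input stands, and
`out` is array `1`, where the output is expected. -/
inductive Arr
  | inp | out | dist | cost | act | g | p | v | d | par | done | pw | tab | nxt
  deriving DecidableEq

/-- The number of a variable. -/
def Var.idx (x : Var) : ℕ := x.ctorIdx

/-- The number of the machine array that represents an array. -/
def Arr.idx (a : Arr) : ℕ := a.ctorIdx

theorem Var.idx_injective : Function.Injective Var.idx := by
  intro a b h
  cases a <;> cases b <;> first | rfl | (exfalso; revert h; decide)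

theorem Arr.idx_injective : Function.Injective Arr.idx := by
  intro a b h
  cases a <;> cases b <;> first | rfl | (exfalso; revert h; decide)

/-- The part of a store that programs talk about: the values of the variables and the arrays. -/
@[ext] structure St where
  reg : Var → ℤ
  arr : Arr → ℤ → ℤ

/-- Assignment to a variable. -/
def St.set (s : St) (x : Var) (v : ℤ) : St :=
  { s with reg := fun y => if y = x then v else s.reg y }

/-- Assignment to an array cell. -/
def St.put (s : St) (a : Arr) (i v : ℤ) : St :=
  { s with arr := fun b j => if b = a ∧ j = i then v else s.arr b j }

@[simp] theorem St.set_reg (s : St) (x y : Var) (v : ℤ) :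
    (s.set x v).reg y = if y = x then v else s.reg y := rfl
@[simp] theorem St.set_arr (s : St) (x : Var) (v : ℤ) : (s.set x v).arr = s.arr := rfl
@[simp] theorem St.put_reg (s : St) (a : Arr) (i v : ℤ) : (s.put a i v).reg = s.reg := rfl
@[simp] theorem St.put_arr (s : St) (a b : Arr) (i j v : ℤ) :
    (s.put a i v).arr b j = if b = a ∧ j = i then v else s.arr b j := rfl

/-- Variable `x` lives in register `2 * x.idx`; the odd registers hold intermediate results. -/
def proj (S : Store) : St := ⟨fun x => S.reg (2 * x.idx), fun a => S.arr a.idx⟩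

/-- All values in the store have absolute value at most `W`. -/
structure Bdd (W : ℤ) (S : Store) : Prop where
  one : 1 ≤ W
  reg : ∀ x, |S.reg x| ≤ W
  arr : ∀ a i, |S.arr a i| ≤ W

theorem Bdd.setReg {W : ℤ} {S : Store} (h : Bdd W S) (x : ℕ) {v : ℤ} (hv : |v| ≤ W) :
    Bdd W (S.setReg x v) where
  one := h.one
  reg y := by
    by_cases e : y = x
    · subst e; simpa [Store.setReg] using hv
    · simpa [Store.setReg, Function.update_of_ne e] using h.reg y
  arr := h.arr

theorem Bdd.setArr {W : ℤ} {S : Store} (h : Bdd W S) (a : ℕ) (i : ℤ) {v : ℤ} (hv : |v| ≤ W) :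
    Bdd W (S.setArr a i v) where
  one := h.one
  reg := h.reg
  arr b j := by
    simp only [Store.setArr, Function.update_apply]
    split_ifs with h1
    · simp only [Function.update_apply]
      split_ifs
      · exact hv
      · exact h.arr _ _
    · exact h.arr _ _

theorem proj_setReg_odd (S : Store) (t : ℕ) (v : ℤ) : proj (S.setReg (2 * t + 1) v) = proj S := by
  ext x
  · simp only [proj, Store.setReg]
    rw [Function.update_of_ne (by omega)]
  · rfl

theorem proj_setReg (S : Store) (x : Var) (v : ℤ) :
    proj (S.setReg (2 * x.idx) v) = (proj S).set x v := by
  ext y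
  · simp only [proj, Store.setReg, St.set, Function.update_apply]
    by_cases h : y = x
    · simp [h]
    · have : y.idx ≠ x.idx := fun e => h (Var.idx_injective e)
      simp [h, this]
  · rfl

theorem proj_setArr (S : Store) (a : Arr) (i v : ℤ) :
    proj (S.setArr a.idx i v) = (proj S).put a i v := by
  ext b j
  · rfl
  · simp only [proj, Store.setArr, St.put, Function.update_apply]
    by_cases h : b = a
    · simp [h, Function.update_apply]
    · have : b.idx ≠ a.idx := fun e => h (Arr.idx_injective e)
      simp [h, this]

/-! ### Expressions -/

/-- Integer expressions over variables, literals and array reads. -/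
inductive Ex
  | lit (c : ℤ)
  | var (x : Var)
  | get (a : Arr) (e : Ex)
  | bin (o : Op) (e f : Ex)

namespace Ex

instance (k : ℕ) : OfNat Ex k := ⟨.lit k⟩
instance : Add Ex := ⟨.bin .plus⟩
instance : Sub Ex := ⟨.bin .minus⟩
instance : Mul Ex := ⟨.bin .times⟩
instance : Div Ex := ⟨.bin .quot⟩

/-- The value of an expression. -/
def eval (s : St) : Ex → ℤ
  | lit c => c
  | var x => s.reg x
  | get a e => s.arr a (e.eval s)
  | bin o e f => o.eval (e.eval s) (f.eval s)

/-- No intermediate result of the evaluation exceeds `W` in absolute value. -/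
def ok (W : ℤ) (s : St) : Ex → Prop
  | lit c => |c| ≤ W
  | var _ => True
  | get _ e => e.ok W s
  | bin o e f => e.ok W s ∧ f.ok W s ∧ |o.eval (e.eval s) (f.eval s)| ≤ W

variable (s : St) (W : ℤ) (e f : Ex)

@[simp] theorem eval_lit (c : ℤ) : (lit c).eval s = c := rfl
@[simp] theorem eval_ofNat (k : ℕ) : (no_index (OfNat.ofNat k) : Ex).eval s = (k : ℤ) := rfl
@[simp] theorem eval_var (x : Var) : (var x).eval s = s.reg x := rfl
@[simp] theorem eval_get (a : Arr) : (get a e).eval s = s.arr a (e.eval s) := rfl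
@[simp] theorem eval_add : (e + f).eval s = e.eval s + f.eval s := rfl
@[simp] theorem eval_sub : (e - f).eval s = e.eval s - f.eval s := rfl
@[simp] theorem eval_mul : (e * f).eval s = e.eval s * f.eval s := rfl
@[simp] theorem eval_div : (e / f).eval s = e.eval s / f.eval s := rfl
@[simp] theorem ok_lit (c : ℤ) : (lit c).ok W s ↔ |c| ≤ W := Iff.rfl
@[simp] theorem ok_ofNat (k : ℕ) : (no_index (OfNat.ofNat k) : Ex).ok W s ↔ (k : ℤ) ≤ W := by
  change |(k : ℤ)| ≤ W ↔ _
  simp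
@[simp] theorem ok_var (x : Var) : (var x).ok W s := trivial
@[simp] theorem ok_get (a : Arr) : (get a e).ok W s ↔ e.ok W s := Iff.rfl
@[simp] theorem ok_add :
    (e + f).ok W s ↔ e.ok W s ∧ f.ok W s ∧ |e.eval s + f.eval s| ≤ W := Iff.rfl
@[simp] theorem ok_sub :
    (e - f).ok W s ↔ e.ok W s ∧ f.ok W s ∧ |e.eval s - f.eval s| ≤ W := Iff.rfl
@[simp] theorem ok_mul :
    (e * f).ok W s ↔ e.ok W s ∧ f.ok W s ∧ |e.eval s * f.eval s| ≤ W := Iff.rfl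
@[simp] theorem ok_div :
    (e / f).ok W s ↔ e.ok W s ∧ f.ok W s ∧ |e.eval s / f.eval s| ≤ W := Iff.rfl

/-- Code that leaves the value of the expression in register `2 * t + 1` and uses only odd registers
from there on. -/
def comp : Ex → ℕ → Prog
  | lit c, t => .const (2 * t + 1) c
  | var x, t => .seq (.const (2 * t + 1) 0) (.arith .plus (2 * t + 1) (2 * x.idx) (2 * t + 1))
  | get a e, t => .seq (e.comp t) (.load (2 * t + 1) a.idx (2 * t + 1))
  | bin o e f, t => .seq (e.comp t) (.seq (f.comp (t + 1))
      (.arith o (2 * t + 1) (2 * t + 1) (2 * (t + 1) + 1)))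

/-- The number of instructions in the code of an expression. -/
def size : Ex → ℕ
  | lit _ => 1
  | var _ => 2
  | get _ e => e.size + 1
  | bin _ e f => e.size + f.size + 1

end Ex

/-- The largest cost of a single instruction on values bounded by `W`. -/
def unit (W : ℤ) : ℕ := 1 + 2 * len W

theorem setReg_reg_self (S : Store) (x : ℕ) (v : ℤ) : (S.setReg x v).reg x = v := by
  simp [Store.setReg]

theorem setReg_reg_of_ne (S : Store) {x y : ℕ} (v : ℤ) (h : y ≠ x) :
    (S.setReg x v).reg y = S.reg y := by
  simp [Store.setReg, Function.update_of_ne h]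

theorem unit_bound {W a b : ℤ} (ha : |a| ≤ W) (hb : |b| ≤ W) : 1 + len a + len b ≤ unit W := by
  have := len_le_len ha
  have := len_le_len hb
  unfold unit; omega

theorem unit_bound_one {W a : ℤ} (ha : |a| ≤ W) : 1 + len a ≤ unit W := by
  have := len_le_len ha
  unfold unit; omega

/-- The code of an expression computes its value, in at most `e.size` instructions, without changing
variables or arrays. -/
theorem Ex.comp_spec {W : ℤ} (e : Ex) (t : ℕ) (S : Store) (hB : Bdd W S) (hok : e.ok W (proj S)) :
    ∃ S' c, Exec (e.comp t) S S' c ∧ Bdd W S' ∧ proj S' = proj S ∧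
      (∀ x < 2 * t + 1, S'.reg x = S.reg x) ∧ S'.reg (2 * t + 1) = e.eval (proj S) ∧
      c ≤ e.size * unit W := by
  induction e generalizing t S with
  | lit c =>
    refine ⟨_, _, .const _ c S, hB.setReg _ hok, proj_setReg_odd _ _ _, fun x hx => ?_, ?_, ?_⟩
    · exact setReg_reg_of_ne _ _ (by omega)
    · exact setReg_reg_self _ _ _
    · have := unit_bound_one (W := W) (a := c) hok
      simpa [Ex.size] using this
  | var x =>
    have h0 : |(0 : ℤ)| ≤ W := by have := hB.one; simp; omega
    refine ⟨_, _, .seq (.const _ 0 S) (.arith .plus _ _ _ _), ?_, ?_, fun y hy => ?_, ?_, ?_⟩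
    · refine (hB.setReg _ h0).setReg _ ?_
      rw [setReg_reg_self, setReg_reg_of_ne _ _ (by omega)]
      simpa [Op.eval] using hB.reg _
    · rw [proj_setReg_odd, proj_setReg_odd]
    · rw [setReg_reg_of_ne _ _ (by omega), setReg_reg_of_ne _ _ (by omega)]
    · rw [setReg_reg_self, setReg_reg_self, setReg_reg_of_ne _ _ (by omega)]
      simp [Op.eval, proj]
    · have h1 := unit_bound_one h0
      have h2 := unit_bound ((hB.setReg (2 * t + 1) h0).reg (2 * x.idx))
        ((hB.setReg (2 * t + 1) h0).reg (2 * t + 1))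
      simp only [Ex.size]; omega
  | get a e ih =>
    obtain ⟨S1, c1, h1, hB1, hp, hr, hv, hc⟩ := ih t S hB hok
    refine ⟨_, _, .seq h1 (.load _ _ _ _), hB1.setReg _ (hB1.arr _ _), ?_, fun y hy => ?_, ?_, ?_⟩
    · rw [proj_setReg_odd, hp]
    · rw [setReg_reg_of_ne _ _ (by omega), hr y hy]
    · rw [setReg_reg_self, hv, Ex.eval_get, ← hp]; rfl
    · have := unit_bound (hB1.reg (2 * t + 1)) (hB1.arr a.idx (S1.reg (2 * t + 1)))
      simp only [Ex.size, Nat.add_mul]; omega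
  | bin o e f ihe ihf =>
    obtain ⟨S1, c1, h1, hB1, hp, hr, hv, hc⟩ := ihe t S hB hok.1
    obtain ⟨S2, c2, h2, hB2, hp2, hr2, hv2, hc2⟩ := ihf (t + 1) S1 hB1 (by rw [hp]; exact hok.2.1)
    have e1 : S2.reg (2 * t + 1) = e.eval (proj S) := by rw [hr2 _ (by omega), hv]
    have e2 : S2.reg (2 * (t + 1) + 1) = f.eval (proj S) := by rw [hv2, hp]
    refine ⟨_, _, .seq h1 (.seq h2 (.arith o _ _ _ _)), hB2.setReg _ ?_, ?_, fun y hy => ?_, ?_, ?_⟩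
    · rw [e1, e2]; exact hok.2.2
    · rw [proj_setReg_odd, hp2, hp]
    · rw [setReg_reg_of_ne _ _ (by omega), hr2 _ (by omega), hr y hy]
    · rw [setReg_reg_self, e1, e2]; rfl
    · have := unit_bound (hB2.reg (2 * t + 1)) (hB2.reg (2 * (t + 1) + 1))
      simp only [Ex.size, Nat.add_mul]; omega

/-! ### Commands -/

/-- Programs with assignments, conditionals (`ite e c d` runs `c` if `0 < e`) and counting loops
(`loop x n c` runs `c` for `x = 0, …, n - 1`). -/
inductive Cmd
  | skip
  | set (x : Var) (e : Ex)
  | put (a : Arr) (i e : Ex)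
  | seq (c d : Cmd)
  | ite (e : Ex) (c d : Cmd)
  | loop (x n : Var) (c : Cmd)

infixr:60 ";;" => Cmd.seq

namespace Cmd

/-- The code of a command. During a loop over `x`, register `1` holds `n - x` whenever it is
tested. -/
def comp : Cmd → Prog
  | skip => .const 1 0
  | set x e => .seq (e.comp 0) (.seq (.const 3 0) (.arith .plus (2 * x.idx) 1 3))
  | put a i e => .seq (i.comp 0) (.seq (e.comp 1) (.store a.idx 1 3))
  | seq c d => .seq c.comp d.comp
  | ite e c d => .seq (e.comp 0) (.cond 1 c.comp d.comp)
  | .loop x n c => .seq (.const (2 * x.idx) 0) (.seq (.arith .minus 1 (2 * n.idx) (2 * x.idx))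
      (.loop 1 (.seq c.comp (.seq (.const 1 1) (.seq (.arith .plus (2 * x.idx) (2 * x.idx) 1)
        (.arith .minus 1 (2 * n.idx) (2 * x.idx)))))))

/-- Which variables a command may change. -/
def wr : Cmd → Var → Bool
  | skip, _ => false
  | set x _, y => y == x
  | put _ _ _, _ => false
  | seq c d, y => c.wr y || d.wr y
  | ite _ c d, y => c.wr y || d.wr y
  | .loop x _ c, y => y == x || c.wr y

/-- Which arrays a command may change. -/
def wrArr : Cmd → Arr → Bool
  | skip, _ => false
  | set _ _, _ => false
  | put a _ _, b => b == a
  | seq c d, y => c.wrArr y || d.wrArr y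
  | ite _ c d, y => c.wrArr y || d.wrArr y
  | .loop _ _ c, y => c.wrArr y

/-- The number of instructions executed when the value of every loop bound `n` is at most `β n`. -/
def cost (β : Var → ℕ) : Cmd → ℕ
  | skip => 1
  | set _ e => e.size + 2
  | put _ i e => i.size + e.size + 1
  | seq c d => c.cost β + d.cost β
  | ite e c d => e.size + 1 + c.cost β + d.cost β
  | .loop _ n c => 3 + β n * (c.cost β + 4)

end Cmd

/-- `s'` arises from `s` by changing only what the command `c` may change. -/
structure Frame (c : Cmd) (s s' : St) : Prop where
  reg : ∀ x, c.wr x = false → s'.reg x = s.reg x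
  arr : ∀ a, c.wrArr a = false → s'.arr a = s.arr a

theorem Frame.refl (c : Cmd) (s : St) : Frame c s s := ⟨fun _ _ => rfl, fun _ _ => rfl⟩

theorem Frame.trans {c : Cmd} {s s' s'' : St} (h : Frame c s s') (h' : Frame c s' s'') :
    Frame c s s'' :=
  ⟨fun x hx => (h'.reg x hx).trans (h.reg x hx), fun a ha => (h'.arr a ha).trans (h.arr a ha)⟩

theorem Frame.weaken {c d : Cmd} {s s' : St} (h : Frame c s s')
    (hr : ∀ x, d.wr x = false → c.wr x = false) (ha : ∀ a, d.wrArr a = false → c.wrArr a = false) :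
    Frame d s s' :=
  ⟨fun x hx => h.reg x (hr x hx), fun a h' => h.arr a (ha a h')⟩

/-- Total correctness with cost: started in any store that is bounded by `W` and represents `s`,
the compiled command halts, the values stay bounded by `W`, at most `c.cost β` instructions are
executed, only what `c` may change is changed, and `Q` holds at the end. -/
def Triple (W : ℤ) (β : Var → ℕ) (s : St) (c : Cmd) (Q : St → Prop) : Prop :=
  ∀ S, proj S = s → Bdd W S → ∃ S' t, Exec c.comp S S' t ∧ Bdd W S' ∧ Frame c s (proj S') ∧
    t ≤ c.cost β * unit W ∧ Q (proj S')

/-- Weakest preconditions: computed by recursion for code without loops; for a loop, the condition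
is the correctness statement itself, which `wp_for` reduces to an invariant. -/
def wp (W : ℤ) (β : Var → ℕ) : Cmd → St → (St → Prop) → Prop
  | .skip, s, Q => Q s
  | .set x e, s, Q => e.ok W s ∧ Q (s.set x (e.eval s))
  | .put a i e, s, Q => i.ok W s ∧ e.ok W s ∧ Q (s.put a (i.eval s) (e.eval s))
  | .seq c d, s, Q => wp W β c s fun s' => wp W β d s' Q
  | .ite e c d, s, Q => e.ok W s ∧ (0 < e.eval s → wp W β c s Q) ∧ (¬ 0 < e.eval s → wp W β d s Q)
  | .loop x n c, s, Q => Triple W β s (.loop x n c) Q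

variable {W : ℤ} {β : Var → ℕ} {s : St} {c : Cmd} {Q Q' : St → Prop}

/-- The rule of consequence; it also supplies that only what the command may change has changed. -/
theorem wp_mono (c : Cmd) (s : St) (h : wp W β c s Q)
    (hQ : ∀ s', Frame c s s' → Q s' → Q' s') : wp W β c s Q' := by
  induction c generalizing s Q Q' with
  | skip => exact hQ _ (Frame.refl _ _) h
  | set x e =>
    refine ⟨h.1, hQ _ ⟨fun y hy => ?_, fun _ _ => rfl⟩ h.2⟩
    simp only [Cmd.wr, beq_eq_false_iff_ne] at hy
    simp [hy]
  | put a i e =>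
    refine ⟨h.1, h.2.1, hQ _ ⟨fun _ _ => rfl, fun b hb => ?_⟩ h.2.2⟩
    simp only [Cmd.wrArr, beq_eq_false_iff_ne] at hb
    funext j
    simp [hb]
  | seq c d ihc ihd =>
    refine ihc _ h fun s1 f1 h1 => ihd _ h1 fun s2 f2 h2 => hQ _ ?_ h2
    exact (f1.weaken (by simp +contextual [Cmd.wr]) (by simp +contextual [Cmd.wrArr])).trans
      (f2.weaken (by simp +contextual [Cmd.wr]) (by simp +contextual [Cmd.wrArr]))
  | ite e c d ihc ihd =>
    refine ⟨h.1, fun he => ihc _ (h.2.1 he) fun s' f => hQ s' ?_,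
      fun he => ihd _ (h.2.2 he) fun s' f => hQ s' ?_⟩
    · exact f.weaken (by simp +contextual [Cmd.wr]) (by simp +contextual [Cmd.wrArr])
    · exact f.weaken (by simp +contextual [Cmd.wr]) (by simp +contextual [Cmd.wrArr])
  | loop x n c ih =>
    intro S hS hB
    obtain ⟨S', t, h1, h2, h3, h4, h5⟩ := h S hS hB
    exact ⟨S', t, h1, h2, h3, h4, hQ _ h3 h5⟩

theorem triple_of_wp (c : Cmd) (s : St) (h : wp W β c s Q) : Triple W β s c Q := by
  induction c generalizing s Q with
  | skip =>
    intro S hS hB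
    have h0 : |(0 : ℤ)| ≤ W := by have := hB.one; simp; omega
    have hp : proj (S.setReg 1 0) = s := (proj_setReg_odd S 0 0).trans hS
    refine ⟨_, _, .const 1 0 S, hB.setReg _ h0, ?_, ?_, ?_⟩
    · rw [hp]; exact Frame.refl _ _
    · simpa [Cmd.cost] using unit_bound_one h0
    · rw [hp]; exact h
  | set x e =>
    have hF : Frame (.set x e) s (s.set x (e.eval s)) :=
      ⟨fun y hy => by simp only [Cmd.wr, beq_eq_false_iff_ne] at hy; simp [hy], fun _ _ => rfl⟩
    intro S hS hB
    subst hS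
    obtain ⟨S1, c1, h1, hB1, hp, hr, hv, hc⟩ := e.comp_spec 0 S hB h.1
    have h0 : |(0 : ℤ)| ≤ W := by have := hB.one; simp; omega
    have hB2 := hB1.setReg 3 h0
    have ev : Op.plus.eval ((S1.setReg 3 0).reg 1) ((S1.setReg 3 0).reg 3) = e.eval (proj S) := by
      rw [setReg_reg_self, setReg_reg_of_ne _ _ (by omega)]
      simpa [Op.eval] using hv
    have hp2 : proj ((S1.setReg 3 0).setReg (2 * x.idx) (e.eval (proj S))) =
        (proj S).set x (e.eval (proj S)) := by
      rw [proj_setReg, proj_setReg_odd S1 1, hp]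
    refine ⟨_, _, .seq h1 (.seq (.const 3 0 S1) (.arith .plus (2 * x.idx) 1 3 _)), ?_, ?_, ?_, ?_⟩
    · rw [ev, ← hv]
      exact hB2.setReg _ (hB1.reg _)
    · rw [ev, hp2]; exact hF
    · have i1 := unit_bound_one h0
      have i2 := unit_bound (hB2.reg 1) (hB2.reg 3)
      simp only [Cmd.cost, Nat.add_mul]; omega
    · rw [ev, hp2]; exact h.2
  | put a i e =>
    have hF : Frame (.put a i e) s (s.put a (i.eval s) (e.eval s)) :=
      ⟨fun _ _ => rfl, fun b hb => by
        simp only [Cmd.wrArr, beq_eq_false_iff_ne] at hb; funext j; simp [hb]⟩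
    intro S hS hB
    subst hS
    obtain ⟨S1, c1, h1, hB1, hp, hr, hv, hc⟩ := i.comp_spec 0 S hB h.1
    obtain ⟨S2, c2, h2, hB2, hp2, hr2, hv2, hc2⟩ := e.comp_spec 1 S1 hB1 (by rw [hp]; exact h.2.1)
    have e1 : S2.reg 1 = i.eval (proj S) := by rw [hr2 _ (by omega)]; exact hv
    have e2 : S2.reg 3 = e.eval (proj S) := by rw [← hp]; exact hv2
    have hp3 : proj (S2.setArr a.idx (S2.reg 1) (S2.reg 3)) =
        (proj S).put a (i.eval (proj S)) (e.eval (proj S)) := by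
      rw [proj_setArr, hp2, hp, e1, e2]
    refine ⟨_, _, .seq h1 (.seq h2 (.store _ _ _ _)), hB2.setArr _ _ (hB2.reg _), ?_, ?_, ?_⟩
    · rw [hp3]; exact hF
    · have := unit_bound (hB2.reg 1) (hB2.reg 3)
      simp only [Cmd.cost, Nat.add_mul]; omega
    · rw [hp3]; exact h.2.2
  | seq c d ihc ihd =>
    intro S hS hB
    obtain ⟨S1, t1, h1, hB1, f1, hc1, hQ1⟩ := ihc _ h S hS hB
    obtain ⟨S2, t2, h2, hB2, f2, hc2, hQ2⟩ := ihd _ hQ1 S1 rfl hB1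
    refine ⟨S2, _, .seq h1 h2, hB2, ?_, ?_, hQ2⟩
    · exact (f1.weaken (by simp +contextual [Cmd.wr]) (by simp +contextual [Cmd.wrArr])).trans
        (f2.weaken (by simp +contextual [Cmd.wr]) (by simp +contextual [Cmd.wrArr]))
    · simp only [Cmd.cost, Nat.add_mul]; omega
  | ite e c d ihc ihd =>
    intro S hS hB
    subst hS
    obtain ⟨S1, c1, h1, hB1, hp, hr, hv, hc⟩ := e.comp_spec 0 S hB h.1
    have hu := unit_bound_one (hB1.reg 1)
    by_cases he : 0 < e.eval (proj S)
    · obtain ⟨S2, t2, h2, hB2, f2, hc2, hQ2⟩ := ihc _ (h.2.1 he) S1 hp hB1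
      refine ⟨S2, _, .seq h1 (.cond_pos (by rw [← hv] at he; exact he) h2), hB2, ?_, ?_, hQ2⟩
      · exact f2.weaken (by simp +contextual [Cmd.wr]) (by simp +contextual [Cmd.wrArr])
      · simp only [Cmd.cost, Nat.add_mul]; omega
    · obtain ⟨S2, t2, h2, hB2, f2, hc2, hQ2⟩ := ihd _ (h.2.2 he) S1 hp hB1
      refine ⟨S2, _, .seq h1 (.cond_neg (by rw [← hv] at he; exact he) h2), hB2, ?_, ?_, hQ2⟩
      · exact f2.weaken (by simp +contextual [Cmd.wr]) (by simp +contextual [Cmd.wrArr])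
      · simp only [Cmd.cost, Nat.add_mul]; omega
  | loop x n c ih => exact h

/-- The invariant rule for counting loops. -/
theorem wp_for {x n : Var} (P : ℕ → St → Prop) (N : ℕ) (hN : s.reg n = N) (hβ : N ≤ β n)
    (h0 : P 0 (s.set x 0))
    (hstep : ∀ i < N, ∀ s', Frame (.loop x n c) s s' → s'.reg x = i → P i s' →
      wp W β c s' fun s'' => P (i + 1) (s''.set x (i + 1)))
    (hend : ∀ s', Frame (.loop x n c) s s' → s'.reg x = N → P N s' → Q s')
    (hx : c.wr x = false := by rfl) (hn : c.wr n = false := by rfl)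
    (hne : n ≠ x := by decide) :
    wp W β (.loop x n c) s Q := by
  intro S hS hB
  have hnf : (Cmd.loop x n c).wr n = false := by simp [Cmd.wr, hne, hn]
  have hNW : |(N : ℤ)| ≤ W := by
    have := hB.reg (2 * n.idx)
    rw [← hN, ← hS]; exact this
  have h1W : |(1 : ℤ)| ≤ W := by simpa using hB.one
  have h0W : |(0 : ℤ)| ≤ W := by have := hB.one; simp; omega
  rw [Nat.abs_cast] at hNW
  have key : ∀ d i : ℕ, i + d = N → ∀ S1, Bdd W S1 → Frame (.loop x n c) s (proj S1) →
      (proj S1).reg x = i → S1.reg 1 = N - i → P i (proj S1) →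
      ∃ S2 t, Exec (.loop 1 (.seq c.comp (.seq (.const 1 1)
        (.seq (.arith .plus (2 * x.idx) (2 * x.idx) 1)
        (.arith .minus 1 (2 * n.idx) (2 * x.idx)))))) S1 S2 t ∧ Bdd W S2 ∧
        Frame (.loop x n c) s (proj S2) ∧ t ≤ (1 + d * (c.cost β + 4)) * unit W ∧
        (proj S2).reg x = N ∧ P N (proj S2) := by
    intro d
    induction d with
    | zero =>
      intro i hi S1 hB1 hf hx1 h1 hP
      have : i = N := by omega
      subst this
      refine ⟨S1, _, .loop_done (by rw [h1]; simp), hB1, hf, ?_, hx1, hP⟩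
      simpa using unit_bound_one (hB1.reg 1)
    | succ d ihd =>
      intro i hi S1 hB1 hf hx1 h1 hP
      obtain ⟨S2, t2, he2, hB2, f2, hc2, hQ2⟩ :=
        triple_of_wp c _ (hstep i (by omega) _ hf hx1 hP) S1 rfl hB1
      have f2' : Frame (.loop x n c) s (proj S2) :=
        hf.trans (f2.weaken (by simp +contextual [Cmd.wr]) (by simp +contextual [Cmd.wrArr]))
      have hx2 : S2.reg (2 * x.idx) = i := (f2.reg x hx).trans hx1
      have hn2 : S2.reg (2 * n.idx) = N := (f2'.reg n hnf).trans hN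
      have hidx : 2 * n.idx ≠ 2 * x.idx := fun e => hne (Var.idx_injective (by omega))
      have hB3 := hB2.setReg 1 h1W
      have ev3 : Op.plus.eval ((S2.setReg 1 1).reg (2 * x.idx)) ((S2.setReg 1 1).reg 1) =
          (i + 1 : ℕ) := by
        rw [setReg_reg_self, setReg_reg_of_ne _ _ (by omega), hx2]; simp [Op.eval]
      have hB4 : Bdd W ((S2.setReg 1 1).setReg (2 * x.idx) ((i + 1 : ℕ) : ℤ)) :=
        hB3.setReg _ (by rw [Nat.abs_cast]; omega)
      have ev4 : Op.minus.eval (((S2.setReg 1 1).setReg (2 * x.idx) ((i + 1 : ℕ) : ℤ)).reg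
          (2 * n.idx)) (((S2.setReg 1 1).setReg (2 * x.idx) ((i + 1 : ℕ) : ℤ)).reg (2 * x.idx)) =
          N - (i + 1 : ℕ) := by
        rw [setReg_reg_self, setReg_reg_of_ne _ _ hidx, setReg_reg_of_ne _ _ (by omega), hn2]
        simp [Op.eval]
      have hB5 : Bdd W (((S2.setReg 1 1).setReg (2 * x.idx) ((i + 1 : ℕ) : ℤ)).setReg 1
          (N - (i + 1 : ℕ))) := hB4.setReg _ (by rw [abs_le]; omega)
      have hp5 : proj (((S2.setReg 1 1).setReg (2 * x.idx) ((i + 1 : ℕ) : ℤ)).setReg 1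
          (N - (i + 1 : ℕ))) = (proj S2).set x (i + 1) := by
        rw [proj_setReg_odd _ 0, proj_setReg, proj_setReg_odd _ 0]; simp
      obtain ⟨S6, t6, he6, hB6, hf6, hc6, hx6, hP6⟩ := ihd (i + 1) (by omega) _ hB5
        (by
          rw [hp5]
          refine f2'.trans ⟨fun y hy => ?_, fun _ _ => rfl⟩
          simp only [Cmd.wr, Bool.or_eq_false_iff, beq_eq_false_iff_ne] at hy
          simp [hy.1])
        (by rw [hp5]; simp) (by rw [setReg_reg_self]) (by rw [hp5]; exact hQ2)
      have hE := Exec.seq he2 (Exec.seq (Exec.const 1 1 _)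
        (Exec.seq (Exec.arith .plus (2 * x.idx) (2 * x.idx) 1 _)
          (Exec.arith .minus 1 (2 * n.idx) (2 * x.idx) _)))
      rw [ev3, ev4] at hE
      refine ⟨S6, _, .loop_step (by rw [h1]; omega) hE he6, hB6, hf6, ?_, hx6, hP6⟩
      · have i1 := unit_bound_one (hB1.reg 1)
        have i2 := unit_bound_one h1W
        have i3 := unit_bound (hB3.reg (2 * x.idx)) (hB3.reg 1)
        have i4 := unit_bound (hB4.reg (2 * n.idx)) (hB4.reg (2 * x.idx))
        simp only [Nat.add_mul, Nat.one_mul] at hc6 ⊢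
        omega
  have hBx := hB.setReg (2 * x.idx) h0W
  have hidx : 2 * n.idx ≠ 2 * x.idx := fun e => hne (Var.idx_injective (by omega))
  have ev : Op.minus.eval ((S.setReg (2 * x.idx) 0).reg (2 * n.idx))
      ((S.setReg (2 * x.idx) 0).reg (2 * x.idx)) = N := by
    rw [setReg_reg_self, setReg_reg_of_ne _ _ hidx, ← hN, ← hS]; simp [Op.eval, proj]
  have hp : proj ((S.setReg (2 * x.idx) 0).setReg 1 N) = s.set x 0 := by
    rw [proj_setReg_odd _ 0, proj_setReg, hS]
  obtain ⟨S2, t2, he2, hB2, hf2, hc2, hx2, hP2⟩ := key N 0 (by omega)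
    ((S.setReg (2 * x.idx) 0).setReg 1 N) (hBx.setReg _ (by rwa [Nat.abs_cast]))
    (by
      rw [hp]
      refine ⟨fun y hy => ?_, fun _ _ => rfl⟩
      simp only [Cmd.wr, Bool.or_eq_false_iff, beq_eq_false_iff_ne] at hy
      simp [hy.1])
    (by rw [hp]; simp) (by rw [setReg_reg_self]; simp) (by rw [hp]; exact h0)
  rw [← ev] at he2
  refine ⟨S2, _, .seq (.const _ 0 S) (.seq (.arith .minus _ _ _ _) he2), hB2, hf2, ?_,
    hend _ hf2 hx2 hP2⟩
  · have i1 := unit_bound_one h0W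
    have i2 := unit_bound (hBx.reg (2 * n.idx)) (hBx.reg (2 * x.idx))
    have i3 : N * (c.cost β + 4) * unit W ≤ β n * (c.cost β + 4) * unit W := by gcongr
    simp only [Cmd.cost, Nat.add_mul, Nat.one_mul] at hc2 i3 ⊢
    omega

/-! ### Polynomial cost -/

namespace Cmd

/-- The coefficient of a polynomial bound for the cost. -/
def coeff : Cmd → ℕ
  | skip => 1
  | set _ e => e.size + 2
  | put _ i e => i.size + e.size + 1
  | seq c d => c.coeff + d.coeff
  | ite e c d => e.size + 1 + c.coeff + d.coeff
  | .loop _ _ c => c.coeff + 7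

/-- The exponent of a polynomial bound for the cost. -/
def depth : Cmd → ℕ
  | skip => 0
  | set _ _ => 0
  | put _ _ _ => 0
  | seq c d => c.depth + d.depth
  | ite _ c d => c.depth + d.depth
  | .loop _ _ c => c.depth + 1

/-- If the bounds of all loops are at most `X`, then the cost is polynomial in `X`. -/
theorem cost_le (β : Var → ℕ) (X : ℕ) (hX : 1 ≤ X) (c : Cmd) (hβ : ∀ x, β x ≤ X) :
    c.cost β ≤ c.coeff * X ^ c.depth := by
  have add_pow_le (a b i j : ℕ) : a * X ^ i + b * X ^ j ≤ (a + b) * X ^ (i + j) := by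
    have h1 : X ^ i ≤ X ^ (i + j) := Nat.pow_le_pow_right hX (by omega)
    have h2 : X ^ j ≤ X ^ (i + j) := Nat.pow_le_pow_right hX (by omega)
    rw [Nat.add_mul]
    gcongr
  induction c with
  | skip => simp [cost, coeff, depth]
  | set x e => simp [cost, coeff, depth]
  | put a i e => simp [cost, coeff, depth]
  | seq c d ihc ihd => exact (Nat.add_le_add ihc ihd).trans (add_pow_le _ _ _ _)
  | ite e c d ihc ihd =>
    have h1 := add_pow_le c.coeff d.coeff c.depth d.depth
    have h2 : 1 ≤ X ^ (c.depth + d.depth) := Nat.one_le_pow _ _ hX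
    simp only [cost, coeff, depth]
    nlinarith
  | loop x n c ih =>
    have h1 : 1 ≤ X ^ c.depth := Nat.one_le_pow _ _ hX
    have h2 : β n * (c.cost β + 4) ≤ X * (c.coeff * X ^ c.depth + 4) := by
      gcongr
      exact hβ n
    have h3 : X ≤ X * X ^ c.depth := Nat.le_mul_of_pos_right _ h1
    have h4 : 1 ≤ X * X ^ c.depth := Nat.mul_pos hX h1
    simp only [cost, coeff, depth, pow_succ']
    nlinarith

end Cmd

end TourProgram

open Equiv Equiv.Perm

/-! ### Cycles of permutations -/

namespace Equiv.Perm

variable {α : Type*} {f g h π : Perm α} {s A : Finset α} {x y a b j k : α}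

/-- The permutation moves the elements of `s` in one cycle and fixes all others. -/
structure IsTourOn (f : Perm α) (s : Finset α) : Prop where
  fixed : ∀ y ∉ s, f y = y
  sameCycle : ∀ x ∈ s, ∀ y ∈ s, SameCycle f x y

theorem apply_mem_of_fixed (hfix : ∀ y ∉ s, f y = y) (hx : x ∈ s) : f x ∈ s := by
  by_contra h
  have := f.injective (hfix _ h)
  exact h (by rwa [this])

theorem IsTourOn.apply_mem (hf : f.IsTourOn s) (hx : x ∈ s) : f x ∈ s :=
  apply_mem_of_fixed hf.fixed hx

theorem sameCycle_step (f : Perm α) (x : α) : SameCycle f x (f x) := by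
  rw [sameCycle_apply_right]

/-- A tour through at least two elements fixes none of them. -/
theorem IsTourOn.apply_ne (hf : f.IsTourOn s) (hs : 2 ≤ s.card) (hx : x ∈ s) : f x ≠ x := by
  intro e
  obtain ⟨y, hy, hne⟩ := Finset.exists_mem_ne (by omega : 1 < s.card) x
  exact hne ((hf.sameCycle x hx y hy).eq_of_left e).symm

/-- If `π` moves every representative, at most half of them are least in their cycle. -/
theorem two_mul_card_least_le [LinearOrder α] {A' : Finset α} (hπ : ∀ y ∉ A, π y = y)
    (hne : ∀ a ∈ A, π a ≠ a)
    (hA' : ∀ a, a ∈ A' ↔ a ∈ A ∧ ∀ b, SameCycle π a b → a ≤ b) :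
    2 * A'.card ≤ A.card := by
  classical
  have hsub : A' ⊆ A := fun a ha => ((hA' a).1 ha).1
  -- `π` maps the least elements of the cycles to elements that are not least.
  have h : A'.card ≤ (A \ A').card := by
    refine Finset.card_le_card_of_injOn π (fun a ha => ?_) π.injective.injOn
    obtain ⟨haA, hamin⟩ := (hA' a).1 ha
    refine Finset.mem_sdiff.2 ⟨apply_mem_of_fixed hπ haA, fun hm => hne a haA ?_⟩
    exact le_antisymm (((hA' _).1 hm).2 a (sameCycle_step π a).symm) (hamin _ (sameCycle_step π a))
  have := Finset.card_sdiff_add_card_eq_card hsub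
  omega

variable [Fintype α]

/-- A reflexive and transitive relation that holds along every step of a permutation holds along its
cycles. -/
theorem SameCycle.rel_of_step {r : α → α → Prop} (hr : ∀ x, r x x)
    (ht : ∀ x y z, r x y → r y z → r x z) (hs : ∀ x ∈ s, f x ∈ s) (hstep : ∀ x ∈ s, r x (f x))
    (h : SameCycle f x y) (hx : x ∈ s) : y ∈ s ∧ r x y := by
  obtain ⟨i, -, rfl⟩ := h.exists_pow_eq'
  clear h
  induction i with
  | zero => exact ⟨hx, hr x⟩
  | succ i ih =>
    rw [pow_succ', mul_apply]
    exact ⟨hs _ ih.1, ht _ _ _ ih.2 (hstep _ ih.1)⟩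

theorem SameCycle.mem_of_fixed (hfix : ∀ y ∉ s, f y = y) (h : SameCycle f x y) (hx : x ∈ s) :
    y ∈ s :=
  (h.rel_of_step (r := fun _ _ => True) (fun _ => trivial) (fun _ _ _ _ _ => trivial)
    (fun _ => apply_mem_of_fixed hfix) (fun _ _ => trivial) hx).1

/-- Inserting a fixed point `k` behind `j` into a tour. -/
theorem IsTourOn.insert_after [DecidableEq α] (hf : f.IsTourOn s) (hj : j ∈ s) (hk : k ∉ s) :
    (f * swap j k).IsTourOn (insert k s) := by
  have hjk : j ≠ k := fun e => hk (e ▸ hj)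
  have ej : (f * swap j k) j = k := by simp [hf.fixed k hk]
  have ek : (f * swap j k) k = f j := by simp
  have eo (u : α) (h1 : u ≠ j) (h2 : u ≠ k) : (f * swap j k) u = f u := by
    simp [swap_apply_of_ne_of_ne h1 h2]
  have hstep (u : α) (hu : u ∈ s) : SameCycle (f * swap j k) u (f u) := by
    by_cases e : u = j
    · subst e
      have := (sameCycle_step (f * swap u k) u).trans (sameCycle_step _ _)
      rwa [ej, ek] at this
    · have := sameCycle_step (f * swap j k) u
      rwa [eo u e (fun h => hk (h ▸ hu))] at this
  have hcyc (u : α) (hu : u ∈ insert k s) : SameCycle (f * swap j k) j u := by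
    rcases Finset.mem_insert.1 hu with rfl | hu
    · have := sameCycle_step (f * swap j u) j
      rwa [ej] at this
    · exact ((hf.sameCycle j hj u hu).rel_of_step (r := SameCycle (f * swap j k))
        (fun _ => SameCycle.rfl) (fun _ _ _ h1 h2 => h1.trans h2)
        (fun u hu => hf.apply_mem hu) hstep hj).2
  refine ⟨fun u hu => ?_, fun u hu w hw => (hcyc u hu).symm.trans (hcyc w hw)⟩
  simp only [Finset.mem_insert, not_or] at hu
  rw [eo u (fun e => hu.2 (e ▸ hj)) hu.1, hf.fixed u hu.2]

/-- Bypassing the element `x` of a tour; `j` is the predecessor of `x`. -/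
theorem IsTourOn.bypass [DecidableEq α] (hf : f.IsTourOn s) (hjx : f j = x) :
    (f * swap j x).IsTourOn (s.erase x) := by
  have ex : (f * swap j x) x = x := by simp [hjx]
  have ej : (f * swap j x) j = f x := by simp
  have eo (u : α) (h1 : u ≠ j) (h2 : u ≠ x) : (f * swap j x) u = f u := by
    simp [swap_apply_of_ne_of_ne h1 h2]
  constructor
  · intro u hu
    by_cases hux : u = x
    · rw [hux, ex]
    · have hus : u ∉ s := fun h => hu (Finset.mem_erase.2 ⟨hux, h⟩)
      have : u ≠ j := by
        rintro rfl
        exact hux ((hf.fixed u hus).symm.trans hjx)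
      rw [eo u this hux, hf.fixed u hus]
  · intro u hu w hw
    obtain ⟨hux, hus⟩ := Finset.mem_erase.1 hu
    obtain ⟨hwx, hws⟩ := Finset.mem_erase.1 hw
    -- The steps of `f` from `u` to `w` are followed; the two steps `j → x → f x` become one.
    obtain ⟨i, -, hi⟩ := (hf.sameCycle u hus w hws).exists_pow_eq'
    induction i using Nat.strong_induction_on generalizing u with
    | _ i ih =>
      match i with
      | 0 => exact (show u = w by simpa using hi) ▸ SameCycle.rfl
      | 1 =>
        rw [pow_one] at hi
        have huj : u ≠ j := by rintro rfl; exact hwx (hi.symm.trans hjx)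
        rw [← hi, ← eo u huj hux]
        exact sameCycle_step _ _
      | i + 2 =>
        rw [pow_succ, mul_apply] at hi
        by_cases huj : u = j
        · rw [huj, hjx, pow_succ, mul_apply] at hi
          have hxx : f x ≠ x := by
            intro e
            have : x = j := f.injective (e.trans hjx.symm)
            exact hux (huj.trans this.symm)
          have hxs : x ∈ s := by
            have := hf.apply_mem hus
            rwa [huj, hjx] at this
          have := ih i (by omega) (f x) (Finset.mem_erase.2 ⟨hxx, hf.apply_mem hxs⟩) hxx
            (hf.apply_mem hxs) hi
          rw [← ej] at this
          exact (sameCycle_step _ u).trans (by rw [huj]; exact this)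
        · have hfx : f u ≠ x := fun e => huj (f.injective (e.trans hjx.symm))
          have := ih (i + 1) (by omega) (f u) (Finset.mem_erase.2 ⟨hfx, hf.apply_mem hus⟩) hfx
            (hf.apply_mem hus) hi
          rw [← eo u huj hux] at this
          exact (sameCycle_step _ _).trans this

/-- The set `A` contains exactly one element of every cycle of `g`. -/
structure IsTransversal (g : Perm α) (A : Finset α) : Prop where
  exists_mem : ∀ x, ∃ a ∈ A, SameCycle g x a
  unique : ∀ a ∈ A, ∀ b ∈ A, SameCycle g a b → a = b

/-- Composing `g` with a permutation `π` of representatives of the cycles of `g` concatenates the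
cycles of `g` as prescribed by `π`. -/
theorem IsTransversal.sameCycle_mul (hg : g.IsTransversal A) (hπ : ∀ y ∉ A, π y = y)
    (ha : a ∈ A) (hb : b ∈ A) (hxa : SameCycle g x a) (hyb : SameCycle g y b) :
    SameCycle (π * g) x y ↔ SameCycle π a b := by
  have hmemA (u : α) (hu : u ∈ A) : π u ∈ A := apply_mem_of_fixed hπ hu
  constructor
  · -- A step of `π * g` stays in a cycle of `g` or moves to the next one according to `π`.
    intro hxy
    have key : ∀ u v : α, SameCycle (π * g) u v → ∀ a ∈ A, ∀ b ∈ A, SameCycle g u a →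
        SameCycle g v b → SameCycle π a b := by
      intro u v huv
      refine (huv.rel_of_step (s := Finset.univ) (r := fun u v => ∀ a ∈ A, ∀ b ∈ A,
        SameCycle g u a → SameCycle g v b → SameCycle π a b) ?_ ?_ (fun _ _ => Finset.mem_univ _) ?_
        (Finset.mem_univ _)).2
      · intro u a ha b hb h1 h2
        rw [hg.unique a ha b hb (h1.symm.trans h2)]
      · intro u v w h1 h2 a ha b hb hua hwb
        obtain ⟨c, hc, hvc⟩ := hg.exists_mem v
        exact (h1 a ha c hc hua hvc).trans (h2 c hc b hb hvc hwb)
      · intro u _ a ha b hb hua hub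
        by_cases hgu : g u ∈ A
        · have e : a = g u := hg.unique a ha _ hgu (hua.symm.trans (sameCycle_step _ _))
          have e2 : b = π (g u) := hg.unique b hb _ (hmemA _ hgu) hub.symm
          rw [e, e2]
          exact sameCycle_step _ _
        · rw [mul_apply, hπ _ hgu, sameCycle_apply_left] at hub
          rw [hg.unique a ha b hb (hua.symm.trans hub)]
    exact key x y hxy a ha b hb hxa hyb
  · -- Following `π * g` from `u`, one runs along the cycle of `g` up to its representative `a`,
    -- from where `π` leads to `π a`.
    have reach : ∀ u a : α, a ∈ A → SameCycle g u a → SameCycle (π * g) u (π a) := by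
      intro u a ha hua
      obtain ⟨i, hi0, -, hi⟩ := hua.exists_pow_eq''
      obtain ⟨i, rfl⟩ : ∃ l, i = l + 1 := ⟨i - 1, by omega⟩
      clear hi0
      induction i generalizing u with
      | zero =>
        rw [zero_add, pow_one] at hi
        have := sameCycle_step (π * g) u
        rwa [mul_apply, hi] at this
      | succ i ih =>
        by_cases hgu : g u ∈ A
        · have e : g u = a := hg.unique _ hgu a ha (by rwa [sameCycle_apply_left])
          have := sameCycle_step (π * g) u
          rwa [mul_apply, e] at this
        · rw [pow_succ, mul_apply] at hi
          have h1 := ih (g u) (by rwa [sameCycle_apply_left]) hi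
          have h2 := sameCycle_step (π * g) u
          rw [mul_apply, hπ _ hgu] at h2
          exact h2.trans h1
    intro hab
    have h1 : SameCycle (π * g) a b :=
      (hab.rel_of_step (r := SameCycle (π * g)) (fun _ => SameCycle.rfl)
        (fun _ _ _ h1 h2 => h1.trans h2) hmemA (fun u hu => reach u u hu SameCycle.rfl) ha).2
    have h2 (u c : α) (hc : c ∈ A) (huc : SameCycle g u c) : SameCycle (π * g) u c :=
      (reach u c hc huc).trans (reach c c hc SameCycle.rfl).symm
    exact (h2 x a ha hxa).trans (h1.trans (h2 y b hb hyb).symm)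

/-- Composing `g` with a tour through representatives of its cycles gives a tour through
everything. -/
theorem IsTransversal.isTourOn_mul (hg : g.IsTransversal A) (hπ : π.IsTourOn A) :
    (π * g).IsTourOn Finset.univ := by
  refine ⟨fun y hy => absurd (Finset.mem_univ y) hy, fun x _ y _ => ?_⟩
  obtain ⟨a, ha, hxa⟩ := hg.exists_mem x
  obtain ⟨b, hb, hyb⟩ := hg.exists_mem y
  exact (hg.sameCycle_mul hπ.fixed ha hb hxa hyb).2 (hπ.sameCycle a ha b hb)

theorem isTransversal_one : (1 : Perm α).IsTransversal Finset.univ :=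
  ⟨fun x => ⟨x, Finset.mem_univ _, SameCycle.rfl⟩, fun a _ b _ h => by simpa using h⟩

/-- Keeping the least element of every cycle of `π` gives representatives for `π * g`. -/
theorem IsTransversal.mul_least [LinearOrder α] {A' : Finset α} (hg : g.IsTransversal A)
    (hπ : ∀ y ∉ A, π y = y)
    (hA' : ∀ a, a ∈ A' ↔ a ∈ A ∧ ∀ b, SameCycle π a b → a ≤ b) :
    (π * g).IsTransversal A' := by
  classical
  constructor
  · intro x
    obtain ⟨a, ha, hxa⟩ := hg.exists_mem x
    obtain ⟨b, hb, hmin⟩ := Finset.exists_min_image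
      (Finset.univ.filter fun b => SameCycle π a b) id ⟨a, by simp [SameCycle.rfl]⟩
    simp only [Finset.mem_filter, Finset.mem_univ, true_and, id] at hb hmin
    have hbA := hb.mem_of_fixed hπ ha
    exact ⟨b, (hA' b).2 ⟨hbA, fun c hc => hmin c (hb.trans hc)⟩,
      (hg.sameCycle_mul hπ ha hbA hxa SameCycle.rfl).2 hb⟩
  · intro a ha b hb h
    obtain ⟨haA, hamin⟩ := (hA' a).1 ha
    obtain ⟨hbA, hbmin⟩ := (hA' b).1 hb
    rw [hg.sameCycle_mul hπ haA hbA SameCycle.rfl SameCycle.rfl] at h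
    exact le_antisymm (hamin b h) (hbmin a h.symm)

end Equiv.Perm

/-! ### Lengths of permutations -/

namespace TourProgram

variable {α : Type*} [Fintype α]

/-- The total length of the steps `x → f x`. -/
def permCost (c : α → α → ℤ) (f : Perm α) : ℤ := ∑ x, c x (f x)

/-- An integral, possibly asymmetric distance with triangle inequality. -/
structure IsDist (Z : α → α → ℤ) : Prop where
  nonneg : ∀ i j, 0 ≤ Z i j
  self : ∀ i, Z i i = 0
  triangle : ∀ i j k, Z i k ≤ Z i j + Z j k

variable {Z : α → α → ℤ} {f g h π : Perm α} {A : Finset α}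

theorem IsDist.permCost_mul_le (hZ : IsDist Z) (π g : Perm α) :
    permCost Z (π * g) ≤ permCost Z g + permCost Z π := by
  have : permCost Z π = ∑ x, Z (g x) (π (g x)) := (Equiv.sum_comp g fun x => Z x (π x)).symm
  rw [this, permCost, permCost, ← Finset.sum_add_distrib]
  exact Finset.sum_le_sum fun x _ => hZ.triangle _ _ _

/-- Weak duality: a permutation with a feasible potential on the columns has least length. -/
theorem permCost_le_of_potential {c : α → α → ℤ} {p : Perm α} (v : α → ℤ)
    (hv : ∀ j j', v j' ≤ v j + c j' (p j) - c j (p j)) (τ : Perm α) :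
    permCost c p ≤ permCost c τ := by
  have h1 : ∑ j, v j ≤ ∑ j, (v (p⁻¹ (τ j)) + c j (τ j) - c (p⁻¹ (τ j)) (τ j)) := by
    refine Finset.sum_le_sum fun j _ => ?_
    simpa using hv (p⁻¹ (τ j)) j
  have h2 : ∑ j, v (p⁻¹ (τ j)) = ∑ j, v j := Equiv.sum_comp (p⁻¹ * τ) v
  have h3 : ∑ j, c (p⁻¹ (τ j)) (τ j) = permCost c p := by
    have := Equiv.sum_comp (p⁻¹ * τ) fun x => c x (p x)
    simpa [permCost] using this
  rw [Finset.sum_sub_distrib, Finset.sum_add_distrib, h2, h3] at h1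
  simp only [permCost] at h1 ⊢
  linarith

variable [DecidableEq α]

theorem permCost_mul_swap (c : α → α → ℤ) (f : Perm α) {j k : α} (hjk : j ≠ k) :
    permCost c (f * swap j k) = permCost c f - c j (f j) - c k (f k) + c j (f k) + c k (f j) := by
  have h : permCost c (f * swap j k) - permCost c f =
      ∑ x, (c x ((f * swap j k) x) - c x (f x)) := by
    simp [permCost, Finset.sum_sub_distrib]
  rw [Fintype.sum_eq_add j k hjk] at h
  · simp only [mul_apply, swap_apply_left, swap_apply_right] at h
    linarith
  · rintro x ⟨h1, h2⟩
    simp [swap_apply_of_ne_of_ne h1 h2]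

theorem IsDist.permCost_insert_after (hZ : IsDist Z) {j k : α} (hjk : j ≠ k) (hk : f k = k) :
    permCost Z (f * swap j k) = permCost Z f - Z j (f j) + Z j k + Z k (f j) := by
  rw [permCost_mul_swap Z f hjk, hk, hZ.self]
  ring

theorem IsDist.permCost_bypass (hZ : IsDist Z) {j x : α} (hjx : f j = x) :
    permCost Z (f * swap j x) = permCost Z f - Z j x - Z x (f x) + Z j (f x) := by
  by_cases e : j = x
  · subst e
    rw [show swap j j = (1 : Perm α) from swap_self j, mul_one, hjx, hZ.self]
    ring
  · rw [permCost_mul_swap Z f e, hjx, hZ.self]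
    ring

/-- Shortcutting a tour: every set of elements has a tour that is not longer. -/
theorem IsDist.exists_isTourOn (hZ : IsDist Z) (hh : h.IsTourOn Finset.univ) (A : Finset α) :
    ∃ f : Perm α, f.IsTourOn A ∧ permCost Z f ≤ permCost Z h := by
  obtain ⟨R, rfl⟩ : ∃ R : Finset α, Finset.univ \ R = A := ⟨Finset.univ \ A, by simp⟩
  induction R using Finset.induction_on with
  | empty => exact ⟨h, by simpa using hh, le_rfl⟩
  | insert x R _ ih =>
    obtain ⟨f, hf, hle⟩ := ih
    have hjx : f (f⁻¹ x) = x := by simp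
    refine ⟨f * swap (f⁻¹ x) x, ?_, ?_⟩
    · have := hf.bypass hjx
      rwa [← Finset.sdiff_insert] at this
    · rw [hZ.permCost_bypass hjx]
      have := hZ.triangle (f⁻¹ x) x (f x)
      linarith

/-- The distance `Z` with a penalty `B` for fixing an element of `A` or moving another element. -/
def penalized (Z : α → α → ℤ) (B : ℤ) (A : Finset α) (i j : α) : ℤ :=
  Z i j + B * (if i = j then (if i ∈ A then 1 else 0) else 1 - (if i ∈ A then 1 else 0))

/-- If the penalty exceeds the sum of all distances, a permutation of least penalized length is a
fixed-point free permutation of `A`, and it is not longer than a tour. -/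
theorem IsDist.of_penalized_minimal (hZ : IsDist Z) {B : ℤ} (hB : ∑ i, ∑ j, Z i j < B)
    (hA : 2 ≤ A.card) (hh : h.IsTourOn Finset.univ)
    (hmin : ∀ τ, permCost (penalized Z B A) π ≤ permCost (penalized Z B A) τ) :
    (∀ y ∉ A, π y = y) ∧ (∀ a ∈ A, π a ≠ a) ∧ permCost Z π ≤ permCost Z h := by
  -- A shortcut tour `f` of `A` pays no penalty, so `π` costs less than `B` and pays none either.
  obtain ⟨f, hf, hle⟩ := hZ.exists_isTourOn hh A
  have hfB : permCost Z f < B := by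
    refine lt_of_le_of_lt (Finset.sum_le_sum fun i _ => ?_) hB
    exact Finset.single_le_sum (fun j _ => hZ.nonneg i j) (Finset.mem_univ (f i))
  have hB0 : 0 < B := lt_of_le_of_lt
    (Finset.sum_nonneg fun i _ => Finset.sum_nonneg fun j _ => hZ.nonneg i j) hB
  have hpf : permCost (penalized Z B A) f = permCost Z f := by
    refine Finset.sum_congr rfl fun x _ => ?_
    by_cases hx : x ∈ A
    · have := hf.apply_ne hA hx
      simp [penalized, hx, this.symm]
    · simp [penalized, hx, hf.fixed x hx]
  have hpos (x : α) : 0 ≤ B * (if x = π x then (if x ∈ A then 1 else 0)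
      else 1 - (if x ∈ A then 1 else 0)) := by
    apply mul_nonneg hB0.le
    split_ifs <;> simp
  have hsum : permCost (penalized Z B A) π = permCost Z π + ∑ x, B * (if x = π x then
      (if x ∈ A then 1 else 0) else 1 - (if x ∈ A then 1 else 0)) := by
    simp only [permCost, penalized, Finset.sum_add_distrib]
  have hπ0 : 0 ≤ permCost Z π := Finset.sum_nonneg fun x _ => hZ.nonneg _ _
  have hle2 := hmin f
  rw [hpf, hsum] at hle2
  have hlt (x : α) : B * (if x = π x then (if x ∈ A then 1 else 0)
      else 1 - (if x ∈ A then 1 else 0)) < B := by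
    have := Finset.single_le_sum (fun y _ => hpos y) (Finset.mem_univ x)
    linarith
  refine ⟨fun y hy => ?_, fun a ha e => ?_, ?_⟩
  · by_contra hne
    have := hlt y
    simp [hy, Ne.symm hne] at this
  · have := hlt a
    simp [ha, e] at this
  · have := Finset.sum_nonneg fun x (_ : x ∈ Finset.univ) => hpos x
    linarith

/-! ### Assignments of least length -/

variable {n : ℕ}

/-- The first `k` columns have been processed: `v` is feasible for them and the other columns are
matched to the row of the same index. Feasibility means that no column `j'` can be improved by
moving the row `p j` of a processed column `j` there; the potentials of the rows are eliminated. -/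
structure Processed (c : Fin n → Fin n → ℤ) (p : Perm (Fin n)) (v : Fin n → ℤ) (k : ℕ) : Prop where
  le : ∀ j : Fin n, j.val < k → ∀ j', v j' ≤ v j + c j' (p j) - c j (p j)
  fixed : ∀ j : Fin n, k ≤ j.val → p j = j

/-- A shortest path search from row `k` after `t` columns have been scanned, in the order of the
reduced distances `D j - v j`: `D` holds the tentative distances of the columns, `par` the
predecessors (a column that is its own predecessor is reached directly from row `k`), and `done j`
is `0` or the time at which `j` was scanned. A path may pass only through columns `j < k`, where it
continues from the row `p j`. -/
structure Search (c : Fin n → Fin n → ℤ) (K : ℤ) (p : Perm (Fin n)) (v : Fin n → ℤ) (k : Fin n)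
    (D : Fin n → ℤ) (par : Fin n → Fin n) (done : Fin n → ℕ) (t : ℕ) : Prop where
  le_source : ∀ j, D j ≤ c j k
  relaxed : ∀ j, 0 < done j → j < k → ∀ j', D j' ≤ D j + c j' (p j) - c j (p j)
  mono : ∀ j j', 0 < done j → done j' = 0 → D j - v j ≤ D j' - v j'
  parent : ∀ j, (par j = j ∧ D j = c j k) ∨
    (par j < k ∧ 0 < done (par j) ∧ (done (par j) < done j ∨ done j = 0) ∧
      D j = D (par j) + c j (p (par j)) - c (par j) (p (par j)))
  done_le : ∀ j, done j ≤ t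
  card : (Finset.univ.filter fun j => 0 < done j).card = t
  lower : ∀ j, -(t * K) ≤ D j

section Assignment

variable {c : Fin n → Fin n → ℤ} {K : ℤ} {p p' : Perm (Fin n)} {v D : Fin n → ℤ} {k cur : Fin n}
  {par : Fin n → Fin n} {done : Fin n → ℕ} {t : ℕ}

theorem Search.init (hc : ∀ i j, 0 ≤ c i j) :
    Search c K p v k (fun j => c j k) id (fun _ => 0) 0 where
  le_source _ := le_rfl
  relaxed j h := by simp at h
  mono j j' h := by simp at h
  parent j := Or.inl ⟨rfl, rfl⟩
  done_le _ := le_rfl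
  card := by simp
  lower j := by simpa using hc j k

/-- Scanning an open column `b` of least reduced distance. As the potential is feasible, the columns
that were scanned before are not improved. -/
theorem Search.step (hP : Processed c p v k) (hc : ∀ i j, 0 ≤ c i j) (hcK : ∀ i j, c i j ≤ K)
    (hS : Search c K p v k D par done t)
    {b : Fin n} (hb : done b = 0) (hbmin : ∀ j, done j = 0 → D b - v b ≤ D j - v j) :
    Search c K p v k
      (fun j => if b < k ∧ D b - c b (p b) + c j (p b) < D j then D b - c b (p b) + c j (p b)
        else D j)
      (fun j => if b < k ∧ D b - c b (p b) + c j (p b) < D j then b else par j)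
      (Function.update done b (t + 1)) (t + 1) := by
  have old (j : Fin n) (hj : 0 < done j ∨ j = b) :
      ¬ (b < k ∧ D b - c b (p b) + c j (p b) < D j) := by
    rintro ⟨hbk, hlt⟩
    have h1 := hP.le b hbk j
    rcases hj with hj | rfl
    · have h2 := hS.mono j b hj hb
      linarith
    · linarith
  have hK : 0 ≤ K := (hc b b).trans (hcK b b)
  have dpos (j : Fin n) : 0 < Function.update done b (t + 1) j ↔ 0 < done j ∨ j = b := by
    by_cases h : j = b
    · simp [h]
    · simp [h]
  have dzero (j : Fin n) : Function.update done b (t + 1) j = 0 ↔ done j = 0 ∧ j ≠ b := by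
    by_cases h : j = b
    · simp [h]
    · simp [h]
  constructor
  · intro j
    split_ifs with h
    · exact h.2.le.trans (hS.le_source j)
    · exact hS.le_source j
  · intro j hj hjk j'
    rw [dpos] at hj
    rw [if_neg (old j hj)]
    rcases hj with hj | rfl
    · have := hS.relaxed j hj hjk j'
      split_ifs with h
      · exact h.2.le.trans this
      · exact this
    · split_ifs with h
      · linarith
      · push Not at h
        linarith [h hjk]
  · intro j j' hj hj'
    rw [dpos] at hj
    rw [dzero] at hj'
    rw [if_neg (old j hj)]
    have h1 : D j - v j ≤ D b - v b := by
      rcases hj with hj | rfl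
      · exact hS.mono j b hj hb
      · exact le_rfl
    split_ifs with h
    · have := hP.le b h.1 j'
      linarith
    · have := hbmin j' hj'.1
      linarith
  · intro j
    by_cases h : b < k ∧ D b - c b (p b) + c j (p b) < D j
    · right
      have hjb : j ≠ b := by
        rintro rfl
        exact old j (Or.inr rfl) h
      have hj0 : done j = 0 := by
        by_contra hne
        exact old j (Or.inl (Nat.pos_of_ne_zero hne)) h
      simp only [if_pos h]
      rw [if_neg (old b (Or.inr rfl))]
      refine ⟨h.1, by simp, Or.inr ((dzero j).2 ⟨hj0, hjb⟩), by ring⟩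
    · simp only [if_neg h]
      refine (hS.parent j).imp id ?_
      rintro ⟨h1, h2, h3, h4⟩
      have hpb : par j ≠ b := by
        intro e
        rw [e, hb] at h2
        exact lt_irrefl _ h2
      rw [if_neg (old _ (Or.inl h2)), Function.update_of_ne hpb]
      refine ⟨h1, h2, ?_, h4⟩
      by_cases hjb : j = b
      · subst hjb
        left
        simpa using Nat.lt_succ_of_le (hS.done_le (par j))
      · rw [Function.update_of_ne hjb]
        exact h3
  · intro j
    by_cases h : j = b
    · simp [h]
    · simpa [h] using (hS.done_le j).trans (Nat.le_succ t)
  · have : (Finset.univ.filter fun j => 0 < Function.update done b (t + 1) j) =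
        insert b (Finset.univ.filter fun j => 0 < done j) := by
      ext j
      simp only [Finset.mem_filter, Finset.mem_univ, true_and, Finset.mem_insert, dpos]
      tauto
    rw [this, Finset.card_insert_of_notMem (by simp [hb]), hS.card]
  · intro j
    have h1 := hS.lower j
    have h2 := hS.lower b
    have h3 := hc j (p b)
    have h4 := hcK b (p b)
    push_cast
    split_ifs <;> linarith

theorem Search.exists_not_done (hS : Search c K p v k D par done t) (ht : t < n) :
    ∃ j, done j = 0 := by
  by_contra! h
  have := hS.card
  rw [Finset.filter_true_of_mem (fun j _ => Nat.pos_of_ne_zero (h j))] at this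
  simp at this
  omega

theorem Search.done_pos (hS : Search c K p v k D par done n) (j : Fin n) : 0 < done j := by
  have h : (Finset.univ.filter fun j => 0 < done j) = Finset.univ :=
    Finset.eq_univ_of_card _ (by simpa using hS.card)
  have : j ∈ Finset.univ.filter fun j => 0 < done j := by rw [h]; exact Finset.mem_univ j
  simpa using this

/-- Augmenting along the path from row `k` to column `k`: after some steps back from column `k`, row
`k` is matched to column `cur`, and `D` is feasible for all processed columns but `cur`. -/
structure Rotation (c : Fin n → Fin n → ℤ) (p : Perm (Fin n)) (k : Fin n) (D : Fin n → ℤ)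
    (done : Fin n → ℕ) (p' : Perm (Fin n)) (cur : Fin n) : Prop where
  apply_cur : p' cur = k
  le : ∀ j ≤ k, j ≠ cur → ∀ j', D j' ≤ D j + c j' (p' j) - c j (p' j)
  eq_of_lt : ∀ j, done j < done cur → p' j = p j
  fixed : ∀ j, k < j → p' j = j
  cur_le : cur ≤ k

theorem Rotation.init (hP : Processed c p v k) (hS : Search c K p v k D par done n) :
    Rotation c p k D done p k where
  apply_cur := hP.fixed k le_rfl
  le j hj hjk j' := hS.relaxed j (hS.done_pos j) (lt_of_le_of_ne hj hjk) j'
  eq_of_lt _ _ := rfl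
  fixed j hj := hP.fixed j hj.le
  cur_le := le_rfl

/-- One step back along the path: the predecessor of `cur` hands its row over to `cur`. -/
theorem Rotation.step (hS : Search c K p v k D par done n) (hR : Rotation c p k D done p' cur) :
    Rotation c p k D done (p' * swap cur (par cur)) (par cur) ∧
      (par cur = cur ∨ done (par cur) < done cur) := by
  by_cases e : par cur = cur
  · rw [e, show swap cur cur = (1 : Perm (Fin n)) from swap_self cur, mul_one]
    exact ⟨hR, Or.inl rfl⟩
  obtain ⟨h1, h2, h3, h4⟩ := (hS.parent cur).resolve_left (fun h => e h.1)
  have hlt : done (par cur) < done cur := h3.resolve_right (hS.done_pos cur).ne'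
  have hq : p' (par cur) = p (par cur) := hR.eq_of_lt _ hlt
  have eo (j : Fin n) (hj1 : j ≠ cur) (hj2 : j ≠ par cur) : (p' * swap cur (par cur)) j = p' j := by
    simp [swap_apply_of_ne_of_ne hj1 hj2]
  refine ⟨⟨by simp [hR.apply_cur], ?_, ?_, ?_, h1.le⟩, Or.inr hlt⟩
  · intro j hjk hjp j'
    by_cases hj : j = cur
    · subst hj
      have := hS.relaxed _ h2 h1 j'
      simp only [mul_apply, swap_apply_left, hq]
      linarith
    · rw [eo j hj hjp]
      exact hR.le j hjk hj j'
  · intro j hj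
    rw [eo j (by rintro rfl; omega) (by rintro rfl; omega)]
    exact hR.eq_of_lt j (hj.trans hlt)
  · intro j hj
    rw [eo j (by rintro rfl; exact absurd hR.cur_le (not_le.2 hj))
      (by rintro rfl; exact lt_asymm h1 hj)]
    exact hR.fixed j hj

/-- At the start of the path, row `k` is matched to a column that it reaches directly, and the
distances `D` are a feasible potential for one more column. -/
theorem Rotation.processed (hS : Search c K p v k D par done n)
    (hR : Rotation c p k D done p' cur) (hcur : par cur = cur) : Processed c p' D (k + 1) where
  le j hj j' := by
    by_cases e : j = cur
    · subst e
      have hD : D j = c j k := by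
        rcases hS.parent j with h | h
        · exact h.2
        · have := h.2.2.1
          rw [hcur] at this
          have := hS.done_pos j
          omega
      have := hS.le_source j'
      rw [hR.apply_cur]
      linarith
    · exact hR.le j (Nat.lt_succ_iff.1 hj) e j'
  fixed j hj := hR.fixed j hj

end Assignment

/-! ### Shortest tours by dynamic programming over subsets -/

theorem testBit_sub_two_pow {m i : ℕ} (h : m.testBit i) (j : ℕ) :
    (m - 2 ^ i).testBit j = (m.testBit j && decide (j ≠ i)) := by
  have hle : 2 ^ i ≤ m := Nat.ge_two_pow_of_testBit h
  obtain ⟨x, rfl⟩ : ∃ x, m = 2 ^ i + x := ⟨m - 2 ^ i, by omega⟩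
  rw [Nat.testBit_two_pow_add_eq] at h
  rw [Nat.add_sub_cancel_left]
  rcases lt_trichotomy j i with hj | rfl | hj
  · rw [Nat.testBit_two_pow_add_gt hj]; simp [hj.ne]
  · simpa using h
  · obtain ⟨l, rfl⟩ : ∃ l, j = i + 1 + l := ⟨j - (i + 1), by omega⟩
    have hx : x.testBit i = false := by simpa using h
    have hx' : x / 2 ^ i % 2 = 0 := by
      rw [Nat.testBit_eq_decide_div_mod_eq] at hx
      simpa using hx
    have key : (2 ^ i + x) / 2 ^ (i + 1) = x / 2 ^ (i + 1) := by
      rw [pow_succ, ← Nat.div_div_eq_div_mul, ← Nat.div_div_eq_div_mul,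
        Nat.add_div_left _ (by positivity)]
      omega
    have hne : i + 1 + l ≠ i := by omega
    simp only [Nat.testBit_eq_decide_div_mod_eq, hne, ne_eq, not_false_eq_true, decide_true,
      Bool.and_true]
    rw [pow_add 2 (i + 1) l, ← Nat.div_div_eq_div_mul, ← Nat.div_div_eq_div_mul, key]

/-- The subset of `A` that a bit mask stands for, when `loc` numbers the elements of `A`. -/
def subsetOf (A : Finset (Fin n)) (loc : Fin n → ℕ) (mask : ℕ) : Finset (Fin n) :=
  A.filter fun x => mask.testBit (loc x)

/-- The recursion for `F mask x`, the length of a shortest path that starts in `x`, visits the set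
that belongs to `mask` and ends in `a0`. -/
structure Entry (Z : Fin n → Fin n → ℤ) (A : Finset (Fin n)) (loc : Fin n → ℕ) (a0 : Fin n)
    (F : ℕ → Fin n → ℤ) (mask : ℕ) (x : Fin n) : Prop where
  empty : subsetOf A loc mask = ∅ → F mask x = Z x a0
  le : ∀ k ∈ subsetOf A loc mask, F mask x ≤ Z x k + F (mask - 2 ^ loc k) k
  eq : subsetOf A loc mask ≠ ∅ →
    ∃ k ∈ subsetOf A loc mask, F mask x = Z x k + F (mask - 2 ^ loc k) k

theorem subsetOf_sub {A : Finset (Fin n)} {loc : Fin n → ℕ} (hloc : Set.InjOn loc A) {mask : ℕ}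
    {k : Fin n} (hk : k ∈ subsetOf A loc mask) :
    subsetOf A loc (mask - 2 ^ loc k) = (subsetOf A loc mask).erase k := by
  obtain ⟨hkA, hkb⟩ := Finset.mem_filter.1 hk
  ext x
  simp only [subsetOf, Finset.mem_filter, Finset.mem_erase, testBit_sub_two_pow hkb,
    Bool.and_eq_true, decide_eq_true_eq]
  constructor
  · rintro ⟨h1, h2, h3⟩
    exact ⟨fun e => h3 (e ▸ rfl), h1, h2⟩
  · rintro ⟨h1, h2, h3⟩
    exact ⟨h2, h3, fun e => h1 (hloc h2 hkA e)⟩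

theorem two_pow_le_of_mem {A : Finset (Fin n)} {loc : Fin n → ℕ} {mask : ℕ} {k : Fin n}
    (hk : k ∈ subsetOf A loc mask) : 2 ^ loc k ≤ mask :=
  Nat.ge_two_pow_of_testBit (Finset.mem_filter.1 hk).2

/-- No tour is shorter than the path length in the table: if the tour `h` of `S ∪ {j}` enters `j`
from `i`, then breaking it open there gives a path from `j` through `S` to `i`, here continued to
`a0`. -/
theorem IsDist.entry_le {Z : Fin n → Fin n → ℤ} (hZ : IsDist Z) {A : Finset (Fin n)}
    {loc : Fin n → ℕ} (hloc : Set.InjOn loc A) {a0 : Fin n} {F : ℕ → Fin n → ℤ} {M : ℕ}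
    (hF : ∀ mask < M, ∀ x, Entry Z A loc a0 F mask x) (S : Finset (Fin n)) {mask : ℕ}
    (hm : mask < M) (hS : subsetOf A loc mask = S) {i j : Fin n} (hj : j ∉ S) {h : Perm (Fin n)}
    (hh : h.IsTourOn (insert j S)) (hij : h i = j) :
    F mask j ≤ permCost Z h - Z i j + Z i a0 := by
  induction hc : S.card generalizing S mask i j h with
  | zero =>
    rw [Finset.card_eq_zero] at hc
    subst hc
    rw [(hF mask hm j).empty hS]
    have hji : i = j := by
      by_contra e
      exact e ((hh.fixed i (by simp [e])).symm.trans hij)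
    subst hji
    have : 0 ≤ permCost Z h := Finset.sum_nonneg fun x _ => hZ.nonneg _ _
    rw [hZ.self]; linarith
  | succ l ih =>
    -- Bypassing `j` shortens the path by its first step.
    have hkj : h j ≠ j := hh.apply_ne (by rw [Finset.card_insert_of_notMem hj]; omega) (by simp)
    have hkS : h j ∈ S :=
      (Finset.mem_insert.1 (hh.apply_mem (Finset.mem_insert_self j S))).resolve_left hkj
    have hkm : h j ∈ subsetOf A loc mask := by rw [hS]; exact hkS
    have hi : i ≠ j := by rintro rfl; exact hkj hij
    have hb := hh.bypass hij
    rw [Finset.erase_insert hj, ← Finset.insert_erase hkS] at hb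
    have := ih (S.erase (h j)) (mask := mask - 2 ^ loc (h j))
      (lt_of_le_of_lt (Nat.sub_le _ _) hm)
      (by rw [subsetOf_sub hloc hkm, hS]) (j := h j) (by simp) hb (i := i) (by simp)
      (by rw [Finset.card_erase_of_mem hkS]; omega)
    have h1 := (hF mask hm j).le (h j) hkm
    rw [hZ.permCost_bypass hij] at this
    linarith

end TourProgram

namespace TourProgram

open RAM

/-! ### The assignment program -/

/-- A variable as an expression. -/
prefix:max "♯" => Ex.var

variable {n : ℕ} {W : ℤ} {β : Var → ℕ} {s : St}

/-- The array `f` holds the values of `F`. -/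
def Holds (f : ℤ → ℤ) (F : Fin n → ℤ) : Prop := ∀ i : Fin n, f (i.val : ℤ) = F i

/-- The array `f` holds the matrix `c` row by row. -/
def HoldsMat (f : ℤ → ℤ) (c : Fin n → Fin n → ℤ) : Prop :=
  ∀ i j : Fin n, f ((i.val : ℤ) * n + j.val) = c i j

theorem index_bound (i j : Fin n) : (i.val : ℤ) * n + j.val < n * n := by
  have h1 : (i.val : ℤ) + 1 ≤ n := by exact_mod_cast i.isLt
  have h2 : (j.val : ℤ) + 1 ≤ n := by exact_mod_cast j.isLt
  nlinarith

/-- The invariant rule for loops over all cities. -/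
theorem wp_forFin {x nv : Var} {c : Cmd} {Q : St → Prop} (P : ℕ → St → Prop) (hN : s.reg nv = n)
    (hβ : n ≤ β nv) (h0 : P 0 (s.set x 0))
    (hstep : ∀ i : Fin n, ∀ s', Frame (.loop x nv c) s s' → s'.reg x = i.val → P i s' →
      wp W β c s' fun s'' => P (i + 1) (s''.set x (i.val + 1)))
    (hend : ∀ s', Frame (.loop x nv c) s s' → P n s' → Q s')
    (hx : c.wr x = false := by rfl) (hn : c.wr nv = false := by rfl)
    (hne : nv ≠ x := by decide) :
    wp W β (.loop x nv c) s Q :=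
  wp_for P n hN hβ h0 (fun i hi s' => hstep ⟨i, hi⟩ s') (fun s' hF _ => hend s' hF) hx hn hne

/-- Replaces the candidate `b` with value `bv` by `k` with value `x` if there was no candidate yet
(`b = -1`) or if `x` is smaller. -/
def updMin (k : Var) : Cmd :=
  .ite (0 - ♯.b) (.set .b ♯k ;; .set .bv ♯.x)
    (.ite (♯.bv - ♯.x) (.set .b ♯k ;; .set .bv ♯.x) .skip)

/-- Among the eligible indices below `i`, `b` is one of least value `bv`, or `-1` if there is
none. -/
def ArgMin (el : Fin n → Prop) (f : Fin n → ℤ) (i : ℕ) (b bv : ℤ) : Prop :=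
  (b = -1 ∧ ∀ j : Fin n, j.val < i → ¬ el j) ∨
    ∃ k : Fin n, b = k.val ∧ bv = f k ∧ k.val < i ∧ el k ∧ ∀ j : Fin n, j.val < i → el j → f k ≤ f j

theorem ArgMin.skip {el : Fin n → Prop} {f : Fin n → ℤ} {i : Fin n} {b bv : ℤ}
    (h : ArgMin el f i b bv) (hi : ¬ el i) : ArgMin el f (i + 1) b bv := by
  have key (j : Fin n) (hj : j.val < i.val + 1) (he : el j) : j.val < i.val := by
    rcases Nat.lt_succ_iff_lt_or_eq.1 hj with h | h
    · exact h
    · exact absurd (Fin.ext h ▸ he) hi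
  rcases h with ⟨h1, h2⟩ | ⟨k, h1, h2, h3, h4, h5⟩
  · exact Or.inl ⟨h1, fun j hj he => h2 j (key j hj he) he⟩
  · exact Or.inr ⟨k, h1, h2, by omega, h4, fun j hj he => h5 j (key j hj he) he⟩

theorem wp_updMin {el : Fin n → Prop} {f : Fin n → ℤ} {i : Fin n} {kv : Var} {B : ℤ}
    (hW : 2 * B ≤ W) (hnW : n ≤ W) (hf : ∀ j, el j → |f j| ≤ B)
    (h : ArgMin el f i (s.reg .b) (s.reg .bv))
    (hk : s.reg kv = i.val) (hx : s.reg .x = f i) (hi : el i) :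
    wp W β (updMin kv) s fun s' => ArgMin el f (i + 1) (s'.reg .b) (s'.reg .bv) := by
  have hB := abs_le.1 (hf i hi)
  have hi' : (i.val : ℤ) < n := by exact_mod_cast i.isLt
  have key (j : Fin n) (hj : j.val < i.val + 1) : j.val < i.val ∨ j = i := by
    rcases Nat.lt_succ_iff_lt_or_eq.1 hj with h | h
    · exact Or.inl h
    · exact Or.inr (Fin.ext h)
  rcases h with ⟨h1, h2⟩ | ⟨k, h1, h2, h3, h4, h5⟩
  · simp [updMin, wp, h1, hk, hx]
    refine ⟨by omega, Or.inr ⟨i, rfl, rfl, by omega, hi, fun j hj he => ?_⟩⟩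
    rcases key j hj with h | rfl
    · exact absurd he (h2 j h)
    · exact le_rfl
  · have hBk := abs_le.1 (hf k h4)
    have hk' : (k.val : ℤ) < n := by exact_mod_cast k.isLt
    simp [updMin, wp, h1, h2, hk, hx]
    refine ⟨by omega, by simp only [abs_le]; omega, ?_, ?_⟩
    · intro hlt
      refine Or.inr ⟨i, rfl, rfl, by omega, hi, fun j hj he => ?_⟩
      rcases key j hj with h | rfl
      · exact hlt.le.trans (h5 j h he)
      · exact le_rfl
    · intro hle
      refine Or.inr ⟨k, rfl, rfl, by omega, h4, fun j hj he => ?_⟩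
      rcases key j hj with h | rfl
      · exact h5 j h he
      · exact hle

/-- Finds the column that is to be scanned next. -/
def pick : Cmd :=
  .set .b (0 - 1) ;;
  .loop .j .n (.ite (1 - .get .done ♯.j) (.set .x (.get .d ♯.j - .get .v ♯.j) ;; updMin .j) .skip)

theorem wp_pick {D v : Fin n → ℤ} {done : Fin n → ℕ} {B : ℤ} (hW : 4 * B ≤ W) (hnW : n + 1 ≤ W)
    (hβ : n ≤ β .n) (hn : s.reg .n = n) (hD : Holds (s.arr .d) D) (hv : Holds (s.arr .v) v)
    (hdone : Holds (s.arr .done) fun j => (done j : ℤ)) (hDB : ∀ j, |D j| ≤ B)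
    (hvB : ∀ j, |v j| ≤ B) (hdn : ∀ j, done j ≤ n) (hex : ∃ j, done j = 0) :
    wp W β pick s fun s' => ∃ b : Fin n, s'.reg .b = b.val ∧ done b = 0 ∧
      ∀ j, done j = 0 → D b - v b ≤ D j - v j := by
  simp [pick, wp]
  refine ⟨by omega, wp_forFin (fun i s' => ArgMin (fun j => done j = 0) (fun j => D j - v j) i
    (s'.reg .b) (s'.reg .bv)) (by simp [hn]) hβ (Or.inl ⟨by simp, by simp⟩) ?_ ?_⟩
  · intro i s' hF hj hI
    have h1 := abs_le.1 (hDB i)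
    have h2 := abs_le.1 (hvB i)
    have h3 : (done i : ℤ) ≤ n := by exact_mod_cast hdn i
    have e1 : s'.arr .done i.val = done i := by rw [hF.arr .done rfl]; exact hdone i
    have e2 : s'.arr .d i.val = D i := by rw [hF.arr .d rfl]; exact hD i
    have e3 : s'.arr .v i.val = v i := by rw [hF.arr .v rfl]; exact hv i
    simp [wp, hj, e1, e2, e3]
    refine ⟨by simp only [abs_le]; omega, fun h => ⟨by simp only [abs_le]; omega, ?_⟩,
      fun h => hI.skip (by omega)⟩
    refine wp_mono _ _ (wp_updMin (B := 2 * B) (by omega) (by omega) (fun j _ => ?_) hI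
      (by simp [hj]) (by simp) (by omega)) fun s'' _ h => ?_
    · have h1 := abs_le.1 (hDB j)
      have h2 := abs_le.1 (hvB j)
      exact abs_le.2 ⟨by omega, by omega⟩
    · simpa using h
  · rintro s' hF (⟨-, h⟩ | ⟨b, h1, -, -, h2, h3⟩)
    · obtain ⟨j, hj⟩ := hex
      exact absurd hj (h j j.isLt)
    · refine ⟨b, h1, h2, fun j hj => ?_⟩
      have := h3 j j.isLt hj
      linarith

/-- Scanning column `b`: improves the distances of all columns. -/
def relax : Cmd :=
  .set .z (.get .d ♯.b - .get .cost (♯.b * ♯.n + .get .p ♯.b)) ;;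
  .loop .j .n (.set .x (♯.z + .get .cost (♯.j * ♯.n + .get .p ♯.b)) ;;
    .ite (.get .d ♯.j - ♯.x) (.put .d ♯.j ♯.x ;; .put .par ♯.j ♯.b) .skip)

theorem wp_relax {c : Fin n → Fin n → ℤ} {D : Fin n → ℤ} {par : Fin n → Fin n} {p : Perm (Fin n)}
    {B : ℤ} {b : Fin n} (hW : 4 * B ≤ W) (hnW : n * n ≤ W)
    (hβ : n ≤ β .n) (hn : s.reg .n = n) (hb : s.reg .b = b.val)
    (hD : Holds (s.arr .d) D) (hp : Holds (s.arr .p) fun j => ((p j).val : ℤ))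
    (hpar : Holds (s.arr .par) fun j => ((par j).val : ℤ)) (hc : HoldsMat (s.arr .cost) c)
    (hDB : ∀ j, |D j| ≤ B) (hcB : ∀ i j, 2 * |c i j| ≤ B) :
    wp W β relax s fun s' =>
      Holds (s'.arr .d) (fun j => if D b - c b (p b) + c j (p b) < D j
        then D b - c b (p b) + c j (p b) else D j) ∧
      Holds (s'.arr .par) fun j => ((if D b - c b (p b) + c j (p b) < D j
        then b else par j).val : ℤ) := by
  have hcb (i j : Fin n) : -B ≤ 2 * c i j ∧ 2 * c i j ≤ B := by
    have := hcB i j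
    have := neg_abs_le (c i j)
    have := le_abs_self (c i j)
    omega
  have ix (i j : Fin n) := index_bound i j
  have in0 (i : Fin n) : (0 : ℤ) ≤ (i.val : ℤ) * n := by positivity
  have hb1 := abs_le.1 (hDB b)
  have hb2 := hcb b (p b)
  have hb3 := ix b (p b)
  have hb4 := in0 b
  have e1 := hD b
  have e2 := hp b
  have e3 := hc b (p b)
  simp [relax, wp, hb, hn, e1, e2, e3]
  refine ⟨by simp only [abs_le]; omega, ?_⟩
  refine wp_forFin (fun i s' => ∀ j : Fin n,
    s'.arr .d j.val = (if j.val < i ∧ D b - c b (p b) + c j (p b) < D j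
        then D b - c b (p b) + c j (p b) else D j) ∧
    s'.arr .par j.val = ((if j.val < i ∧ D b - c b (p b) + c j (p b) < D j
        then b else par j).val : ℤ)) (by simp [hn]) hβ ?_ ?_ ?_
  · intro j
    simpa using ⟨hD j, hpar j⟩
  · intro i s' hF hj hI
    have r1 : s'.reg .n = n := by rw [hF.reg .n rfl]; simp [hn]
    have r2 : s'.reg .b = b.val := by rw [hF.reg .b rfl]; simp [hb]
    have r3 : s'.reg .z = D b - c b (p b) := by rw [hF.reg .z rfl]; simp
    have a1 : s'.arr .p b.val = (p b).val := by rw [hF.arr .p rfl]; exact hp b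
    have a2 : s'.arr .cost ((i.val : ℤ) * n + (p b).val) = c i (p b) := by
      rw [hF.arr .cost rfl]; exact hc i (p b)
    have a3 : s'.arr .d i.val = D i := by simpa using (hI i).1
    have i1 := ix i (p b)
    have i2 := in0 i
    have i3 := hcb i (p b)
    have i4 := abs_le.1 (hDB i)
    simp [wp, r1, r2, r3, hj, a1, a2, a3]
    refine ⟨by simp only [abs_le]; omega, by simp only [abs_le]; omega, fun hlt j => ?_,
      fun hle j => ?_⟩
    · by_cases h : j = i
      · subst h
        simp [hlt]
      · have h' : j.val ≠ i.val := fun e => h (Fin.ext e)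
        have := hI j
        simpa [h, h', Ne.le_iff_lt h] using this
    · by_cases h : j = i
      · subst h
        have := hI j
        simpa [not_lt.2 hle] using this
      · have h' : j.val ≠ i.val := fun e => h (Fin.ext e)
        have := hI j
        simpa [h, h', Ne.le_iff_lt h] using this
  · intro s' hF hI
    constructor
    · intro j
      simpa using (hI j).1
    · intro j
      simpa using (hI j).2

/-- One step of the shortest path search. -/
def scan : Cmd :=
  pick ;; .put .done ♯.b (♯.t + 1) ;; .ite (♯.k - ♯.b) relax .skip

/-- Shortest paths from row `k` to all columns. -/
def search : Cmd :=
  .loop .j .n (.put .d ♯.j (.get .cost (♯.j * ♯.n + ♯.k)) ;; .put .par ♯.j ♯.j ;;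
    .put .done ♯.j 0) ;;
  .loop .t .n scan

/-- The arrays describe a search state. -/
def SearchState (c : Fin n → Fin n → ℤ) (K : ℤ) (p : Perm (Fin n)) (v : Fin n → ℤ) (k : Fin n)
    (t : ℕ) (s : St) : Prop :=
  ∃ D par done, Search c K p v k D par done t ∧ Holds (s.arr .d) D ∧
    Holds (s.arr .par) (fun j => ((par j).val : ℤ)) ∧ Holds (s.arr .done) fun j => (done j : ℤ)

theorem Search.abs_le {c : Fin n → Fin n → ℤ} {K : ℤ} {p : Perm (Fin n)} {v D : Fin n → ℤ}
    {k : Fin n} {par : Fin n → Fin n} {done : Fin n → ℕ} {t : ℕ} (hc : ∀ i j, 0 ≤ c i j)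
    (hcK : ∀ i j, c i j ≤ K) (hS : Search c K p v k D par done t) (ht : t ≤ n) (j : Fin n) :
    |D j| ≤ n * K := by
  have hK : 0 ≤ K := (hc j j).trans (hcK j j)
  have h1 : (t : ℤ) * K ≤ n * K := by gcongr
  have h2 : 1 * K ≤ n * K := by
    have : (1 : ℤ) ≤ n := by exact_mod_cast j.pos
    gcongr
  have h3 := hS.lower j
  have h4 := (hS.le_source j).trans (hcK j k)
  rw [_root_.abs_le]
  constructor <;> linarith

/-- The bounds that the assignment program needs: costs between `0` and `K`, and room for the
potentials. -/
structure CostBounds (W : ℤ) (c : Fin n → Fin n → ℤ) (K : ℤ) : Prop where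
  nonneg : ∀ i j, 0 ≤ c i j
  le : ∀ i j, c i j ≤ K
  size : 8 * ((n + 1) * K) ≤ W
  index : n * n + n + 1 ≤ W

section

variable {c : Fin n → Fin n → ℤ} {K : ℤ} {p : Perm (Fin n)} {v : Fin n → ℤ} {k : Fin n}

theorem wp_scan (hcb : CostBounds W c K) (hP : Processed c p v k) (hvB : ∀ j, |v j| ≤ n * K)
    {t : Fin n} (hβ : n ≤ β .n) (hn : s.reg .n = n) (hk : s.reg .k = k.val) (ht : s.reg .t = t.val)
    (hp : Holds (s.arr .p) fun j => ((p j).val : ℤ)) (hv : Holds (s.arr .v) v)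
    (hc : HoldsMat (s.arr .cost) c) (hI : SearchState c K p v k t s) :
    wp W β scan s (SearchState c K p v k (t + 1)) := by
  obtain ⟨D, par, done, hS, hD, hpar, hdone⟩ := hI
  have hDB := hS.abs_le hcb.nonneg hcb.le t.isLt.le
  have hK : 0 ≤ K := (hcb.nonneg k k).trans (hcb.le k k)
  have hnK : 0 ≤ (n : ℤ) * K := by positivity
  have hn0 : (t.val : ℤ) < n := by exact_mod_cast t.isLt
  have hnn : 0 ≤ (n : ℤ) * n := by positivity
  have hW1 := hcb.size
  have hW2 := hcb.index
  rw [add_mul, one_mul] at hW1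
  simp only [scan, wp]
  refine wp_mono _ _ (wp_pick (B := n * K) (by omega) (by omega) hβ hn hD hv hdone hDB hvB
    (fun j => (hS.done_le j).trans t.isLt.le) (hS.exists_not_done t.isLt)) ?_
  rintro s1 hF1 ⟨b, hb, hb0, hbmin⟩
  have r1 : s1.reg .n = n := (hF1.reg .n rfl).trans hn
  have r2 : s1.reg .t = t.val := (hF1.reg .t rfl).trans ht
  have r3 : s1.reg .k = k.val := (hF1.reg .k rfl).trans hk
  have hkn : (k.val : ℤ) < n := by exact_mod_cast k.isLt
  have hbn : (b.val : ℤ) < n := by exact_mod_cast b.isLt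
  have hstep := hS.step hP hcb.nonneg hcb.le hb0 hbmin
  have hdone1 : Holds (fun j => if j = (b.val : ℤ) then (t.val : ℤ) + 1 else s1.arr .done j)
      fun j => ((Function.update done b (t + 1) j : ℕ) : ℤ) := by
    intro j
    by_cases h : j = b
    · subst h; simp
    · have h' : j.val ≠ b.val := fun e => h (Fin.ext e)
      have := hdone j
      rw [← hF1.arr .done rfl] at this
      simpa [h, h'] using this
  simp [hb, r2, r3]
  refine ⟨by simp only [_root_.abs_le]; omega, by simp only [_root_.abs_le]; omega,
    fun hbk => ?_, fun hbk => ?_⟩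
  · refine wp_mono _ _ (wp_relax (c := c) (D := D) (par := par) (p := p)
      (B := n * K + 2 * K) (b := b)
      (by omega) (by omega) hβ (by simpa using r1) (by simpa using hb) ?_ ?_ ?_ ?_ ?_ ?_) ?_
    · intro j; simpa [hF1.arr .d rfl] using hD j
    · intro j; simpa [hF1.arr .p rfl] using hp j
    · intro j; simpa [hF1.arr .par rfl] using hpar j
    · intro i j; simpa [hF1.arr .cost rfl] using hc i j
    · intro j; have := hDB j; omega
    · intro i j
      rw [abs_of_nonneg (hcb.nonneg i j)]
      have := hcb.le i j
      omega
    · rintro s2 hF2 ⟨h1, h2⟩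
      refine ⟨_, _, _, hstep, ?_, ?_, ?_⟩
      · simpa [hbk] using h1
      · simpa [hbk] using h2
      · rw [hF2.arr .done rfl]
        intro j; simpa using hdone1 j
  · refine ⟨_, _, _, hstep, ?_, ?_, ?_⟩
    · intro j; simpa [hF1.arr .d rfl, not_lt.2 hbk] using hD j
    · intro j; simpa [hF1.arr .par rfl, not_lt.2 hbk] using hpar j
    · intro j; simpa using hdone1 j

theorem wp_search (hcb : CostBounds W c K) (hP : Processed c p v k) (hvB : ∀ j, |v j| ≤ n * K)
    (hβ : n ≤ β .n) (hn : s.reg .n = n) (hk : s.reg .k = k.val)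
    (hp : Holds (s.arr .p) fun j => ((p j).val : ℤ)) (hv : Holds (s.arr .v) v)
    (hc : HoldsMat (s.arr .cost) c) :
    wp W β search s (SearchState c K p v k n) := by
  have hW2 := hcb.index
  have hnn : 0 ≤ (n : ℤ) * n := by positivity
  simp only [search, wp]
  refine triple_of_wp _ _ (wp_forFin (fun i s' => ∀ j : Fin n, j.val < i →
    s'.arr .d j.val = c j k ∧ s'.arr .par j.val = j.val ∧ s'.arr .done j.val = 0) hn hβ ?_ ?_ ?_)
  · intro j hj
    exact absurd hj (Nat.not_lt_zero _)
  · intro i s' hF hj hI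
    have r1 : s'.reg .n = n := (hF.reg .n rfl).trans hn
    have r2 : s'.reg .k = k.val := (hF.reg .k rfl).trans hk
    have i1 := index_bound i k
    have i2 : (0 : ℤ) ≤ (i.val : ℤ) * n := by positivity
    have a1 : s'.arr .cost ((i.val : ℤ) * n + k.val) = c i k := by
      rw [hF.arr .cost rfl]; exact hc i k
    simp [wp, r1, r2, hj, a1]
    refine ⟨by simp only [_root_.abs_le]; omega, by omega, fun j hj => ?_⟩
    by_cases h : j = i
    · simp [h]
    · have h' : j.val ≠ i.val := fun e => h (Fin.ext e)
      simpa [h, h'] using hI j (lt_of_le_of_ne hj h')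
  · intro s1 hF1 h1
    refine wp_forFin (SearchState c K p v k) ((hF1.reg .n rfl).trans hn) hβ ?_ ?_ ?_
    · exact ⟨_, _, _, Search.init hcb.nonneg, fun j => (h1 j j.isLt).1, fun j => (h1 j j.isLt).2.1,
        fun j => (h1 j j.isLt).2.2⟩
    · intro t s' hF ht hI
      refine wp_mono _ _ (wp_scan hcb hP hvB hβ ?_ ?_ ht ?_ ?_ ?_ hI) fun s'' _ h => h
      · rw [hF.reg .n rfl, hF1.reg .n rfl, hn]
      · rw [hF.reg .k rfl, hF1.reg .k rfl, hk]
      · rw [hF.arr .p rfl, hF1.arr .p rfl]; exact hp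
      · rw [hF.arr .v rfl, hF1.arr .v rfl]; exact hv
      · rw [hF.arr .cost rfl, hF1.arr .cost rfl]; exact hc
    · intro s' _ h
      exact h

/-- Takes over the distances as potentials and rotates the matching along the path to column `k`. -/
def augment : Cmd :=
  .loop .j .n (.put .v ♯.j (.get .d ♯.j)) ;;
  .set .y ♯.k ;;
  .loop .t .n (.set .x (.get .par ♯.y) ;; .set .z (.get .p ♯.y) ;; .put .p ♯.y (.get .p ♯.x) ;;
    .put .p ♯.x ♯.z ;; .set .y ♯.x)

theorem wp_augment (hcb : CostBounds W c K) (hP : Processed c p v k)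
    (hβ : n ≤ β .n) (hn : s.reg .n = n) (hk : s.reg .k = k.val)
    (hp : Holds (s.arr .p) fun j => ((p j).val : ℤ)) (hI : SearchState c K p v k n s) :
    wp W β augment s fun s' => ∃ p' D, Processed c p' D (k + 1) ∧ (∀ j, |D j| ≤ n * K) ∧
      Holds (s'.arr .p) (fun j => ((p' j).val : ℤ)) ∧ Holds (s'.arr .v) D := by
  obtain ⟨D, par, done, hS, hD, hpar, hdone⟩ := hI
  simp only [augment, wp]
  refine triple_of_wp _ _ (wp_forFin (fun i s' => ∀ j : Fin n, j.val < i → s'.arr .v j.val = D j)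
    hn hβ ?_ ?_ ?_)
  · intro j hj
    exact absurd hj (Nat.not_lt_zero _)
  · intro i s' hF hj hI
    have a1 : s'.arr .d i.val = D i := by rw [hF.arr .d rfl]; exact hD i
    simp [wp, hj, a1]
    intro j hj
    by_cases h : j = i
    · simp [h]
    · have h' : j.val ≠ i.val := fun e => h (Fin.ext e)
      simpa [h, h'] using hI j (lt_of_le_of_ne hj h')
  · intro s1 hF1 h1
    refine ⟨trivial, wp_forFin (fun i s' => ∃ p' cur, Rotation c p k D done p' cur ∧
      Holds (s'.arr .p) (fun j => ((p' j).val : ℤ)) ∧ s'.reg .y = cur.val ∧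
      (par cur = cur ∨ done cur + i ≤ n)) ?_ hβ ?_ ?_ ?_⟩
    · simpa using (hF1.reg .n rfl).trans hn
    · refine ⟨p, k, Rotation.init hP hS, ?_, ?_, Or.inr (by simpa using hS.done_le k)⟩
      · simpa [hF1.arr .p rfl] using hp
      · simpa using (hF1.reg .k rfl).trans hk
    · rintro i s' hF ht ⟨p', cur, hR, hp', hy, hm⟩
      have a1 : s'.arr .par cur.val = (par cur).val := by
        rw [hF.arr .par rfl]; simpa [hF1.arr .par rfl] using hpar cur
      have a2 : s'.arr .p cur.val = (p' cur).val := hp' cur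
      have a3 : s'.arr .p (par cur).val = (p' (par cur)).val := hp' (par cur)
      obtain ⟨hR', hm'⟩ := hR.step hS
      simp [wp, hy, a1, a2, a3]
      refine ⟨_, _, hR', fun j => ?_, rfl, ?_⟩
      · by_cases h1 : j = par cur
        · subst h1; simp
        · have h1' : j.val ≠ (par cur).val := fun e => h1 (Fin.ext e)
          by_cases h2 : j = cur
          · subst h2; simp [h1']
          · have h2' : j.val ≠ cur.val := fun e => h2 (Fin.ext e)
            simpa [h1', h2', swap_apply_of_ne_of_ne h2 h1] using hp' j
      · rcases hm' with h | h
        · left; rw [h, h]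
        · rcases hm with h2 | h2
          · rw [h2] at h; exact absurd h (lt_irrefl _)
          · right; omega
    · rintro s' hF ⟨p', cur, hR, hp', hy, hm⟩
      have hcur : par cur = cur := by
        rcases hm with h | h
        · exact h
        · have := hS.done_pos cur
          omega
      refine ⟨p', D, hR.processed hS hcur, hS.abs_le hcb.nonneg hcb.le le_rfl, hp', ?_⟩
      rw [hF.arr .v rfl]
      intro j
      exact h1 j j.isLt

/-- Computes a permutation of least length. -/
def assign : Cmd :=
  .loop .j .n (.put .p ♯.j ♯.j ;; .put .v ♯.j 0) ;; .loop .k .n (search ;; augment)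

theorem wp_assign (hcb : CostBounds W c K) (hn1 : 0 < n) (hβ : n ≤ β .n) (hn : s.reg .n = n)
    (hc : HoldsMat (s.arr .cost) c) :
    wp W β assign s fun s' => ∃ p : Perm (Fin n), Holds (s'.arr .p) (fun j => ((p j).val : ℤ)) ∧
      ∀ τ, permCost c p ≤ permCost c τ := by
  have hW2 := hcb.index
  have hnn : 0 ≤ (n : ℤ) * n := by positivity
  have hnK : 0 ≤ (n : ℤ) * K :=
    mul_nonneg (by positivity) ((hcb.nonneg ⟨0, hn1⟩ ⟨0, hn1⟩).trans (hcb.le _ _))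
  simp only [assign, wp]
  refine triple_of_wp _ _ (wp_forFin (fun i s' => ∀ j : Fin n, j.val < i →
    s'.arr .p j.val = j.val ∧ s'.arr .v j.val = 0) hn hβ ?_ ?_ ?_)
  · intro j hj
    exact absurd hj (Nat.not_lt_zero _)
  · intro i s' hF hj hI
    simp [wp, hj]
    refine ⟨by omega, fun j hj => ?_⟩
    by_cases h : j = i
    · simp [h]
    · have h' : j.val ≠ i.val := fun e => h (Fin.ext e)
      simpa [h, h'] using hI j (lt_of_le_of_ne hj h')
  · intro s1 hF1 h1
    refine wp_forFin (fun k s' => ∃ p v, Processed c p v k ∧ (∀ j, |v j| ≤ n * K) ∧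
      Holds (s'.arr .p) (fun j => ((p j).val : ℤ)) ∧ Holds (s'.arr .v) v)
      ((hF1.reg .n rfl).trans hn) hβ ?_ ?_ ?_
    · refine ⟨1, 0, ⟨fun j hj => absurd hj (Nat.not_lt_zero _), fun _ _ => rfl⟩, ?_, ?_, ?_⟩
      · intro j; simpa using hnK
      · intro j; exact (h1 j j.isLt).1
      · intro j; exact (h1 j j.isLt).2
    · rintro k s' hF hk ⟨p, v, hP, hvB, hp, hv⟩
      have r1 : s'.reg .n = n := by rw [hF.reg .n rfl, hF1.reg .n rfl, hn]
      simp only [wp]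
      refine wp_mono _ _ (wp_search hcb hP hvB hβ r1 hk hp hv ?_) fun s2 hF2 h2 => ?_
      · rw [hF.arr .cost rfl, hF1.arr .cost rfl]; exact hc
      · refine wp_mono _ _ (wp_augment hcb hP hβ ((hF2.reg .n rfl).trans r1)
          ((hF2.reg .k rfl).trans hk) ?_ h2) fun s3 _ h3 => by simpa using h3
        rw [hF2.arr .p rfl]; exact hp
    · rintro s' hF ⟨p, v, hP, -, hp, -⟩
      exact ⟨p, hp, permCost_le_of_potential v fun j => hP.le j j.isLt⟩

end

end TourProgram

namespace TourProgram

open RAM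

/-! ### The dynamic program -/

variable {n : ℕ} {W : ℤ} {β : Var → ℕ} {s : St} {Z : Fin n → Fin n → ℤ} {A : Finset (Fin n)} {B : ℤ}

/-- Indicator function of a set of cities. -/
def ind (A : Finset (Fin n)) (i : Fin n) : ℤ := if i ∈ A then 1 else 0

/-- Position of a city in the increasing enumeration of `A`. -/
def rank (A : Finset (Fin n)) (x : Fin n) : ℕ := (A.filter fun y => y.val < x.val).card

theorem rank_lt_rank {x y : Fin n} (hx : x ∈ A) (h : x < y) : rank A x < rank A y := by
  refine Finset.card_lt_card ⟨fun z hz => ?_, fun hsub => ?_⟩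
  · rw [Finset.mem_filter] at hz ⊢
    exact ⟨hz.1, hz.2.trans h⟩
  · have := hsub (Finset.mem_filter.2 ⟨hx, h⟩)
    simp at this

theorem rank_injOn : Set.InjOn (rank A) A := by
  intro x hx y hy h
  rcases lt_trichotomy x y with hlt | rfl | hlt
  · exact absurd h (rank_lt_rank hx hlt).ne
  · rfl
  · exact absurd h (rank_lt_rank hy hlt).ne'

theorem rank_lt_card {x : Fin n} (hx : x ∈ A) : rank A x < A.card := by
  refine Finset.card_lt_card ⟨Finset.filter_subset _ _, fun hsub => ?_⟩
  have := hsub hx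
  simp at this

theorem card_filter_succ (A : Finset (Fin n)) (i : Fin n) :
    (A.filter fun y => y.val < i.val + 1).card = rank A i + if i ∈ A then 1 else 0 := by
  have : (A.filter fun y => y.val < i.val + 1) =
      (A.filter fun y => y.val < i.val) ∪ A.filter fun y => y = i := by
    ext y
    simp only [Finset.mem_filter, Finset.mem_union, Fin.ext_iff]
    constructor
    · rintro ⟨h1, h2⟩
      rcases Nat.lt_succ_iff_lt_or_eq.1 h2 with h | h
      · exact Or.inl ⟨h1, h⟩
      · exact Or.inr ⟨h1, h⟩
    · rintro (⟨h1, h2⟩ | ⟨h1, h2⟩)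
      · exact ⟨h1, by omega⟩
      · exact ⟨h1, by omega⟩
  rw [this, Finset.card_union_of_disjoint, rank]
  · congr 1
    rw [Finset.filter_eq']
    split_ifs <;> simp
  · rw [Finset.disjoint_filter]
    rintro y - h rfl
    exact lt_irrefl _ h

/-- Distances between `0` and `B`, and room for the table. -/
structure TableBounds (W : ℤ) (Z : Fin n → Fin n → ℤ) (B : ℤ) : Prop where
  nonneg : ∀ i j, 0 ≤ Z i j
  le : ∀ i j, Z i j ≤ B
  size : 2 * ((n + 2) * B) ≤ W
  index : 2 ^ n * n + 2 * 2 ^ n + n * n + n + 2 ≤ W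

/-- The tables that stay fixed during the dynamic program: the set `A`, the distances and the value
`2 ^ rank A x` of the bit of every `x` in `A`. -/
structure Tables (Z : Fin n → Fin n → ℤ) (A : Finset (Fin n)) (s : St) : Prop where
  n : s.reg .n = n
  act : Holds (s.arr .act) (ind A)
  dist : HoldsMat (s.arr .dist) Z
  pw : ∀ x ∈ A, s.arr .pw (x.val : ℤ) = 2 ^ rank A x

/-- Initializes the next-pointers, numbers the bits and sets `cap` to the number of masks. -/
def bits : Cmd :=
  .set .cap 1 ;;
  .loop .i .n (.put .nxt ♯.i ♯.i ;; .ite (.get .act ♯.i)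
    (.put .pw ♯.i ♯.cap ;; .set .cap (♯.cap + ♯.cap) ;; .set .a0 ♯.i) .skip)

theorem wp_bits (hb : TableBounds W Z B) (hβ : n ≤ β .n) (hn : s.reg .n = n)
    (hact : Holds (s.arr .act) (ind A)) (hA : A.Nonempty) :
    wp W β bits s fun s' => s'.reg .cap = 2 ^ A.card ∧ (∃ a ∈ A, s'.reg .a0 = a.val) ∧
      Holds (n := n) (s'.arr .nxt) (fun j => (j.val : ℤ)) ∧
      ∀ x ∈ A, s'.arr .pw (x.val : ℤ) = 2 ^ rank A x := by
  have hW := hb.index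
  have h2n : (0 : ℤ) < 2 ^ n := by positivity
  have hnn : 0 ≤ (n : ℤ) * n := by positivity
  have hnn2 : 0 ≤ (2 : ℤ) ^ n * n := by positivity
  simp [bits, wp]
  refine ⟨by omega, wp_forFin (fun i s' => s'.reg .cap = 2 ^ (A.filter fun y => y.val < i).card ∧
    ((∃ a ∈ A, s'.reg .a0 = a.val) ∨ ∀ a ∈ A, i ≤ a.val) ∧ ∀ x : Fin n, x.val < i →
      s'.arr .nxt x.val = x.val ∧ (x ∈ A → s'.arr .pw x.val = 2 ^ rank A x))
    (by simpa using hn) hβ ?_ ?_ ?_⟩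
  · simp
  · rintro i s' hF hi ⟨h1, h2, h3⟩
    have a1 : s'.arr .act i.val = ind A i := by rw [hF.arr .act rfl]; exact hact i
    rw [card_filter_succ]
    change s'.reg .cap = 2 ^ rank A i at h1
    have hr : (2 : ℤ) ^ rank A i ≤ 2 ^ n := by
      apply pow_le_pow_right₀ (by norm_num)
      exact (Finset.card_le_card (Finset.filter_subset _ _)).trans
        (by simpa using Finset.card_le_univ A)
    have hr0 : (0 : ℤ) < 2 ^ rank A i := by positivity
    by_cases hiA : i ∈ A
    · simp [wp, hi, a1, ind, hiA, h1]
      refine ⟨by simp only [abs_le]; omega, by ring, Or.inl ⟨i, hiA, rfl⟩, fun x hx => ?_⟩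
      by_cases h : x = i
      · subst h; simp
      · have h' : x.val ≠ i.val := fun e => h (Fin.ext e)
        simpa [h, h'] using h3 x (lt_of_le_of_ne hx h')
    · simp [wp, hi, a1, ind, hiA, h1]
      refine ⟨h2.imp id fun h a ha => ?_, fun x hx => ?_⟩
      · have := h a ha
        rcases this.lt_or_eq with h | h
        · exact h
        · exact absurd (Fin.ext h ▸ ha) hiA
      · by_cases h : x = i
        · subst h; simp [hiA]
        · have h' : x.val ≠ i.val := fun e => h (Fin.ext e)
          simpa [h, h'] using h3 x (lt_of_le_of_ne hx h')
  · rintro s' hF ⟨h1, h2, h3⟩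
    rw [Finset.filter_true_of_mem (fun y _ => y.isLt)] at h1
    refine ⟨h1, h2.resolve_right fun h => ?_, fun x => (h3 x x.isLt).1, fun x => (h3 x x.isLt).2⟩
    obtain ⟨a, ha⟩ := hA
    have := h a ha
    omega

/-- The table as a function of a mask and a city. -/
def tab (s : St) (mask : ℕ) (x : Fin n) : ℤ := s.arr .tab ((mask : ℤ) * n + x.val)

/-- Finds the best first step of a path that starts in city `j` and visits the set of `mask`. -/
def best : Cmd :=
  .set .b (0 - 1) ;;
  .loop .k .n (.ite (.get .act ♯.k)
    (.set .y (♯.mask / .get .pw ♯.k) ;; .ite (♯.y - 2 * (♯.y / 2))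
      (.set .x (.get .dist (♯.j * ♯.n + ♯.k) + .get .tab ((♯.mask - .get .pw ♯.k) * ♯.n + ♯.k)) ;;
        updMin .k) .skip) .skip)

theorem wp_best (hb : TableBounds W Z B) (hβ : n ≤ β .n) (hT : Tables Z A s) {mask : ℕ} {j : Fin n}
    (hm : s.reg .mask = mask) (hmn : mask < 2 ^ n) (hj : s.reg .j = j.val)
    (hF : ∀ k ∈ subsetOf A (rank A) mask,
      0 ≤ tab s (mask - 2 ^ rank A k) k ∧ tab s (mask - 2 ^ rank A k) k ≤ (n + 1) * B) :
    wp W β best s fun s' => ArgMin (fun k => k ∈ subsetOf A (rank A) mask)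
      (fun k => Z j k + tab s (mask - 2 ^ rank A k) k) n (s'.reg .b) (s'.reg .bv) := by
  have hW := hb.index
  have h2n : (0 : ℤ) < 2 ^ n := by positivity
  have hnn : 0 ≤ (n : ℤ) * n := by positivity
  have hnn2 : 0 ≤ (2 : ℤ) ^ n * n := by positivity
  have hB : 0 ≤ B := (hb.nonneg j j).trans (hb.le j j)
  have hnB : 0 ≤ (n : ℤ) * B := by positivity
  have hW2 := hb.size
  rw [add_mul] at hW2
  simp only [add_mul, one_mul] at hF
  simp [best, wp]
  refine ⟨by omega, wp_forFin (fun i s' => ArgMin (fun k => k ∈ subsetOf A (rank A) mask)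
    (fun k => Z j k + tab s (mask - 2 ^ rank A k) k) i (s'.reg .b) (s'.reg .bv))
    (by simpa using hT.n) hβ (Or.inl ⟨by simp, by simp⟩) ?_ fun s' _ h => h⟩
  intro i s' hFr hi hI
  have r1 : s'.reg .n = n := by rw [hFr.reg .n rfl]; simpa using hT.n
  have r2 : s'.reg .mask = mask := by rw [hFr.reg .mask rfl]; simpa using hm
  have r3 : s'.reg .j = j.val := by rw [hFr.reg .j rfl]; simpa using hj
  have a1 : s'.arr .act i.val = ind A i := by rw [hFr.arr .act rfl]; exact hT.act i
  by_cases hiA : i ∈ A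
  · have a2 : s'.arr .pw i.val = ((2 ^ rank A i : ℕ) : ℤ) := by
      rw [hFr.arr .pw rfl]; push_cast; exact hT.pw i hiA
    have a3 : s'.arr .dist ((j.val : ℤ) * n + i.val) = Z j i := by
      rw [hFr.arr .dist rfl]; exact hT.dist j i
    have hmemiff : i ∈ subsetOf A (rank A) mask ↔ mask / 2 ^ rank A i % 2 = 1 := by
      simp [subsetOf, hiA, Nat.testBit_eq_decide_div_mod_eq]
    have q1 : mask / 2 ^ rank A i ≤ mask := Nat.div_le_self _ _
    have hmn' : (mask : ℤ) < 2 ^ n := by exact_mod_cast hmn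
    have q2 : ((mask : ℤ) / ((2 ^ rank A i : ℕ) : ℤ)) = ((mask / 2 ^ rank A i : ℕ) : ℤ) := by
      push_cast; rfl
    simp only [wp, Ex.ok_get, Ex.ok_var, Ex.eval_get, Ex.eval_var, hi, a1, ind, hiA, if_true,
      zero_lt_one, not_true_eq_false, false_imp_iff, true_imp_iff, and_true, true_and, Ex.ok_div,
      Ex.eval_div, r2, a2, q2, Ex.ok_sub, Ex.ok_mul, Ex.ok_ofNat, Ex.eval_sub, Ex.eval_mul,
      Ex.eval_ofNat, St.set_reg]
    generalize hq : mask / 2 ^ rank A i = q at *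
    refine ⟨by simp only [abs_le]; omega, by simp only [abs_le]; omega, fun hpos => ?_,
      fun hneg => ?_⟩
    · have hmem : i ∈ subsetOf A (rank A) mask := hmemiff.2 (by push_cast at hpos; omega)
      have hle := two_pow_le_of_mem hmem
      have a4 : s'.arr .tab (((mask : ℤ) - ((2 ^ rank A i : ℕ) : ℤ)) * n + i.val) =
          tab s (mask - 2 ^ rank A i) i := by
        rw [hFr.arr .tab rfl, tab, Nat.cast_sub hle]; rfl
      have i1 := index_bound j i
      have i2 : (0 : ℤ) ≤ (j.val : ℤ) * n := by positivity
      have i3 : (0 : ℤ) ≤ (mask : ℤ) - ((2 ^ rank A i : ℕ) : ℤ) := by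
        have : ((2 ^ rank A i : ℕ) : ℤ) ≤ mask := by exact_mod_cast hle
        omega
      have i4 : ((mask : ℤ) - ((2 ^ rank A i : ℕ) : ℤ)) * n ≤ 2 ^ n * n := by
        apply mul_le_mul_of_nonneg_right _ (by positivity)
        have : (0 : ℤ) ≤ ((2 ^ rank A i : ℕ) : ℤ) := by positivity
        omega
      have i5 : (0 : ℤ) ≤ ((mask : ℤ) - ((2 ^ rank A i : ℕ) : ℤ)) * n := by positivity
      have i6 : (i.val : ℤ) < n := by exact_mod_cast i.isLt
      have f1 := hF i hmem
      have z1 := hb.nonneg j i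
      have z2 := hb.le j i
      simp [-abs_mul, r1, r2, r3, hi, a2]
      have a2' := a2
      push_cast at a2' a4 i3 i4 i5
      have hp0 : (0 : ℤ) < 2 ^ rank A i := by positivity
      simp only [a3, a4]
      refine ⟨by simp only [abs_le]; omega, ?_⟩
      refine wp_mono _ _ (wp_updMin (B := (n + 2) * B) hb.size (by omega) (fun k hk => ?_) hI
        (by simp [hi]) (by simp) hmem) fun s'' _ h => by simpa using h
      have f1 := hF k hk
      have z1 := hb.nonneg j k
      have z2 := hb.le j k
      rw [add_mul]
      simp only [abs_le]; omega
    · refine hI.skip fun hmem => hneg ?_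
      have := hmemiff.1 hmem
      push_cast
      omega
  · simp [wp, hi, a1, ind, hiA]
    exact hI.skip fun h => hiA (Finset.mem_filter.1 h).1

theorem Entry.congr {loc : Fin n → ℕ} {a0 x : Fin n} {F F' : ℕ → Fin n → ℤ} {mask : ℕ}
    (h : Entry Z A loc a0 F mask x) (h1 : F' mask x = F mask x)
    (h2 : ∀ m < mask, ∀ k, F' m k = F m k) : Entry Z A loc a0 F' mask x := by
  have key (k : Fin n) (hk : k ∈ subsetOf A loc mask) :
      F' (mask - 2 ^ loc k) k = F (mask - 2 ^ loc k) k := by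
    apply h2
    have := two_pow_le_of_mem hk
    have : 0 < 2 ^ loc k := by positivity
    omega
  refine ⟨fun he => h1.trans (h.empty he), fun k hk => ?_, fun hne => ?_⟩
  · rw [h1, key k hk]; exact h.le k hk
  · obtain ⟨k, hk, he⟩ := h.eq hne
    exact ⟨k, hk, by rw [h1, key k hk]; exact he⟩

/-- Different pairs of a mask and a city have different cells in the table. -/
theorem cell_inj {m m' : ℕ} {x x' : Fin n} :
    (m : ℤ) * n + x.val = m' * n + x'.val ↔ m = m' ∧ x = x' := by
  constructor
  · intro h
    have h1 : (x.val : ℤ) < n := by exact_mod_cast x.isLt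
    have h2 : (x'.val : ℤ) < n := by exact_mod_cast x'.isLt
    have hm : (m : ℤ) = m' := by
      rcases lt_trichotomy (m : ℤ) m' with hlt | heq | hlt
      · nlinarith
      · exact heq
      · nlinarith
    rw [hm] at h
    exact ⟨by exact_mod_cast hm, Fin.ext (by exact_mod_cast add_left_cancel h)⟩
  · rintro ⟨rfl, rfl⟩; rfl

/-- Fills the table in increasing order of the masks, so that all smaller subsets come first. -/
def fill : Cmd :=
  .loop .mask .cap (.loop .j .n (best ;;
    .ite (0 - ♯.b) (.set .bv (.get .dist (♯.j * ♯.n + ♯.a0))) .skip ;;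
    .put .tab (♯.mask * ♯.n + ♯.j) ♯.bv))

/-- A correct entry, with bounds for its value. -/
def GoodEntry (Z : Fin n → Fin n → ℤ) (A : Finset (Fin n)) (B : ℤ) (a0 : Fin n) (s : St) (mask : ℕ)
    (x : Fin n) : Prop :=
  Entry Z A (rank A) a0 (tab s) mask x ∧ 0 ≤ tab s mask x ∧
    tab s mask x ≤ ((subsetOf A (rank A) mask).card + 1) * B

theorem wp_fill_cell (hb : TableBounds W Z B) (hβ : n ≤ β .n) (hT : Tables Z A s) {a0 : Fin n}
    (ha0 : s.reg .a0 = a0.val) {mask : ℕ} (hm : s.reg .mask = mask) (hmn : mask < 2 ^ n) {j : Fin n}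
    (hj : s.reg .j = j.val) (h1 : ∀ m < mask, ∀ x, GoodEntry Z A B a0 s m x)
    (h2 : ∀ x < j, GoodEntry Z A B a0 s mask x) :
    wp W β (best ;; .ite (0 - ♯.b) (.set .bv (.get .dist (♯.j * ♯.n + ♯.a0))) .skip ;;
      .put .tab (♯.mask * ♯.n + ♯.j) ♯.bv) s fun s' =>
      (∀ m < mask, ∀ x, GoodEntry Z A B a0 s' m x) ∧ ∀ x ≤ j, GoodEntry Z A B a0 s' mask x := by
  have hW := hb.index
  have h2n : (0 : ℤ) < 2 ^ n := by positivity
  have hnn : 0 ≤ (n : ℤ) * n := by positivity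
  have hnn2 : 0 ≤ (2 : ℤ) ^ n * n := by positivity
  have hB : 0 ≤ B := (hb.nonneg j j).trans (hb.le j j)
  have hlt (k : Fin n) (hk : k ∈ subsetOf A (rank A) mask) : mask - 2 ^ rank A k < mask := by
    have := two_pow_le_of_mem hk
    have : 0 < 2 ^ rank A k := by positivity
    omega
  have hmn' : (mask : ℤ) < 2 ^ n := by exact_mod_cast hmn
  have i4 : (mask : ℤ) * n ≤ 2 ^ n * n := by gcongr
  have i5 : (0 : ℤ) ≤ (mask : ℤ) * n := by positivity
  have i6 : (j.val : ℤ) < n := by exact_mod_cast j.isLt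
  have put_tab (s' : St) (hF : s'.arr .tab = s.arr .tab) (v : ℤ) (m : ℕ) (x : Fin n) :
      tab (s'.put .tab ((mask : ℤ) * n + j.val) v) m x =
        if m = mask ∧ x = j then v else tab s m x := by
    simp only [tab, St.put_arr, cell_inj, true_and, hF]
  -- Writing a correct value keeps all earlier entries.
  have fin (s' : St) (hF : s'.arr .tab = s.arr .tab) (v : ℤ) (hv : 0 ≤ v)
      (hv2 : v ≤ ((subsetOf A (rank A) mask).card + 1) * B)
      (he : subsetOf A (rank A) mask = ∅ → v = Z j a0)
      (hle : ∀ k ∈ subsetOf A (rank A) mask, v ≤ Z j k + tab s (mask - 2 ^ rank A k) k)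
      (heq : subsetOf A (rank A) mask ≠ ∅ →
        ∃ k ∈ subsetOf A (rank A) mask, v = Z j k + tab s (mask - 2 ^ rank A k) k) :
      (∀ m < mask, ∀ x, GoodEntry Z A B a0 (s'.put .tab ((mask : ℤ) * n + j.val) v) m x) ∧
      ∀ x ≤ j, GoodEntry Z A B a0 (s'.put .tab ((mask : ℤ) * n + j.val) v) mask x := by
    have old (m : ℕ) (hm : m < mask) (k : Fin n) :
        tab (s'.put .tab ((mask : ℤ) * n + j.val) v) m k = tab s m k := by
      rw [put_tab s' hF, if_neg (fun h => hm.ne h.1)]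
    have keep (m : ℕ) (hm : m ≤ mask) (x : Fin n) (hx : ¬ (m = mask ∧ x = j))
        (hg : GoodEntry Z A B a0 s m x) :
        GoodEntry Z A B a0 (s'.put .tab ((mask : ℤ) * n + j.val) v) m x := by
      have e : tab (s'.put .tab ((mask : ℤ) * n + j.val) v) m x = tab s m x := by
        rw [put_tab s' hF, if_neg hx]
      refine ⟨hg.1.congr e fun m' hm' k => old m' (hm'.trans_le hm) k, ?_⟩
      rw [e]; exact hg.2
    refine ⟨fun m hm x => keep m hm.le x (fun h => hm.ne h.1) (h1 m hm x), fun x hx => ?_⟩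
    rcases hx.lt_or_eq with hx | rfl
    · exact keep mask le_rfl x (fun h => hx.ne h.2) (h2 x hx)
    · have e : tab (s'.put .tab ((mask : ℤ) * n + x.val) v) mask x = v := by
        rw [put_tab s' hF, if_pos ⟨rfl, rfl⟩]
      refine ⟨⟨fun h => e.trans (he h), fun k hk => ?_, fun hne => ?_⟩, ?_⟩
      · rw [e, old _ (hlt k hk)]; exact hle k hk
      · obtain ⟨k, hk, hk2⟩ := heq hne
        exact ⟨k, hk, by rw [e, old _ (hlt k hk)]; exact hk2⟩
      · rw [e]; exact ⟨hv, hv2⟩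
  have hcard (k : Fin n) (hk : k ∈ subsetOf A (rank A) mask) :
      0 ≤ tab s (mask - 2 ^ rank A k) k ∧
        tab s (mask - 2 ^ rank A k) k ≤ (subsetOf A (rank A) mask).card * B := by
    have h := (h1 _ (hlt k hk) k).2
    rw [subsetOf_sub rank_injOn hk] at h
    have hc := Finset.card_erase_add_one hk
    have hc' : (((subsetOf A (rank A) mask).erase k).card : ℤ) + 1 =
      (subsetOf A (rank A) mask).card := by exact_mod_cast hc
    rwa [hc'] at h
  simp only [wp]
  refine wp_mono _ _ (wp_best hb hβ hT hm hmn hj fun k hk => ?_) fun s1 hF1 hI => ?_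
  · refine ⟨(hcard k hk).1, (hcard k hk).2.trans ?_⟩
    have : ((subsetOf A (rank A) mask).card : ℤ) ≤ n := by
      exact_mod_cast (Finset.card_le_univ _).trans (by simp)
    gcongr
    omega
  have r1 : s1.reg .n = n := (hF1.reg .n rfl).trans hT.n
  have r2 : s1.reg .mask = mask := (hF1.reg .mask rfl).trans hm
  have r3 : s1.reg .j = j.val := (hF1.reg .j rfl).trans hj
  have r4 : s1.reg .a0 = a0.val := (hF1.reg .a0 rfl).trans ha0
  have a1 : s1.arr .dist ((j.val : ℤ) * n + a0.val) = Z j a0 := by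
    rw [hF1.arr .dist rfl]; exact hT.dist j a0
  have i1 := index_bound j a0
  have i2 : (0 : ℤ) ≤ (j.val : ℤ) * n := by positivity
  rcases hI with ⟨hb1, hne⟩ | ⟨k, hb1, hbv, -, hk, hmin⟩
  · have hemp : subsetOf A (rank A) mask = ∅ :=
      Finset.eq_empty_of_forall_notMem fun k => hne k k.isLt
    simp [hb1, r1, r2, r3, r4, a1]
    refine ⟨by omega, by simp only [abs_le]; omega, by simp only [abs_le]; omega, ?_⟩
    refine fin _ (by simpa using hF1.arr .tab rfl) _ (hb.nonneg _ _) ?_ (fun _ => rfl) ?_ ?_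
    · simpa [hemp] using hb.le j a0
    · simp [hemp]
    · simp [hemp]
  · have i7 : (k.val : ℤ) < n := by exact_mod_cast k.isLt
    simp [hb1, hbv, r1, r2, r3, r4]
    refine ⟨by omega, by simp only [abs_le]; omega, ?_⟩
    refine fin _ (by simpa using hF1.arr .tab rfl) _ ?_ ?_ ?_ (fun k' hk' => hmin k' k'.isLt hk') ?_
    · have := hcard k hk; have := hb.nonneg j k; omega
    · have := hcard k hk; have := hb.le j k
      rw [add_mul]; omega
    · intro h; rw [h] at hk; simp at hk
    · exact fun _ => ⟨k, hk, rfl⟩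

theorem Tables.congr {s' : St} (hT : Tables Z A s) (h1 : s'.reg .n = s.reg .n)
    (h2 : s'.arr .act = s.arr .act) (h3 : s'.arr .dist = s.arr .dist)
    (h4 : s'.arr .pw = s.arr .pw) :
    Tables Z A s' :=
  ⟨h1.trans hT.n, by rw [h2]; exact hT.act, by rw [h3]; exact hT.dist, by rw [h4]; exact hT.pw⟩

theorem wp_fill (hb : TableBounds W Z B) (hβ : n ≤ β .n) (hβ2 : 2 ^ A.card ≤ β .cap)
    (hT : Tables Z A s) {a0 : Fin n}
    (ha0 : s.reg .a0 = a0.val) (hcap : s.reg .cap = 2 ^ A.card) :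
    wp W β fill s fun s' => ∀ m < 2 ^ A.card, ∀ x, GoodEntry Z A B a0 s' m x := by
  have hAn : 2 ^ A.card ≤ 2 ^ n :=
    Nat.pow_le_pow_right (by norm_num) ((Finset.card_le_univ A).trans (by simp))
  refine wp_for (fun M s' => ∀ m < M, ∀ x, GoodEntry Z A B a0 s' m x) (2 ^ A.card)
    (by rw [hcap]; push_cast; rfl) hβ2 (fun m hm => absurd hm (Nat.not_lt_zero _)) ?_
    fun s' _ _ h => h
  intro mask hmask s' hF hm hI
  have hT' : Tables Z A s' :=
    hT.congr (hF.reg .n rfl) (hF.arr .act rfl) (hF.arr .dist rfl) (hF.arr .pw rfl)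
  refine triple_of_wp _ _ (wp_forFin (fun j s'' => (∀ m < mask, ∀ x, GoodEntry Z A B a0 s'' m x) ∧
    ∀ x : Fin n, x.val < j → GoodEntry Z A B a0 s'' mask x) hT'.n hβ ?_ ?_ ?_)
  · exact ⟨hI, fun x hx => absurd hx (Nat.not_lt_zero _)⟩
  · rintro j s'' hF2 hj ⟨h1, h2⟩
    have hT'' : Tables Z A s'' :=
      hT'.congr (hF2.reg .n rfl) (hF2.arr .act rfl) (hF2.arr .dist rfl) (hF2.arr .pw rfl)
    refine wp_mono _ _ (wp_fill_cell hb hβ hT'' (a0 := a0) ?_ ((hF2.reg .mask rfl).trans hm)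
      (hmask.trans_le hAn) hj h1 h2) ?_
    · rw [hF2.reg .a0 rfl, hF.reg .a0 rfl, ha0]
    · rintro s3 _ ⟨h3, h4⟩
      exact ⟨h3, fun x hx => h4 x (Nat.lt_succ_iff.1 hx)⟩
  · rintro s'' hF2 ⟨h1, h2⟩ m hm x
    rcases Nat.lt_succ_iff_lt_or_eq.1 hm with h | rfl
    · exact h1 m h x
    · exact h2 x x.isLt

/-- Follows the best steps through the table, inserting one city after the other into a tour. -/
def follow : Cmd :=
  .set .j ♯.a0 ;; .set .mask (♯.cap - 1 - .get .pw ♯.a0) ;;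
  .loop .t .n (best ;; .ite (♯.b + 1)
    (.put .nxt ♯.b (.get .nxt ♯.j) ;; .put .nxt ♯.j ♯.b ;;
      .set .mask (♯.mask - .get .pw ♯.b) ;; .set .j ♯.b) .skip)

theorem subsetOf_full {a : Fin n} (ha : a ∈ A) :
    subsetOf A (rank A) (2 ^ A.card - 1 - 2 ^ rank A a) = A.erase a := by
  have full : subsetOf A (rank A) (2 ^ A.card - 1) = A := by
    ext x
    simp only [subsetOf, Finset.mem_filter, Nat.testBit_two_pow_sub_one, decide_eq_true_eq]
    exact ⟨fun h => h.1, fun h => ⟨h, rank_lt_card h⟩⟩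
  rw [subsetOf_sub rank_injOn (by rw [full]; exact ha), full]

/-- The state while a tour is read off the table: `τ` is a tour through the cities visited so far,
it leads from the last one, `j`, back to `a0`, and `mask` stands for the cities not yet visited.
The best completion of the path to `j` has length `L`. -/
structure Partial (Z : Fin n → Fin n → ℤ) (A : Finset (Fin n)) (B : ℤ) (a0 : Fin n) (L : ℤ) (t : ℕ)
    (s : St) (mask : ℕ) (j : Fin n) (τ : Perm (Fin n)) : Prop where
  mask_eq : s.reg .mask = mask
  mask_lt : mask < 2 ^ A.card
  j_eq : s.reg .j = j.val
  tour : τ.IsTourOn (A \ subsetOf A (rank A) mask)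
  mem : j ∈ A \ subsetOf A (rank A) mask
  apply : τ j = a0
  nxt : Holds (s.arr .nxt) fun x => ((τ x).val : ℤ)
  length : permCost Z τ - Z j a0 + tab s mask j = L
  count : (subsetOf A (rank A) mask).card + t ≤ n ∨ subsetOf A (rank A) mask = ∅

theorem wp_follow (hZ : IsDist Z) (hb : TableBounds W Z B) (hβ : n ≤ β .n) (hT : Tables Z A s)
    {a0 : Fin n} (ha0A : a0 ∈ A) (ha0 : s.reg .a0 = a0.val) (hcap : s.reg .cap = 2 ^ A.card)
    (hnxt : Holds (n := n) (s.arr .nxt) fun x => (x.val : ℤ))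
    (hG : ∀ m < 2 ^ A.card, ∀ x, GoodEntry Z A B a0 s m x) :
    wp W β follow s fun s' => ∃ τ : Perm (Fin n), τ.IsTourOn A ∧
      Holds (s'.arr .nxt) (fun x => ((τ x).val : ℤ)) ∧
      permCost Z τ = tab s (2 ^ A.card - 1 - 2 ^ rank A a0) a0 := by
  have hW := hb.index
  have hAn : 2 ^ A.card ≤ 2 ^ n :=
    Nat.pow_le_pow_right (by norm_num) ((Finset.card_le_univ A).trans (by simp))
  have hAn' : (2 : ℤ) ^ A.card ≤ 2 ^ n := by exact_mod_cast hAn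
  have hA0 : 0 < 2 ^ A.card := by positivity
  have hA0' : (0 : ℤ) < 2 ^ A.card := by positivity
  have h2n : (0 : ℤ) < 2 ^ n := by positivity
  have hnn : 0 ≤ (n : ℤ) * n := by positivity
  have hnn2 : 0 ≤ (2 : ℤ) ^ n * n := by positivity
  have hB : 0 ≤ B := (hb.nonneg a0 a0).trans (hb.le a0 a0)
  have hr : 2 ^ rank A a0 < 2 ^ A.card := Nat.pow_lt_pow_right (by norm_num) (rank_lt_card ha0A)
  have hr' : (2 : ℤ) ^ rank A a0 < 2 ^ A.card := by exact_mod_cast hr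
  have hr0 : (0 : ℤ) < 2 ^ rank A a0 := by positivity
  have ep := hT.pw a0 ha0A
  simp [follow, wp, ha0, hcap, ep]
  refine ⟨by simp only [abs_le]; omega, wp_forFin (fun t s' => ∃ mask j τ,
    Partial Z A B a0 (tab s (2 ^ A.card - 1 - 2 ^ rank A a0) a0) t s' mask j τ)
    (by simpa using hT.n) hβ ?_ ?_ ?_⟩
  · have hsd : A \ A.erase a0 = {a0} := Finset.sdiff_erase_self ha0A
    refine ⟨2 ^ A.card - 1 - 2 ^ rank A a0, a0, 1, ?_,
      lt_of_le_of_lt (Nat.sub_le _ _) (Nat.sub_lt hA0 one_pos), by simp, ?_, ?_, rfl, ?_, ?_, ?_⟩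
    · have h1 : 2 ^ rank A a0 ≤ 2 ^ A.card - 1 := by omega
      have h2 : ((2 ^ A.card - 1 - 2 ^ rank A a0 : ℕ) : ℤ) = 2 ^ A.card - 1 - 2 ^ rank A a0 := by
        rw [Nat.cast_sub h1, Nat.cast_sub (by omega)]
        push_cast
        rfl
      exact h2.symm
    · rw [subsetOf_full ha0A, hsd]
      refine ⟨fun _ _ => rfl, fun x hx y hy => ?_⟩
      rw [Finset.mem_singleton.1 hx, Finset.mem_singleton.1 hy]
    · rw [subsetOf_full ha0A, hsd]; simp
    · simpa using hnxt
    · simp [permCost, hZ.self, tab]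
    · left
      rw [subsetOf_full ha0A]
      exact (Finset.card_le_univ _).trans (by simp)
  · rintro i s1 hF1 hi ⟨mask, j, τ, hP⟩
    have hT1 : Tables Z A s1 :=
      hT.congr (hF1.reg .n rfl) (hF1.arr .act rfl) (hF1.arr .dist rfl) (hF1.arr .pw rfl)
    have hG1 (m : ℕ) (hm : m < 2 ^ A.card) (x : Fin n) : GoodEntry Z A B a0 s1 m x := by
      have e : (tab s1 : ℕ → Fin n → ℤ) = tab s := by
        funext m x; simp only [tab, hF1.arr .tab rfl]; rfl
      have := hG m hm x
      unfold GoodEntry at this ⊢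
      rwa [e]
    have hE := hG1 mask hP.mask_lt j
    simp only [wp]
    refine wp_mono _ _ (wp_best hb hβ hT1 hP.mask_eq (hP.mask_lt.trans_le hAn) hP.j_eq
      fun k hk => ?_) fun s2 hF2 hI => ?_
    · have := hG1 (mask - 2 ^ rank A k) (lt_of_le_of_lt (Nat.sub_le _ _) hP.mask_lt) k
      refine ⟨this.2.1, this.2.2.trans ?_⟩
      have : ((subsetOf A (rank A) (mask - 2 ^ rank A k)).card : ℤ) ≤ n := by
        exact_mod_cast (Finset.card_le_univ _).trans (by simp)
      gcongr
    have etab : (tab s2 : ℕ → Fin n → ℤ) = tab s1 := by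
      funext m x; simp only [tab, hF2.arr .tab rfl]
    rcases hI with ⟨hb1, hne⟩ | ⟨k, hb1, -, -, hk, hmin⟩
    · have hemp : subsetOf A (rank A) mask = ∅ :=
        Finset.eq_empty_of_forall_notMem fun k => hne k k.isLt
      simp [hb1]
      refine ⟨by omega, mask, j, τ, ?_, hP.mask_lt, ?_, hP.tour, hP.mem, hP.apply, ?_, ?_,
        Or.inr hemp⟩
      · simpa using (hF2.reg .mask rfl).trans hP.mask_eq
      · simpa using (hF2.reg .j rfl).trans hP.j_eq
      · simpa [hF2.arr .nxt rfl] using hP.nxt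
      · exact etab ▸ hP.length
    · have hkn : (k.val : ℤ) < n := by exact_mod_cast k.isLt
      have hkA : k ∈ A := (Finset.mem_filter.1 hk).1
      have hle := two_pow_le_of_mem hk
      have r1 : s2.reg .j = j.val := (hF2.reg .j rfl).trans hP.j_eq
      have r2 : s2.reg .mask = mask := (hF2.reg .mask rfl).trans hP.mask_eq
      have a1 : s2.arr .nxt j.val = a0.val := by
        rw [hF2.arr .nxt rfl]
        simpa [hP.apply] using hP.nxt j
      have a2 : s2.arr .pw k.val = 2 ^ rank A k := by
        rw [hF2.arr .pw rfl]; exact hT1.pw k hkA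
      have hmask : (mask : ℤ) < 2 ^ A.card := by exact_mod_cast hP.mask_lt
      have hle' : (2 : ℤ) ^ rank A k ≤ mask := by exact_mod_cast hle
      have hr0 : (0 : ℤ) < 2 ^ rank A k := by positivity
      have hkU : k ∉ A \ subsetOf A (rank A) mask := fun h => (Finset.mem_sdiff.1 h).2 hk
      have hjk : j ≠ k := fun e => hkU (e ▸ hP.mem)
      have hjk' : j.val ≠ k.val := fun e => hjk (Fin.ext e)
      have hU : A \ subsetOf A (rank A) (mask - 2 ^ rank A k) =
          insert k (A \ subsetOf A (rank A) mask) := by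
        rw [subsetOf_sub rank_injOn hk, Finset.sdiff_erase hkA]
      simp [hb1, r1, r2, a1, a2]
      refine ⟨by simp only [abs_le]; omega, by simp only [abs_le]; omega, ?_⟩
      refine ⟨mask - 2 ^ rank A k, k, τ * swap j k, ?_,
        lt_of_le_of_lt (Nat.sub_le _ _) hP.mask_lt, by simp, ?_, ?_, ?_, ?_, ?_, ?_⟩
      · simp [Nat.cast_sub hle]
      · rw [hU]; exact hP.tour.insert_after hP.mem hkU
      · rw [hU]; exact Finset.mem_insert_self _ _
      · simp [hP.apply]
      · intro x
        by_cases h1 : x = j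
        · subst h1
          simp [hP.tour.fixed k hkU]
        · have h1' : x.val ≠ j.val := fun e => h1 (Fin.ext e)
          by_cases h2 : x = k
          · subst h2; simp [h1', hP.apply]
          · have h2' : x.val ≠ k.val := fun e => h2 (Fin.ext e)
            have := hP.nxt x
            rw [← hF2.arr .nxt rfl] at this
            simpa [h1', h2', swap_apply_of_ne_of_ne h1 h2] using this
      · have hval : tab s1 mask j = Z j k + tab s1 (mask - 2 ^ rank A k) k := by
          refine le_antisymm (hE.1.le k hk) ?_
          obtain ⟨k', hk', e⟩ := hE.1.eq (Finset.ne_empty_of_mem hk)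
          rw [e]
          exact hmin k' k'.isLt hk'
        have hlen := hP.length
        have hins := hZ.permCost_insert_after hjk (hP.tour.fixed k hkU)
        rw [hP.apply] at hins
        have e2 : tab s2 (mask - 2 ^ rank A k) k = tab s1 (mask - 2 ^ rank A k) k := by rw [etab]
        change permCost Z (τ * swap j k) - Z k a0 + tab s2 (mask - 2 ^ rank A k) k = _
        rw [e2]
        linarith
      · left
        have hc := Finset.card_erase_add_one hk
        rw [← subsetOf_sub rank_injOn hk] at hc
        rcases hP.count with h | h
        · omega
        · rw [h] at hk; simp at hk
  · rintro s1 hF1 ⟨mask, j, τ, hP⟩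
    have hemp : subsetOf A (rank A) mask = ∅ := by
      rcases hP.count with h | h
      · exact Finset.card_eq_zero.1 (by omega)
      · exact h
    have e : tab s1 mask j = tab s mask j := by simp only [tab, hF1.arr .tab rfl]; rfl
    have h1 := (hG mask hP.mask_lt j).1.empty hemp
    have h2 := hP.tour
    have h3 := hP.length
    rw [hemp, Finset.sdiff_empty] at h2
    exact ⟨τ, h2, hP.nxt, by rw [e, h1] at h3; linarith⟩

/-- Computes a shortest tour through the active cities. -/
def heldKarp : Cmd := bits ;; fill ;; follow

theorem wp_heldKarp (hZ : IsDist Z) (hb : TableBounds W Z B) (hβ : n ≤ β .n)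
    (hβ2 : 2 ^ A.card ≤ β .cap) (hn : s.reg .n = n) (hact : Holds (s.arr .act) (ind A))
    (hdist : HoldsMat (s.arr .dist) Z) (hA : A.Nonempty) :
    wp W β heldKarp s fun s' => ∃ τ : Perm (Fin n), τ.IsTourOn A ∧
      Holds (s'.arr .nxt) (fun x => ((τ x).val : ℤ)) ∧
      ∀ h : Perm (Fin n), h.IsTourOn A → permCost Z τ ≤ permCost Z h := by
  simp only [heldKarp, wp]
  refine wp_mono _ _ (wp_bits hb hβ hn hact hA) ?_
  rintro s1 hF1 ⟨hcap, ⟨a0, ha0A, ha0⟩, hnxt, hpw⟩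
  have hT1 : Tables Z A s1 := ⟨(hF1.reg .n rfl).trans hn, by rw [hF1.arr .act rfl]; exact hact,
    by rw [hF1.arr .dist rfl]; exact hdist, hpw⟩
  refine wp_mono _ _ (wp_fill hb hβ hβ2 hT1 ha0 hcap) fun s2 hF2 hG => ?_
  have hT2 : Tables Z A s2 :=
    hT1.congr (hF2.reg .n rfl) (hF2.arr .act rfl) (hF2.arr .dist rfl) (hF2.arr .pw rfl)
  refine wp_mono _ _ (wp_follow hZ hb hβ hT2 ha0A ((hF2.reg .a0 rfl).trans ha0)
    ((hF2.reg .cap rfl).trans hcap) (by rw [hF2.arr .nxt rfl]; exact hnxt) hG) ?_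
  rintro s3 - ⟨τ, hτ, hN, hlen⟩
  refine ⟨τ, hτ, hN, fun h hh => ?_⟩
  have hA0 : 0 < 2 ^ A.card := by positivity
  have := hZ.entry_le rank_injOn (fun m hm x => (hG m hm x).1) (A.erase a0)
    (mask := 2 ^ A.card - 1 - 2 ^ rank A a0)
    (lt_of_le_of_lt (Nat.sub_le _ _) (Nat.sub_lt hA0 one_pos)) (subsetOf_full ha0A) (j := a0)
    (i := h⁻¹ a0) (by simp) (by rwa [Finset.insert_erase ha0A]) (by simp)
  rw [hlen]
  linarith

end TourProgram

namespace TourProgram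

open RAM

/-! ### One round: cycle cover and choice of representatives -/

variable {n : ℕ} {W : ℤ} {β : Var → ℕ} {s : St} {Z : Fin n → Fin n → ℤ} {A : Finset (Fin n)} {B : ℤ}

/-- Writes the penalized distances to the cost matrix; the diagonal is corrected afterwards. -/
def penalize : Cmd :=
  .loop .i .n (.loop .j .n
      (.put .cost (♯.i * ♯.n + ♯.j) (.get .dist (♯.i * ♯.n + ♯.j) + ♯.big * (1 - .get .act ♯.i))) ;;
    .put .cost (♯.i * ♯.n + ♯.i) (.get .dist (♯.i * ♯.n + ♯.i) + ♯.big * .get .act ♯.i))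

theorem wp_penalize (hZ0 : ∀ i j, 0 ≤ Z i j) (hZB : ∀ i j, Z i j ≤ B) (hW : 2 * B ≤ W)
    (hW2 : n * n + n + 1 ≤ W) (hβ : n ≤ β .n) (hn : s.reg .n = n)
    (hact : Holds (s.arr .act) (ind A)) (hdist : HoldsMat (s.arr .dist) Z) (hbig : s.reg .big = B) :
    wp W β penalize s fun s' => HoldsMat (s'.arr .cost) (penalized Z B A) := by
  have hnn : 0 ≤ (n : ℤ) * n := by positivity
  refine wp_forFin (fun i s' => ∀ i' j' : Fin n, i'.val < i →
    s'.arr .cost ((i'.val : ℤ) * n + j'.val) = penalized Z B A i' j') hn hβ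
    (fun i' j' h => absurd h (Nat.not_lt_zero _)) ?_ fun s' _ h i j => h i j i.isLt
  intro i s1 hF1 hi hI
  have hn1 : s1.reg .n = n := (hF1.reg .n rfl).trans hn
  have i2 : (0 : ℤ) ≤ (i.val : ℤ) * n := by positivity
  have i3 : (i.val : ℤ) < n := by exact_mod_cast i.isLt
  have a1 : s1.arr .act i.val = ind A i := by rw [hF1.arr .act rfl]; exact hact i
  have a2 (j : Fin n) : s1.arr .dist ((i.val : ℤ) * n + j.val) = Z i j := by
    rw [hF1.arr .dist rfl]; exact hdist i j
  have r3 : s1.reg .big = B := by rw [hF1.reg .big rfl, hbig]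
  have hx : ind A i = 0 ∨ ind A i = 1 := by
    unfold ind; split_ifs <;> simp
  have hB : 0 ≤ B := (hZ0 i i).trans (hZB i i)
  simp only [wp]
  refine wp_forFin (fun j s' =>
    (∀ i' j' : Fin n, i'.val < i.val →
      s'.arr .cost ((i'.val : ℤ) * n + j'.val) = penalized Z B A i' j') ∧
    ∀ j' : Fin n, j'.val < j →
      s'.arr .cost ((i.val : ℤ) * n + j'.val) = Z i j' + B * (1 - ind A i)) hn1 hβ ?_ ?_ ?_
  · exact ⟨hI, fun j' h => absurd h (Nat.not_lt_zero _)⟩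
  · rintro j s2 hF2 hj ⟨hJ, hJ2⟩
    have r1 : s2.reg .n = n := (hF2.reg .n rfl).trans hn1
    have r2 : s2.reg .i = i.val := (hF2.reg .i rfl).trans hi
    have r4 : s2.reg .big = B := by rw [hF2.reg .big rfl, r3]
    have b1 : s2.arr .act i.val = ind A i := by rw [hF2.arr .act rfl, a1]
    have b2 : s2.arr .dist ((i.val : ℤ) * n + j.val) = Z i j := by rw [hF2.arr .dist rfl, a2]
    have i1 := index_bound i j
    have i4 : (j.val : ℤ) < n := by exact_mod_cast j.isLt
    have z0 := hZ0 i j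
    have z1 := hZB i j
    simp [-abs_mul, wp, r1, r2, r4, hj, b1, b2, cell_inj]
    refine ⟨by simp only [abs_le]; omega, ?_, ?_, ?_⟩
    · rcases hx with h | h <;> rw [h] <;>
        simp only [sub_zero, sub_self, mul_one, mul_zero, abs_le] <;> omega
    · intro i' j' h
      rw [if_neg (fun hc => absurd hc.1 (Nat.ne_of_lt h))]
      exact hJ i' j' h
    · intro j' h
      by_cases h' : j' = j
      · simp [h']
      · rw [if_neg (fun e => h' (Fin.ext e))]
        exact hJ2 j' (lt_of_le_of_ne h (fun e => h' (Fin.ext e)))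
  · rintro s2 hF2 ⟨hJ, hJ2⟩
    have r1 : s2.reg .n = n := (hF2.reg .n rfl).trans hn1
    have r2 : s2.reg .i = i.val := (hF2.reg .i rfl).trans hi
    have r4 : s2.reg .big = B := by rw [hF2.reg .big rfl, r3]
    have b1 : s2.arr .act i.val = ind A i := by rw [hF2.arr .act rfl, a1]
    have b2 : s2.arr .dist ((i.val : ℤ) * n + i.val) = Z i i := by rw [hF2.arr .dist rfl, a2]
    have i1 := index_bound i i
    have z0 := hZ0 i i
    have z1 := hZB i i
    simp [-abs_mul, r1, r2, r4, b1, b2, cell_inj]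
    refine ⟨by simp only [abs_le]; omega, ?_, ?_⟩
    · rcases hx with h | h <;> rw [h] <;> simp only [mul_one, mul_zero, abs_le] <;> omega
    · intro i' j' h
      by_cases h1 : i' = i
      · subst h1
        by_cases h2 : j' = i'
        · subst h2
          simp [penalized, ind]
        · simp [h2, hJ2 j' j'.isLt, penalized, ind, Ne.symm h2]
      · have h1' : i'.val ≠ i.val := fun e => h1 (Fin.ext e)
        rw [if_neg (fun hc => h1' hc.1)]
        exact hJ i' j' (lt_of_le_of_ne h h1')

/-- Composes the current permutation with the new one. -/
def compose : Cmd := .loop .x .n (.put .g ♯.x (.get .p (.get .g ♯.x)))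

theorem wp_compose (hβ : n ≤ β .n) (hn : s.reg .n = n) {g π : Perm (Fin n)}
    (hg : Holds (s.arr .g) fun i => ((g i).val : ℤ))
    (hp : Holds (s.arr .p) fun i => ((π i).val : ℤ)) :
    wp W β compose s fun s' => Holds (s'.arr .g) fun i => (((π * g) i).val : ℤ) := by
  refine wp_forFin (fun i s' => ∀ x : Fin n, s'.arr .g x.val =
    if x.val < i then (((π * g) x).val : ℤ) else (g x).val) hn hβ ?_ ?_ ?_
  · intro x; simpa using hg x
  · intro i s1 hF hi hI
    have a1 : s1.arr .g i.val = (g i).val := by simpa using hI i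
    have a2 : s1.arr .p (g i).val = (π (g i)).val := by rw [hF.arr .p rfl]; exact hp (g i)
    simp [wp, hi, a1, a2]
    intro x
    by_cases h : x = i
    · subst h; simp
    · have h' : x.val ≠ i.val := fun e => h (Fin.ext e)
      simpa [h', Ne.le_iff_lt h] using hI x
  · intro s1 _ h x
    simpa using h x

/-- Keeps only those active cities that are least in their cycle, and counts them. -/
def least : Cmd :=
  .set .m 0 ;;
  .loop .i .n (.set .f (.get .act ♯.i) ;; .set .x ♯.i ;;
    .loop .t .n (.set .x (.get .p ♯.x) ;; .ite (♯.i - ♯.x) (.set .f 0) .skip) ;;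
    .put .act ♯.i ♯.f ;; .set .m (♯.m + ♯.f))

/-- The first `n` steps decide whether a city is the least one of its cycle. -/
theorem forall_sameCycle_le_iff (π : Perm (Fin n)) (i : Fin n) :
    (∀ b, SameCycle π i b → i ≤ b) ↔ ∀ t < n, i ≤ (π ^ (t + 1)) i := by
  refine ⟨fun h t _ => h _ ((sameCycle_pow_right (n := t + 1)).2 SameCycle.rfl), fun h b hb => ?_⟩
  by_cases hi : i ∈ π.support
  · obtain ⟨t, ht, rfl⟩ := hb.exists_pow_eq_of_mem_support hi
    rcases t with _ | t
    · simp
    · refine h t ?_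
      have := (Finset.card_le_univ (π.cycleOf i).support)
      rw [Fintype.card_fin] at this
      omega
  · rw [notMem_support] at hi
    exact (hb.eq_of_left hi).le

theorem wp_least (hβ : n ≤ β .n) (hnW : n + 1 ≤ W) (hn : s.reg .n = n) {π : Perm (Fin n)}
    (hact : Holds (s.arr .act) (ind A)) (hp : Holds (s.arr .p) fun i => ((π i).val : ℤ)) :
    wp W β least s fun s' => ∃ A' : Finset (Fin n),
      (∀ a, a ∈ A' ↔ a ∈ A ∧ ∀ b, SameCycle π a b → a ≤ b) ∧ Holds (s'.arr .act) (ind A') ∧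
      s'.reg .m = A'.card := by
  classical
  let A' : Finset (Fin n) := A.filter fun a => ∀ b, SameCycle π a b → a ≤ b
  have hA' (a : Fin n) : a ∈ A' ↔ a ∈ A ∧ ∀ b, SameCycle π a b → a ≤ b := by simp [A']
  simp [least, wp]
  refine ⟨by omega, wp_forFin (fun i s' => s'.reg .m = (A'.filter fun y => y.val < i).card ∧
    ∀ x : Fin n, s'.arr .act x.val = if x.val < i then ind A' x else ind A x)
    (by simpa using hn) hβ ?_ ?_ ?_⟩
  · refine ⟨by simp, fun x => by simpa using hact x⟩
  · rintro i s1 hF1 hi ⟨hm, hI⟩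
    have r1 : s1.reg .n = n := by rw [hF1.reg .n rfl]; simpa using hn
    have a1 : s1.arr .act i.val = ind A i := by simpa using hI i
    simp [wp, hi, a1]
    refine wp_forFin (fun t s' => s'.reg .x = ((π ^ t) i).val ∧
      s'.reg .f = if ∀ t' < t, i ≤ (π ^ (t' + 1)) i then ind A i else 0) (by simpa using r1) hβ
      ?_ ?_ ?_
    · simp
    · rintro t s2 hF2 ht ⟨hx, hf⟩
      have r2 : s2.reg .i = i.val := by rw [hF2.reg .i rfl]; simpa using hi
      have a2 : s2.arr .p ((π ^ t.val) i).val = ((π ^ (t.val + 1)) i).val := by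
        rw [hF2.arr .p rfl, pow_succ', mul_apply]
        simpa [hF1.arr .p rfl] using hp ((π ^ t.val) i)
      have i1 : (i.val : ℤ) < n := by exact_mod_cast i.isLt
      have i2 : (((π ^ (t.val + 1)) i).val : ℤ) < n := by exact_mod_cast ((π ^ (t.val + 1)) i).isLt
      have hiff : (∀ t' < t.val + 1, i ≤ (π ^ (t' + 1)) i) ↔
          (∀ t' < t.val, i ≤ (π ^ (t' + 1)) i) ∧ i ≤ (π ^ (t.val + 1)) i := by
        constructor
        · exact fun h => ⟨fun t' ht' => h t' (by omega), h t.val (by omega)⟩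
        · rintro ⟨h1, h2⟩ t' ht'
          rcases Nat.lt_succ_iff_lt_or_eq.1 ht' with h | h
          · exact h1 t' h
          · rw [h]; exact h2
      simp only [hiff]
      simp [wp, hx, a2, r2, hf]
      refine ⟨by simp only [abs_le]; omega, fun h => ⟨by omega, fun _ h2 => absurd h (not_lt.2 h2)⟩,
        fun h => by simp [h]⟩
    · rintro s2 hF2 ⟨-, hf⟩
      have r2 : s2.reg .i = i.val := by rw [hF2.reg .i rfl]; simpa using hi
      have r3 : s2.reg .m = s1.reg .m := by rw [hF2.reg .m rfl]; simp
      have a2 : s2.arr .act = s1.arr .act := by rw [hF2.arr .act rfl]; simp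
      simp only [← forall_sameCycle_le_iff] at hf
      have hf' : s2.reg .f = ind A' i := by
        rw [hf]
        by_cases h1 : ∀ b, SameCycle π i b → i ≤ b
        · have h2 : i ∈ A' ↔ i ∈ A := by rw [hA']; exact and_iff_left h1
          simp only [if_pos h1, ind, h2]
        · rw [if_neg h1, ind, if_neg (fun h => h1 ((hA' i).1 h).2)]
      have hfc : s2.reg .m + s2.reg .f = (A'.filter fun y => y.val < i.val + 1).card := by
        rw [card_filter_succ, r3, hm, hf', rank, ind]
        push_cast
        rfl
      have hle : (A'.filter fun y => y.val < i.val + 1).card ≤ n :=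
        (Finset.card_le_univ _).trans (by simp)
      simp [-Order.lt_add_one_iff, r2, hfc]
      refine ⟨by omega, ?_, fun x => ?_⟩
      · simp
      · by_cases h : x = i
        · subst h; simp [hf']
        · have h' : x.val ≠ i.val := fun e => h (Fin.ext e)
          simpa [h', Ne.le_iff_lt h, a2] using hI x
  · rintro s' - ⟨hm, hI⟩
    refine ⟨A', hA', fun x => by simpa using hI x, ?_⟩
    rwa [Finset.filter_true_of_mem (fun y _ => y.isLt)] at hm

end TourProgram

namespace TourProgram

open RAM

/-! ### Repeated cycle covers -/

variable {n : ℕ} {W : ℤ} {β : Var → ℕ} {s : St} {Z : Fin n → Fin n → ℤ} {A : Finset (Fin n)} {B : ℤ}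

/-- One round: a shortest cycle cover of the active cities is composed with the current permutation,
and only the least city of every cycle stays active. -/
def round : Cmd := penalize ;; assign ;; compose ;; least

/-- `W` is large enough for the intermediate results that arise for `n` cities, integral distances
`Z` below `B`, and the ratio `rn / rd` scaled by `c`. -/
structure Bounds (W : ℤ) (n : ℕ) (Z : Fin n → Fin n → ℤ) (B rn rd : ℤ) (c : ℕ) : Prop where
  sum_lt : ∑ i, ∑ j, Z i j < B
  size : 16 * ((n + 2) * B) ≤ W
  index : 2 ^ n * n + 2 * 2 ^ n + n * n + n + 2 ≤ W
  num : n * rn ≤ W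
  den : c * (n * rd) ≤ W

variable {rn rd : ℤ} {c : ℕ}

theorem Bounds.le (hb : Bounds W n Z B rn rd c) (hZ : IsDist Z) (i j : Fin n) : Z i j ≤ B := by
  refine le_of_lt (lt_of_le_of_lt ?_ hb.sum_lt)
  refine (Finset.single_le_sum (f := fun j => Z i j) (fun j _ => hZ.nonneg i j)
    (Finset.mem_univ j)).trans ?_
  exact Finset.single_le_sum (f := fun i => ∑ j, Z i j)
    (fun i _ => Finset.sum_nonneg fun j _ => hZ.nonneg i j) (Finset.mem_univ i)

theorem Bounds.pos (hb : Bounds W n Z B rn rd c) (hZ : IsDist Z) : 0 < B :=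
  lt_of_le_of_lt (Finset.sum_nonneg fun i _ => Finset.sum_nonneg fun j _ => hZ.nonneg i j) hb.sum_lt

theorem wp_round (hZ : IsDist Z) (hb : Bounds W n Z B rn rd c) (hβ : n ≤ β .n) (hn : s.reg .n = n)
    (hbig : s.reg .big = B) (hact : Holds (s.arr .act) (ind A)) (hdist : HoldsMat (s.arr .dist) Z)
    (hA : 2 ≤ A.card) {g : Perm (Fin n)} (hg : Holds (s.arr .g) fun i => ((g i).val : ℤ))
    (hgA : g.IsTransversal A) {h : Perm (Fin n)} (hh : h.IsTourOn Finset.univ) :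
    wp W β round s fun s' => ∃ (g' : Perm (Fin n)) (A' : Finset (Fin n)),
      g'.IsTransversal A' ∧ Holds (s'.arr .act) (ind A') ∧
      (Holds (s'.arr .g) fun i => ((g' i).val : ℤ)) ∧ s'.reg .m = A'.card ∧
      2 * A'.card ≤ A.card ∧ permCost Z g' ≤ permCost Z g + permCost Z h := by
  have hn1 : 0 < n := by
    have := A.card_le_univ
    rw [Fintype.card_fin] at this
    omega
  have hB := hb.pos hZ
  have hx1 : (2 : ℤ) ^ n * n + 2 * 2 ^ n ≥ 0 := by positivity
  have hx2 : (0 : ℤ) ≤ n * n := by positivity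
  have hx3 : 0 ≤ n * B := by positivity
  have hsz := hb.size
  have hix := hb.index
  rw [add_mul] at hsz
  simp only [round, wp]
  refine wp_mono _ _ (wp_penalize hZ.nonneg (hb.le hZ) (by omega) (by omega) hβ hn hact hdist hbig)
    fun s1 hF1 hc1 => ?_
  have hn_1 : s1.reg .n = n := (hF1.reg .n rfl).trans hn
  have hcb : CostBounds W (penalized Z B A) (2 * B) := by
    have key (i j : Fin n) : 0 ≤ penalized Z B A i j ∧ penalized Z B A i j ≤ 2 * B := by
      have z0 := hZ.nonneg i j
      have z1 := hb.le hZ i j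
      unfold penalized
      split_ifs <;> constructor <;> linarith
    refine ⟨fun i j => (key i j).1, fun i j => (key i j).2, ?_, by omega⟩
    linarith
  refine wp_mono _ _ (wp_assign hcb hn1 hβ hn_1 hc1) fun s2 hF2 ⟨π, hp, hmin⟩ => ?_
  have hn_2 : s2.reg .n = n := (hF2.reg .n rfl).trans hn_1
  obtain ⟨hfix, hne, hle⟩ := hZ.of_penalized_minimal hb.sum_lt hA hh hmin
  have hg2 : Holds (s2.arr .g) fun i => ((g i).val : ℤ) := by
    rw [hF2.arr .g rfl, hF1.arr .g rfl]; exact hg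
  refine wp_mono _ _ (wp_compose hβ hn_2 hg2 hp) fun s3 hF3 hg3 => ?_
  have hn_3 : s3.reg .n = n := (hF3.reg .n rfl).trans hn_2
  have hact3 : Holds (s3.arr .act) (ind A) := by
    rw [hF3.arr .act rfl, hF2.arr .act rfl, hF1.arr .act rfl]; exact hact
  have hp3 : Holds (s3.arr .p) fun i => ((π i).val : ℤ) := by rw [hF3.arr .p rfl]; exact hp
  refine wp_mono _ _ (wp_least hβ (by omega) hn_3 hact3 hp3) fun s4 hF4 ⟨A', hA', hact4, hm⟩ => ?_
  refine ⟨π * g, A', hgA.mul_least hfix hA', hact4, ?_, hm, two_mul_card_least_le hfix hne hA', ?_⟩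
  · rw [hF4.arr .g rfl]; exact hg3
  · exact (hZ.permCost_mul_le π g).trans (by linarith)

/-- Rounds are carried out as long as there are more than `c * n / r` active cities, where
`r = rn / rd`; `n` repetitions are enough. -/
def mainLoop (c : ℕ) : Cmd :=
  .loop .it .n (.ite (♯.m * ♯.rn - .lit c * (♯.n * ♯.rd)) round .skip)

/-- The state after `e` rounds: a permutation whose cycles are represented by the cities in `A`. The
field `last` records that the last round was still needed. -/
structure Reached (Z : Fin n → Fin n → ℤ) (h : Perm (Fin n)) (rn rd : ℤ) (c : ℕ) (s : St)
    (g : Perm (Fin n)) (A : Finset (Fin n)) (e : ℕ) : Prop where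
  transversal : g.IsTransversal A
  act : Holds (s.arr .act) (ind A)
  perm : Holds (s.arr .g) fun i => ((g i).val : ℤ)
  m : s.reg .m = A.card
  length : permCost Z g ≤ e * permCost Z h
  card : A.card * 2 ^ e ≤ n
  last : e = 0 ∨ c * 2 ^ (e - 1) * rd < rn

theorem wp_mainLoop (hZ : IsDist Z) (hb : Bounds W n Z B rn rd c) (hc : 1 ≤ c) (hβ : n ≤ β .n)
    (hn : s.reg .n = n) (hn1 : 0 < n) (hrd : 0 < rd) (hrn0 : 0 < rn) (hrn : rn ≤ n * rd)
    (h1 : s.reg .rn = rn) (h2 : s.reg .rd = rd) (hbig : s.reg .big = B)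
    (hdist : HoldsMat (s.arr .dist) Z) {h : Perm (Fin n)} (hh : h.IsTourOn Finset.univ)
    {g : Perm (Fin n)} {A : Finset (Fin n)} (h0 : Reached Z h rn rd c s g A 0) :
    wp W β (mainLoop c) s fun s' => ∃ g A e, Reached Z h rn rd c s' g A e ∧ A.Nonempty ∧
      A.card * rn ≤ c * (n * rd) := by
  have hne {g : Perm (Fin n)} {A : Finset (Fin n)} (h : g.IsTransversal A) : A.Nonempty := by
    obtain ⟨a, ha, -⟩ := h.exists_mem ⟨0, hn1⟩
    exact ⟨a, ha⟩
  refine wp_forFin (fun it s' => ∃ g A e, Reached Z h rn rd c s' g A e ∧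
    (e = it ∨ A.card * rn ≤ c * (n * rd))) hn hβ ?_ ?_ ?_
  · exact ⟨g, A, 0, ⟨h0.transversal, h0.act, h0.perm, by simpa using h0.m, h0.length, h0.card,
      h0.last⟩, .inl rfl⟩
  · rintro it s1 hF1 hit ⟨g, A, e, hR, hdone⟩
    have r1 : s1.reg .n = n := (hF1.reg .n rfl).trans hn
    have r2 : s1.reg .rn = rn := (hF1.reg .rn rfl).trans h1
    have r3 : s1.reg .rd = rd := (hF1.reg .rd rfl).trans h2
    have r4 : s1.reg .big = B := (hF1.reg .big rfl).trans hbig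
    have a1 : HoldsMat (s1.arr .dist) Z := by rw [hF1.arr .dist rfl]; exact hdist
    have hAn : (A.card : ℤ) ≤ n := by
      have := A.card_le_univ
      rw [Fintype.card_fin] at this
      exact_mod_cast this
    have i1 : 0 ≤ A.card * rn := by positivity
    have i2 : A.card * rn ≤ n * rn := by gcongr
    have i3 : 0 ≤ c * (n * rd) := by positivity
    have i4 : 0 ≤ n * rd := by positivity
    have i5 : n * rd ≤ c * (n * rd) := le_mul_of_one_le_left i4 (by exact_mod_cast hc)
    have i6 : (c : ℤ) ≤ c * (n * rd) := by
      refine le_mul_of_one_le_right (by positivity) ?_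
      have : 0 < n * rd := by positivity
      omega
    have b1 := hb.num
    have b2 := hb.den
    simp only [wp, Ex.ok_sub, Ex.ok_mul, Ex.ok_var, Ex.ok_lit, Ex.eval_var, Ex.eval_mul,
      Ex.eval_sub, Ex.eval_lit, r1, r2, r3, hR.m, true_and]
    refine ⟨by simp only [abs_le]; omega, fun hpos => ?_, fun hpos => ?_⟩
    · -- As `c ≥ 1` and `rn ≤ n * rd`, a single active city is not more than `c * n * rd / rn`.
      have hA2 : 2 ≤ A.card := by
        by_contra hlt
        have : A.card * rn ≤ 1 * rn := by
          gcongr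
          exact_mod_cast (by omega : A.card ≤ 1)
        omega
      have he : e = it := hdone.resolve_right (by omega)
      refine wp_mono _ _ (wp_round hZ hb hβ r1 r4 hR.act a1 hA2 hR.perm hR.transversal hh)
        fun s2 hF2 ⟨g', A', hT, hact, hperm, hm, hcard, hlen⟩ => ?_
      refine ⟨g', A', e + 1, ⟨hT, hact, hperm, by simpa using hm, ?_, ?_, .inr ?_⟩,
        .inl (by omega)⟩
      · have := hR.length
        push_cast
        linarith
      · have := hR.card
        rw [pow_succ]
        nlinarith
      · rw [Nat.add_sub_cancel]
        have hcd : (A.card : ℤ) * 2 ^ e ≤ n := by exact_mod_cast hR.card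
        have hpos' : (0 : ℤ) < A.card := by omega
        have h3 : (A.card : ℤ) * (c * 2 ^ e * rd) ≤ c * (n * rd) := by
          calc (A.card : ℤ) * (c * 2 ^ e * rd) = c * (A.card * 2 ^ e * rd) := by ring
            _ ≤ _ := by gcongr
        exact lt_of_mul_lt_mul_left (h3.trans_lt (by omega)) hpos'.le
    · exact ⟨g, A, e, ⟨hR.transversal, hR.act, hR.perm, by simpa using hR.m, hR.length, hR.card,
        hR.last⟩, .inr (by omega)⟩
  · rintro s' - ⟨g, A, e, hR, hdone⟩
    refine ⟨g, A, e, hR, hne hR.transversal, hdone.resolve_left fun he => ?_⟩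
    -- After `n` rounds there would be at most `n / 2 ^ n < 1` active cities.
    have h3 := hR.card
    have h4 := (hne hR.transversal).card_pos
    have h5 : e < 2 ^ e := Nat.lt_two_pow_self
    have h6 : 2 ^ e ≤ A.card * 2 ^ e := Nat.le_mul_of_pos_left _ h4
    omega

/-! ### Input and output -/

/-- Reads the input and scales the distances by the product `pr` of all denominators. -/
def setup : Cmd :=
  .set .n (.get .inp 0) ;; .set .rn (.get .inp 1) ;; .set .rd (.get .inp 2) ;;
  .set .nn (♯.n * ♯.n) ;; .set .pr 1 ;;
  .loop .k .nn (.set .pr (♯.pr * .get .inp (2 * ♯.k + 4))) ;;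
  .set .big 1 ;;
  .loop .k .nn (.set .x (.get .inp (2 * ♯.k + 3) * (♯.pr / .get .inp (2 * ♯.k + 4))) ;;
    .put .dist ♯.k ♯.x ;; .set .big (♯.big + ♯.x)) ;;
  .loop .i .n (.put .act ♯.i 1 ;; .put .g ♯.i ♯.i) ;;
  .set .m ♯.n

/-- Follows the permutation `nxt ∘ g` from city `0`. -/
def output : Cmd :=
  .set .x 0 ;; .loop .i .n (.put .out ♯.i ♯.x ;; .set .x (.get .nxt (.get .g ♯.x)))

theorem wp_output (hW : 0 ≤ W) (hβ : n ≤ β .n) (hn : s.reg .n = n) (hn1 : 0 < n)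
    {g τ : Perm (Fin n)}
    (hg : Holds (s.arr .g) fun i => ((g i).val : ℤ))
    (hp : Holds (s.arr .nxt) fun i => ((τ i).val : ℤ)) :
    wp W β output s fun s' => ∀ i : Fin n,
      s'.arr .out i.val = ((((τ * g) ^ i.val) ⟨0, hn1⟩).val : ℤ) := by
  simp only [output, wp, Ex.eval_ofNat, Ex.ok_ofNat]
  refine ⟨?_, wp_forFin (fun i s' => s'.reg .x = ((((τ * g) ^ i) ⟨0, hn1⟩).val : ℤ) ∧
    ∀ i' : Fin n, i'.val < i → s'.arr .out i'.val = ((((τ * g) ^ i'.val) ⟨0, hn1⟩).val : ℤ))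
    (by simpa using hn) hβ ?_ ?_ ?_⟩
  · exact_mod_cast hW
  · simp
  · rintro i s1 hF1 hi ⟨hx, hI⟩
    set y := ((τ * g) ^ i.val) ⟨0, hn1⟩ with hy
    have a1 : s1.arr .g y.val = (g y).val := by rw [hF1.arr .g rfl]; exact hg y
    have a2 : s1.arr .nxt (g y).val = (τ (g y)).val := by rw [hF1.arr .nxt rfl]; exact hp (g y)
    simp [wp, hi, hx, a1, a2]
    refine ⟨by rw [pow_succ', hy]; rfl, fun i' hle => ?_⟩
    by_cases h : i' = i
    · simp [h, hy]
    · have h' : i'.val ≠ i.val := fun e => h (Fin.ext e)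
      simpa [h'] using hI i' (lt_of_le_of_ne hle h')
  · rintro s' - ⟨-, h⟩ i
    exact h i i.isLt

/-- The input array holds `n`, the ratio `rn / rd` and the list of fractions `a q / b q`. -/
structure InputIs (f : ℤ → ℤ) (n : ℕ) (rn rd : ℤ) (a b : ℕ → ℤ) : Prop where
  cities : f 0 = n
  ratio_num : f 1 = rn
  ratio_den : f 2 = rd
  num : ∀ q < n * n, f (2 * q + 3) = a q
  den : ∀ q < n * n, f (2 * q + 4) = b q
  num_nonneg : ∀ q < n * n, 0 ≤ a q
  den_pos : ∀ q < n * n, 0 < b q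

/-- The distances after scaling with the product of all denominators. -/
def scaled (n : ℕ) (a b : ℕ → ℤ) (q : ℕ) : ℤ := a q * ((∏ k ∈ Finset.range (n * n), b k) / b q)

theorem InputIs.prod_pos {f : ℤ → ℤ} {a b : ℕ → ℤ} (hI : InputIs f n rn rd a b) {N : ℕ}
    (hN : N ≤ n * n) : 0 < ∏ k ∈ Finset.range N, b k :=
  Finset.prod_pos fun k hk => hI.den_pos k ((Finset.mem_range.1 hk).trans_le hN)

theorem InputIs.scaled_nonneg {f : ℤ → ℤ} {a b : ℕ → ℤ} (hI : InputIs f n rn rd a b) {q : ℕ}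
    (hq : q < n * n) : 0 ≤ scaled n a b q :=
  mul_nonneg (hI.num_nonneg q hq) (Int.ediv_nonneg (hI.prod_pos le_rfl).le (hI.den_pos q hq).le)

theorem wp_setup {a b : ℕ → ℤ} (hI : InputIs (s.arr .inp) n rn rd a b) (hβ : n ≤ β .n)
    (hβ2 : n * n ≤ β .nn) (hW : 2 * (n * n) + 4 ≤ W)
    (hprod : ∏ k ∈ Finset.range (n * n), b k ≤ W)
    (hsum : 1 + ∑ q ∈ Finset.range (n * n), scaled n a b q ≤ W) :
    wp W β setup s fun s' => s'.reg .n = n ∧ s'.reg .rn = rn ∧ s'.reg .rd = rd ∧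
      s'.reg .m = n ∧ s'.reg .big = 1 + ∑ q ∈ Finset.range (n * n), scaled n a b q ∧
      (∀ q < n * n, s'.arr .dist q = scaled n a b q) ∧
      (∀ i < n, s'.arr .act i = 1) ∧ ∀ i < n, s'.arr .g i = i := by
  have hnn : (0 : ℤ) ≤ (n : ℤ) * n := by positivity
  have hpart {N : ℕ} (hN : N ≤ n * n) : ∏ k ∈ Finset.range N, b k ≤ W := by
    refine (Int.le_of_dvd (hI.prod_pos le_rfl) ?_).trans hprod
    exact Finset.prod_dvd_prod_of_subset _ _ _ (Finset.range_subset_range.2 hN)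
  simp [-abs_mul, wp, setup, hI.cities, hI.ratio_num, hI.ratio_den]
  refine ⟨by omega, by omega, by omega, by simp only [abs_le]; omega, by omega, ?_⟩
  refine wp_for (fun k s' => s'.reg .pr = ∏ q ∈ Finset.range k, b q) (n * n) (by simp) hβ2 ?_ ?_ ?_
  · simp
  · intro k hk s1 hF1 hkk hpr
    have hk' : (k : ℤ) < n * n := by exact_mod_cast hk
    have a1 : s1.arr .inp (2 * k + 4) = b k := by
      rw [hF1.arr .inp rfl]; simpa using hI.den k hk
    have h1 : |∏ q ∈ Finset.range (k + 1), b q| ≤ W := by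
      rw [abs_of_pos (hI.prod_pos hk)]; exact hpart hk
    rw [Finset.prod_range_succ] at h1
    simp [-abs_mul, wp, hkk, a1, hpr, Finset.prod_range_succ, and_assoc]
    exact ⟨by omega, by simp only [abs_le]; omega, by omega, by simp only [abs_le]; omega, h1⟩
  rintro s1 hF1 - hpr
  have n1 : s1.reg .n = n := by rw [hF1.reg .n rfl]; simp
  have nn1 : s1.reg .nn = n * n := by rw [hF1.reg .nn rfl]; simp
  have rn1 : s1.reg .rn = rn := by rw [hF1.reg .rn rfl]; simp
  have rd1 : s1.reg .rd = rd := by rw [hF1.reg .rd rfl]; simp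
  have in1 : InputIs (s1.arr .inp) n rn rd a b := by rw [hF1.arr .inp rfl]; simpa using hI
  refine ⟨by omega, ?_⟩
  refine wp_for (fun k s' => s'.reg .big = 1 + ∑ q ∈ Finset.range k, scaled n a b q ∧
    ∀ q < k, s'.arr .dist q = scaled n a b q) (n * n) (by simpa using nn1) hβ2 ?_ ?_ ?_
  · simp
  · rintro k hk s2 hF2 hkk ⟨hbig, hd⟩
    have hk' : (k : ℤ) < n * n := by exact_mod_cast hk
    have a1 : s2.arr .inp (2 * k + 3) = a k := by
      rw [hF2.arr .inp rfl]; simpa using in1.num k hk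
    have a2 : s2.arr .inp (2 * k + 4) = b k := by
      rw [hF2.arr .inp rfl]; simpa using in1.den k hk
    have r1 : s2.reg .pr = ∏ q ∈ Finset.range (n * n), b q := by
      rw [hF2.reg .pr rfl]; simpa using hpr
    have hp0 := hI.prod_pos (le_refl (n * n))
    have hq0 := Int.ediv_nonneg hp0.le (hI.den_pos k hk).le
    have hq1 := Int.ediv_le_self (b k) hp0.le
    have hz (q : ℕ) (hq : q ∈ Finset.range (n * n)) : 0 ≤ scaled n a b q :=
      hI.scaled_nonneg (Finset.mem_range.1 hq)
    have hs1 : ∑ q ∈ Finset.range (k + 1), scaled n a b q ≤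
        ∑ q ∈ Finset.range (n * n), scaled n a b q :=
      Finset.sum_le_sum_of_subset_of_nonneg (Finset.range_subset_range.2 hk) fun q hq _ => hz q hq
    have hs0 : 0 ≤ ∑ q ∈ Finset.range k, scaled n a b q :=
      Finset.sum_nonneg fun q hq => hI.scaled_nonneg ((Finset.mem_range.1 hq).trans hk)
    have hzk := hz k (Finset.mem_range.2 hk)
    rw [Finset.sum_range_succ] at hs1
    have hdef : a k * ((∏ q ∈ Finset.range (n * n), b q) / b k) = scaled n a b k := rfl
    simp [-abs_mul, wp, hkk, a1, a2, r1, hbig, hdef, Finset.sum_range_succ, and_assoc]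
    refine ⟨by omega, by simp only [abs_le]; omega, by omega, by simp only [abs_le]; omega,
      by omega, by simp only [abs_le]; omega, by omega, by simp only [abs_le]; omega,
      by simp only [abs_le]; omega, by simp only [abs_le]; omega, by simp only [abs_le]; omega,
      by ring, fun q hq => ?_⟩
    rcases hq.lt_or_eq with h | rfl
    · rw [if_neg h.ne, hd q h]
    · rw [if_pos rfl]
  rintro s2 hF2 - ⟨hbig, hd⟩
  have n2 : s2.reg .n = n := by rw [hF2.reg .n rfl]; simpa using n1
  refine wp_for (fun k s' => (∀ i < k, s'.arr .act i = 1) ∧ ∀ i < k, s'.arr .g i = i) n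
    (by simpa using n2) hβ ?_ ?_ ?_
  · simp
  · rintro k hk s3 hF3 hkk ⟨h1, h2⟩
    simp only [wp, Ex.ok_var, Ex.ok_ofNat, Ex.eval_var, Ex.eval_ofNat, hkk, true_and]
    refine ⟨by push_cast; omega, fun i hi => ?_, fun i hi => ?_⟩ <;>
      rcases Nat.lt_succ_iff_lt_or_eq.1 hi with h | rfl
    · simp [h1 i h]
    · simp
    · simp [h2 i h, eq_comm]
    · simp [hkk]
  rintro s3 hF3 - ⟨h1, h2⟩
  have n3 : s3.reg .n = n := by rw [hF3.reg .n rfl, n2]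
  simp [n3, hF3.reg .rn rfl, hF3.reg .rd rfl, hF3.reg .big rfl, hF3.arr .dist rfl, hF2.reg .rn rfl,
    hF2.reg .rd rfl, rn1, rd1, hbig]
  exact ⟨hd, h1, h2⟩

end TourProgram

/-! ### Tours as cyclic permutations -/

namespace Equiv.Perm

variable {n : ℕ}

/-- A cyclic permutation of all cities, listed from city `0`. -/
theorem IsTourOn.exists_enumeration {G : Perm (Fin n)} (hG : G.IsTourOn Finset.univ) (hn : 0 < n) :
    ∃ σ : Perm (Fin n), (∀ i, σ i = (G ^ i.val) ⟨0, hn⟩) ∧ ∀ i, σ (finRotate n i) = G (σ i) := by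
  obtain ⟨m, rfl⟩ : ∃ m, n = m + 1 := ⟨n - 1, by omega⟩
  let F (i : Fin (m + 1)) : Fin (m + 1) := (G ^ i.val) 0
  have hsurj : Function.Surjective F := by
    intro y
    have hy := hG.sameCycle 0 (Finset.mem_univ _) y (Finset.mem_univ _)
    by_cases h0 : (0 : Fin (m + 1)) ∈ G.support
    · obtain ⟨i, hi, rfl⟩ := hy.exists_pow_eq_of_mem_support h0
      have := Finset.card_le_univ (G.cycleOf 0).support
      rw [Fintype.card_fin] at this
      exact ⟨⟨i, by omega⟩, rfl⟩
    · rw [notMem_support] at h0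
      exact ⟨0, by simpa [F] using hy.eq_of_left h0⟩
  have hbij : Function.Bijective F := Finite.surjective_iff_bijective.1 hsurj
  refine ⟨Equiv.ofBijective F hbij, fun i => rfl, fun i => ?_⟩
  change F (finRotate (m + 1) i) = G (F i)
  have hstep (k : Fin (m + 1)) (hk : k.val + 1 < m + 1) : F ⟨k.val + 1, hk⟩ = G (F k) := by
    simp [F, pow_succ']
  obtain hi | hi : i.val + 1 < m + 1 ∨ i = Fin.last m := by
    rcases Fin.lt_or_eq_of_le (Fin.le_last i) with h | h
    · left; have : i.val < m := h; omega
    · exact .inr h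
  · rw [← hstep i hi]
    congr 1
    rw [finRotate_apply]
    ext
    rw [Fin.val_add_one_of_lt (show i < Fin.last m by rw [Fin.lt_def, Fin.val_last]; omega)]
  · -- The successor of the last city can only be the first one.
    subst hi
    rw [finRotate_last]
    obtain ⟨k, hk⟩ := hsurj (G (F (Fin.last m)))
    rw [← hk]
    congr 1
    by_contra hne
    have hk0 : 0 < k.val := Fin.pos_iff_ne_zero.2 (Ne.symm hne)
    have h1 := hstep ⟨k.val - 1, by omega⟩ (by simp; omega)
    have h2 : (⟨k.val - 1 + 1, by omega⟩ : Fin (m + 1)) = k := by ext; simp; omega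
    rw [h2, hk] at h1
    have h3 := congrArg Fin.val (hbij.1 (G.injective h1))
    simp at h3
    omega

theorem isTourOn_conj_finRotate (σ : Perm (Fin n)) :
    (σ * finRotate n * σ⁻¹).IsTourOn Finset.univ := by
  refine ⟨fun y hy => absurd (Finset.mem_univ y) hy, fun x _ y _ => ?_⟩
  rw [sameCycle_conj]
  rcases lt_or_ge n 2 with h | h
  · have : Subsingleton (Fin n) := Fin.subsingleton_iff_le_one.2 (by omega)
    rw [Subsingleton.elim (σ⁻¹ x) (σ⁻¹ y)]
  · have hs : (finRotate n).support = Finset.univ := support_finRotate_of_le h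
    exact (isCycle_finRotate_of_le h).sameCycle (mem_support.1 (hs ▸ Finset.mem_univ _))
      (mem_support.1 (hs ▸ Finset.mem_univ _))

end Equiv.Perm

/-! ### The encoding of instances -/

theorem List.getD_flatMap {α β : Type*} {f : α → List β} {k : ℕ} (hf : ∀ x, (f x).length = k)
    (d : β) (l : List α) (i : ℕ) (hi : i < l.length) {r : ℕ} (hr : r < k) :
    (l.flatMap f).getD (i * k + r) d = (f l[i]).getD r d := by
  induction l generalizing i with
  | nil => simp at hi
  | cons x l ih =>
    rcases i with _ | i
    · rw [List.flatMap_cons, List.getD_append _ _ _ _ (by rw [hf]; omega)]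
      simp
    · rw [List.flatMap_cons, List.getD_append_right _ _ _ _ (by rw [hf]; nlinarith), hf]
      have : (i + 1) * k + r - k = i * k + r := by rw [Nat.add_mul]; omega
      rw [this, ih i (by simpa using hi)]
      simp

namespace ATSP

variable (I : ATSP) (r : ℚ)

theorem length_encode : (I.encode r).length = 2 * (I.n * I.n) + 3 := by
  simp [encode, List.length_flatMap]
  ring

theorem encode_getD (i j : Fin I.n) {k : ℕ} (hk : k < 2) :
    (I.encode r).getD (2 * (i.val * I.n + j.val) + 3 + k) 0 =
      [(I.dist i j).num, ((I.dist i j).den : ℤ)].getD k 0 := by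
  have h1 (i : Fin I.n) : ((List.finRange I.n).flatMap
      fun j => [(I.dist i j).num, ((I.dist i j).den : ℤ)]).length = I.n * 2 := by
    simp [List.length_flatMap]
  have e : 2 * (i.val * I.n + j.val) + 3 + k = 3 + (i.val * (I.n * 2) + (j.val * 2 + k)) := by ring
  have hj : j.val * 2 + k < I.n * 2 := by have := j.isLt; omega
  rw [e, encode, List.getD_append_right _ _ _ _ (by simp)]
  have : 3 + (i.val * (I.n * 2) + (j.val * 2 + k)) - [(I.n : ℤ), r.num, (r.den : ℤ)].length =
    i.val * (I.n * 2) + (j.val * 2 + k) := by simp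
  rw [this, List.getD_flatMap h1 0 _ i.val (by simp) hj,
    List.getD_flatMap (k := 2) (fun _ => rfl) 0 _ j.val (by simp) hk]
  simp

theorem encode_num (i j : Fin I.n) :
    (I.encode r).getD (2 * (i.val * I.n + j.val) + 3) 0 = (I.dist i j).num :=
  I.encode_getD r i j (k := 0) (by norm_num)

theorem encode_den (i j : Fin I.n) :
    (I.encode r).getD (2 * (i.val * I.n + j.val) + 4) 0 = (I.dist i j).den :=
  I.encode_getD r i j (k := 1) (by norm_num)

end ATSP

namespace RAM

theorem length_le_inputSize (l : List ℤ) : l.length ≤ inputSize l := by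
  induction l with
  | nil => simp
  | cons x l ih =>
    simp only [List.length_cons, inputSize, List.map_cons, List.sum_cons, len] at ih ⊢
    omega

theorem abs_getD_lt (l : List ℤ) (i : ℕ) : |l.getD i 0| < 2 ^ inputSize l := by
  rcases lt_or_ge i l.length with h | h
  · rw [List.getD_eq_getElem _ _ h]
    have h1 : len l[i] ≤ inputSize l :=
      List.le_sum_of_mem (List.mem_map.2 ⟨_, List.getElem_mem h, rfl⟩)
    have h2 : l[i].natAbs < 2 ^ inputSize l :=
      (Nat.lt_size_self _).trans_le (Nat.pow_le_pow_right two_pos (by unfold len at h1; omega))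
    rw [Int.abs_eq_natAbs]
    exact_mod_cast h2
  · rw [List.getD_eq_default _ _ h]
    simp

end RAM

namespace TourProgram

open RAM

/-! ### Correctness for instances -/

/-- The numerators of the distances, in the order of the input. -/
def numer (I : ATSP) (r : ℚ) (q : ℕ) : ℤ := (I.encode r).getD (2 * q + 3) 0

/-- The denominators of the distances, in the order of the input. -/
def denom (I : ATSP) (r : ℚ) (q : ℕ) : ℤ := (I.encode r).getD (2 * q + 4) 0

/-- The distances after scaling to integers. -/
def scaledDist (I : ATSP) (r : ℚ) (i j : Fin I.n) : ℤ :=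
  scaled I.n (numer I r) (denom I r) (i.val * I.n + j.val)

/-- The product of all denominators. -/
def scale (I : ATSP) (r : ℚ) : ℤ := ∏ k ∈ Finset.range (I.n * I.n), denom I r k

variable (I : ATSP) (r : ℚ)

theorem exists_cell {n q : ℕ} (hq : q < n * n) : ∃ i j : Fin n, q = i.val * n + j.val := by
  have hn : 0 < n := Nat.pos_of_ne_zero fun h => by simp [h] at hq
  exact ⟨⟨q / n, (Nat.div_lt_iff_lt_mul hn).2 hq⟩, ⟨q % n, Nat.mod_lt _ hn⟩,
    (Nat.div_add_mod' q n).symm⟩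

theorem inputIs : InputIs (fun i => (init (I.encode r)).arr 0 i) I.n r.num r.den
    (numer I r) (denom I r) where
  cities := by simp [init, ATSP.encode]
  ratio_num := by simp [init, ATSP.encode]
  ratio_den := by simp [init, ATSP.encode]
  num q _ := by
    have h : (2 * (q : ℤ) + 3).toNat = 2 * q + 3 := by omega
    have h0 : (0 : ℤ) ≤ 2 * q + 3 := by omega
    simp only [init, h, h0, numer, true_and, if_true]
  den q _ := by
    have h : (2 * (q : ℤ) + 4).toNat = 2 * q + 4 := by omega
    have h0 : (0 : ℤ) ≤ 2 * q + 4 := by omega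
    simp only [init, h, h0, denom, true_and, if_true]
  num_nonneg q hq := by
    obtain ⟨i, j, rfl⟩ := exists_cell hq
    rw [numer, ATSP.encode_num]
    exact Rat.num_nonneg.2 (I.nonneg i j)
  den_pos q hq := by
    obtain ⟨i, j, rfl⟩ := exists_cell hq
    rw [denom, ATSP.encode_den]
    exact_mod_cast (I.dist i j).den_pos

theorem scale_pos : 0 < scale I r := (inputIs I r).prod_pos le_rfl

theorem index_lt {n : ℕ} (i j : Fin n) : i.val * n + j.val < n * n := by
  exact_mod_cast index_bound i j

theorem scaledDist_cast (i j : Fin I.n) : (scaledDist I r i j : ℚ) = scale I r * I.dist i j := by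
  have hd : denom I r (i.val * I.n + j.val) ∣ scale I r :=
    Finset.dvd_prod_of_mem _ (Finset.mem_range.2 (index_lt i j))
  have h0 : denom I r (i.val * I.n + j.val) = (I.dist i j).den := I.encode_den r i j
  have h1 : numer I r (i.val * I.n + j.val) = (I.dist i j).num := I.encode_num r i j
  obtain ⟨k, hk⟩ := hd
  have hne : ((I.dist i j).den : ℤ) ≠ 0 := by exact_mod_cast (I.dist i j).den_nz
  rw [scaledDist, scaled]
  change ((numer I r _ * (scale I r / denom I r _) : ℤ) : ℚ) = _
  rw [hk, h0, h1, Int.mul_ediv_cancel_left _ hne]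
  push_cast
  rw [mul_right_comm, mul_comm ((I.dist i j).den : ℚ), Rat.mul_den_eq_num]

theorem isDist_scaledDist : IsDist (scaledDist I r) := by
  have hp : (0 : ℚ) < scale I r := by exact_mod_cast scale_pos I r
  constructor
  · intro i j
    have : (0 : ℚ) ≤ scaledDist I r i j := by
      rw [scaledDist_cast]; exact mul_nonneg hp.le (I.nonneg i j)
    exact_mod_cast this
  · intro i
    have : (scaledDist I r i i : ℚ) = 0 := by rw [scaledDist_cast, I.dist_self, mul_zero]
    exact_mod_cast this
  · intro i j k
    have : (scaledDist I r i k : ℚ) ≤ scaledDist I r i j + scaledDist I r j k := by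
      rw [scaledDist_cast, scaledDist_cast, scaledDist_cast, ← mul_add]
      exact mul_le_mul_of_nonneg_left (I.triangle i j k) hp.le
    exact_mod_cast this

theorem permCost_scaledDist (G σ : Perm (Fin I.n)) (h : ∀ i, σ (finRotate I.n i) = G (σ i)) :
    (permCost (scaledDist I r) G : ℚ) = scale I r * I.tourLength σ := by
  rw [permCost, ← Equiv.sum_comp σ]
  push_cast
  rw [ATSP.tourLength, Finset.mul_sum]
  exact Finset.sum_congr rfl fun i _ => by rw [scaledDist_cast, h]

theorem sum_scaledDist : ∑ i, ∑ j, scaledDist I r i j =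
    ∑ q ∈ Finset.range (I.n * I.n), scaled I.n (numer I r) (denom I r) q := by
  rw [Finset.sum_range, ← finProdFinEquiv.sum_comp, Fintype.sum_prod_type]
  refine Finset.sum_congr rfl fun i _ => Finset.sum_congr rfl fun j _ => ?_
  rw [scaledDist]
  congr 1
  simp [finProdFinEquiv]
  ring

theorem opt_nonneg : 0 ≤ I.opt := by
  rw [ATSP.opt, Finset.le_inf'_iff]
  exact fun σ _ => Finset.sum_nonneg fun i _ => I.nonneg _ _

theorem exists_optimal : ∃ h : Perm (Fin I.n), h.IsTourOn Finset.univ ∧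
    (permCost (scaledDist I r) h : ℚ) = scale I r * I.opt := by
  obtain ⟨σ, -, hσ⟩ := Finset.exists_mem_eq_inf' (Finset.univ_nonempty (α := Perm (Fin I.n)))
    I.tourLength
  refine ⟨_, isTourOn_conj_finRotate σ, ?_⟩
  rw [permCost_scaledDist I r _ σ (by simp), ATSP.opt, hσ]

/-- The bound for all numbers that occur in the computation. -/
def wordBound (L : ℕ) : ℤ := 2 ^ (L * L + 4 * L + 10)

theorem unit_wordBound (L : ℕ) : unit (wordBound L) = 2 * (L * L + 4 * L + 10) + 5 := by
  unfold unit len wordBound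
  have : ((2 : ℤ) ^ (L * L + 4 * L + 10)).natAbs = 2 ^ (L * L + 4 * L + 10) := by
    rw [Int.natAbs_pow]; rfl
  rw [this, Nat.size_pow]
  ring

theorem bdd_init : Bdd (wordBound (inputSize (I.encode r))) (init (I.encode r)) := by
  have h1 : (1 : ℤ) ≤ wordBound (inputSize (I.encode r)) := one_le_pow₀ (by norm_num)
  refine ⟨h1, fun x => ?_, fun a i => ?_⟩
  · simp [init]; omega
  · simp only [init]
    split_ifs
    · refine (abs_getD_lt _ _).le.trans (pow_le_pow_right₀ (by norm_num) ?_)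
      nlinarith
    · simp; omega

theorem square_le : 2 * (I.n * I.n) + 3 ≤ inputSize (I.encode r) :=
  (I.length_encode r).symm.le.trans (length_le_inputSize _)

/-- With `T = 2 ^ L` for the bit length `L` of the input, the product of the denominators is at most
`2 ^ (L * L)`, and `B` is at most `2 * T * T` times that. -/
theorem bounds (c : ℕ) (hc : c ≤ 4) (hn : 1 ≤ I.n) (hr : 0 ≤ r) :
    Bounds (wordBound (inputSize (I.encode r))) I.n (scaledDist I r)
      (1 + ∑ q ∈ Finset.range (I.n * I.n), scaled I.n (numer I r) (denom I r) q) r.num r.den c ∧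
    scale I r ≤ wordBound (inputSize (I.encode r)) := by
  have hI := inputIs I r
  have hsq := square_le I r
  set L := inputSize (I.encode r) with hL
  set B := ∑ q ∈ Finset.range (I.n * I.n), scaled I.n (numer I r) (denom I r) q with hB
  have hB0 : 0 ≤ B := Finset.sum_nonneg fun q hq => hI.scaled_nonneg (Finset.mem_range.1 hq)
  obtain ⟨T, hT⟩ : ∃ T : ℤ, T = 2 ^ L := ⟨_, rfl⟩
  have hLT : (L : ℤ) < T := by rw [hT]; exact_mod_cast Nat.lt_two_pow_self
  have hT1 : 1 ≤ T := by omega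
  obtain ⟨P, hP⟩ : ∃ P : ℤ, P = 2 ^ (L * L) := ⟨_, rfl⟩
  have hP1 : 1 ≤ P := by rw [hP]; exact one_le_pow₀ (by norm_num)
  have hW : wordBound L = 1024 * (T ^ 4 * P) := by
    rw [wordBound, hT, hP, pow_add, pow_add, mul_comm 4 L, pow_mul 2 L 4]; ring
  have hnum (q : ℕ) : numer I r q ≤ T := (le_abs_self _).trans (hT ▸ (abs_getD_lt _ _).le)
  have hden (q : ℕ) : denom I r q ≤ T := (le_abs_self _).trans (hT ▸ (abs_getD_lt _ _).le)
  have hscale : scale I r ≤ P := by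
    have h1 : scale I r ≤ ∏ _k ∈ Finset.range (I.n * I.n), T :=
      Finset.prod_le_prod (fun k hk => (hI.den_pos k (Finset.mem_range.1 hk)).le) fun k _ => hden k
    refine h1.trans ?_
    rw [Finset.prod_const, Finset.card_range, hT, hP, ← pow_mul]
    exact pow_le_pow_right₀ (by norm_num) (Nat.mul_le_mul_left _ (by omega))
  have hnn : (I.n * I.n : ℤ) ≤ T := by
    have : ((I.n * I.n : ℕ) : ℤ) ≤ L := by exact_mod_cast (by omega)
    push_cast at this
    omega
  have hn' : (1 : ℤ) ≤ I.n := by exact_mod_cast hn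
  have hnT : (I.n : ℤ) ≤ T := by nlinarith
  have hnT2 : (I.n : ℤ) + 2 ≤ T := by
    have : ((2 * (I.n * I.n) + 3 : ℕ) : ℤ) ≤ L := by exact_mod_cast hsq
    push_cast at this
    nlinarith
  have hB1 : B ≤ T * (T * P) := by
    have h1 : B ≤ ∑ _q ∈ Finset.range (I.n * I.n), T * P := by
      refine Finset.sum_le_sum fun q hq => ?_
      have hq' := Finset.mem_range.1 hq
      have h2 := Int.ediv_le_self (denom I r q) (scale_pos I r).le
      have h3 := Int.ediv_nonneg (scale_pos I r).le (hI.den_pos q hq').le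
      exact mul_le_mul (hnum q) (h2.trans hscale) h3 (by omega)
    refine h1.trans ?_
    rw [Finset.sum_const, Finset.card_range, nsmul_eq_mul]
    push_cast
    gcongr
  have hT2 : T ≤ T * T := by nlinarith
  have hT3 : T * T ≤ T ^ 4 := by
    rw [← sq]; exact pow_le_pow_right₀ hT1 (by norm_num)
  have hT4 : T ^ 4 ≤ T ^ 4 * P := le_mul_of_one_le_right (by positivity) hP1
  have hrn : r.num ≤ T := by
    have e : (I.encode r).getD 1 0 = r.num := by simp [ATSP.encode]
    rw [hT, ← e]
    exact (le_abs_self _).trans (abs_getD_lt _ _).le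
  have hrd : (r.den : ℤ) ≤ T := by
    have e : (I.encode r).getD 2 0 = r.den := by simp [ATSP.encode]
    rw [hT, ← e]
    exact (le_abs_self _).trans (abs_getD_lt _ _).le
  refine ⟨⟨?_, ?_, ?_, ?_, ?_⟩, ?_⟩
  · rw [sum_scaledDist]; omega
  · have hT0 : 0 < T := by omega
    have h1 : 1 + B ≤ 2 * (T * (T * P)) := by nlinarith [mul_pos hT0 hT0]
    have h2 : ((I.n : ℤ) + 2) * (1 + B) ≤ T * (2 * (T * (T * P))) := by gcongr
    have h3 : T * (T * (T * P)) ≤ T ^ 4 * P := by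
      have : T ^ 3 ≤ T ^ 4 := pow_le_pow_right₀ hT1 (by norm_num)
      calc T * (T * (T * P)) = T ^ 3 * P := by ring
        _ ≤ _ := by gcongr
    rw [hW]
    nlinarith
  · have h1 : (2 : ℤ) ^ I.n ≤ T := by
      rw [hT]; exact pow_le_pow_right₀ (by norm_num) (by nlinarith)
    have h2 : (2 : ℤ) ^ I.n * I.n ≤ T * T := by gcongr
    rw [hW]
    omega
  · have h2 : (I.n : ℤ) * r.num ≤ T * T := by gcongr
    rw [hW]
    omega
  · have h2 : (I.n : ℤ) * r.den ≤ T * T := by gcongr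
    have h3 : (c : ℤ) * (I.n * r.den) ≤ 4 * (T * T) := by
      gcongr
      exact_mod_cast hc
    rw [hW]
    omega
  · have h4 : P ≤ T ^ 4 * P := le_mul_of_one_le_left (by omega) (one_le_pow₀ hT1)
    rw [hW]
    omega

end TourProgram

namespace TourProgram

open RAM

/-! ### The algorithm -/

/-- The rounds reduce the number of active cities. -/
def contract (c : ℕ) : Cmd := setup ;; mainLoop c

/-- An optimal tour of the remaining cities completes the permutation to a tour. -/
def finish : Cmd := heldKarp ;; output

/-- Bounds for the lengths of loops: `M` for the loop over all sets of active cities, `X` for all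
others. -/
def loopBound (X M : ℕ) : Var → ℕ
  | .cap => M
  | _ => X

/-- The loop over all sets is not nested in another loop, so its bound enters the cost only once. -/
theorem cost_finish_le (X : ℕ) {M : ℕ} (hM : 1 ≤ M) :
    finish.cost (loopBound X M) ≤ M * finish.cost (loopBound X 1) := by
  have key (a k f o : ℕ) : a + (3 + M * k + f) + o ≤ M * (a + (3 + 1 * k + f) + o) := by
    nlinarith
  exact key (bits.cost (loopBound X 1)) _ (follow.cost (loopBound X 1))
    (output.cost (loopBound X 1))

variable (I : ATSP) (r : ℚ)

theorem two_mul_sq_add_four_le (n : ℕ) :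
    (2 : ℤ) * (n * n) + 4 ≤ 2 ^ n * n + 2 * 2 ^ n + n * n + n + 2 := by
  have h1 : (n : ℤ) + 1 ≤ 2 ^ n := by exact_mod_cast Nat.lt_two_pow_self (n := n)
  have h2 : ((n : ℤ) + 1) * n ≤ 2 ^ n * n := by gcongr
  linarith

/-- The first phase leaves at most `c * n / r` active cities; `h` is any tour to compare with. -/
theorem contract_triple {c : ℕ} (hc1 : 1 ≤ c) (hc4 : c ≤ 4) (hr : 1 ≤ r) (hrn : r ≤ I.n)
    {h : Perm (Fin I.n)} (hh : h.IsTourOn Finset.univ) :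
    Triple (wordBound (inputSize (I.encode r))) (loopBound (I.n * I.n) 1)
      (proj (init (I.encode r))) (contract c) fun s => s.reg .n = I.n ∧
        HoldsMat (s.arr .dist) (scaledDist I r) ∧
        ∃ g A e, Reached (scaledDist I r) h r.num r.den c s g A e ∧ A.Nonempty ∧
          A.card * r.num ≤ c * (I.n * r.den) := by
  have hn : 1 ≤ I.n := by exact_mod_cast hr.trans hrn
  have hβ : I.n ≤ loopBound (I.n * I.n) 1 .n := Nat.le_mul_self _
  have hI := inputIs I r
  obtain ⟨hb, hsc⟩ := bounds I r c hc4 hn (zero_le_one.trans hr)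
  have hZ := isDist_scaledDist I r
  have hpos := hb.pos hZ
  have hB1 := hb.size
  rw [← mul_assoc] at hB1
  apply triple_of_wp
  simp only [contract, wp]
  refine wp_mono _ _ (wp_setup (s := proj (init (I.encode r))) hI hβ le_rfl ?_ hsc ?_) ?_
  · exact (two_mul_sq_add_four_le I.n).trans hb.index
  · exact (le_mul_of_one_le_left hpos.le (by omega)).trans hB1
  rintro s1 - ⟨h1, h2, h3, h4, h5, h6, h7, h8⟩
  have hd1 : HoldsMat (s1.arr .dist) (scaledDist I r) := fun i j => by
    have := h6 _ (index_lt i j)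
    push_cast at this
    exact this
  have hnum : 0 < r.num := Rat.num_pos.2 (zero_lt_one.trans_le hr)
  have hrn' : r.num ≤ I.n * r.den := by
    have h9 : (r.num : ℚ) ≤ I.n * r.den := by
      rw [← Rat.mul_den_eq_num r]
      gcongr
    exact_mod_cast h9
  refine wp_mono _ _ (wp_mainLoop hZ hb hc1 hβ h1 hn (by exact_mod_cast r.den_pos) hnum hrn' h2 h3
    h5 hd1 hh (g := 1) (A := Finset.univ) ⟨isTransversal_one, fun i => ?_, fun i => ?_, ?_, ?_, ?_,
      .inl rfl⟩) fun s2 hF2 hR => ⟨(hF2.reg .n rfl).trans h1, ?_, hR⟩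
  · simpa [ind] using h7 i i.isLt
  · simpa using h8 i i.isLt
  · simpa using h4
  · simp [permCost, hZ.self]
  · simp
  · rw [hF2.arr .dist rfl]; exact hd1

/-- The second phase turns the permutation that is left by the first one into a tour. -/
theorem finish_triple {c : ℕ} (hc4 : c ≤ 4) (hr : 0 ≤ r) (hn : 1 ≤ I.n) {s : St}
    (hs : s.reg .n = I.n) (hd : HoldsMat (s.arr .dist) (scaledDist I r)) {g h : Perm (Fin I.n)}
    (hh : h.IsTourOn Finset.univ) {A : Finset (Fin I.n)} {e : ℕ}
    (hR : Reached (scaledDist I r) h r.num r.den c s g A e) (hA : A.Nonempty) :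
    Triple (wordBound (inputSize (I.encode r))) (loopBound (I.n * I.n) (2 ^ A.card)) s finish
      fun s' => ∃ G : Perm (Fin I.n), G.IsTourOn Finset.univ ∧
        permCost (scaledDist I r) G ≤ (e + 1) * permCost (scaledDist I r) h ∧
        ∀ i : Fin I.n, s'.arr .out i.val = (((G ^ i.val) ⟨0, hn⟩).val : ℤ) := by
  have hβ : I.n ≤ loopBound (I.n * I.n) (2 ^ A.card) .n := Nat.le_mul_self _
  obtain ⟨hb, -⟩ := bounds I r c hc4 hn hr
  have hZ := isDist_scaledDist I r
  have hpos := hb.pos hZ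
  have hB1 := hb.size
  apply triple_of_wp
  simp only [finish, wp]
  refine wp_mono _ _ (wp_heldKarp hZ ⟨hZ.nonneg, hb.le hZ, by nlinarith, hb.index⟩ hβ le_rfl hs
    hR.act hd hA) ?_
  rintro s1 hF1 ⟨τ, hτ, hnxt, hmin⟩
  have hg1 : Holds (s1.arr .g) fun i => ((g i).val : ℤ) := by rw [hF1.arr .g rfl]; exact hR.perm
  refine wp_mono _ _ (wp_output (by nlinarith) hβ ((hF1.reg .n rfl).trans hs) hn hg1 hnxt)
    fun s2 _ hout => ⟨τ * g, hR.transversal.isTourOn_mul hτ, ?_, hout⟩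
  obtain ⟨f, hf, hfh⟩ := hZ.exists_isTourOn hh A
  have h1 := hZ.permCost_mul_le τ g
  have h2 := hmin f hf
  have h3 := hR.length
  linarith

/-- The algorithm, for both parts of the theorem: it finds a tour that is at most `e + 1` times as
long as an optimal one, where `e` is the number of rounds and `m` the number of cities left after
them. -/
theorem exists_program (c : ℕ) (hc1 : 1 ≤ c) (hc4 : c ≤ 4) :
    ∃ (p : Prog) (C d : ℕ), ∀ (I : ATSP) (r : ℚ), 1 ≤ r → r ≤ I.n →
      ∃ (s : Store) (t : ℕ) (σ : Perm (Fin I.n)) (e m : ℕ),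
        Exec p (init (I.encode r)) s t ∧ (∀ i : Fin I.n, s.arr 1 (i : ℕ) = ((σ i : ℕ) : ℤ)) ∧
        I.tourLength σ ≤ (e + 1) * I.opt ∧ (e = 0 ∨ c * 2 ^ (e - 1) < r) ∧ m * r ≤ c * I.n ∧
        t ≤ C * inputSize (I.encode r) ^ d * 2 ^ m := by
  refine ⟨.seq (contract c).comp finish.comp, ((contract c).coeff + finish.coeff) * 35,
    (contract c).depth + finish.depth + 2, fun I r hr hrn => ?_⟩
  have hn : 1 ≤ I.n := by exact_mod_cast hr.trans hrn
  obtain ⟨h, hh, hopt⟩ := exists_optimal I r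
  obtain ⟨S1, t1, hE1, hB1, -, ht1, hs1, hd1, g, A, e, hR, hA, hcard⟩ :=
    contract_triple I r hc1 hc4 hr hrn hh _ rfl (bdd_init I r)
  obtain ⟨S2, t2, hE2, -, -, ht2, G, hG, hlen, hout⟩ :=
    finish_triple I r hc4 (zero_le_one.trans hr) hn hs1 hd1 hh hR hA S1 rfl hB1
  obtain ⟨σ, hσ, hrot⟩ := hG.exists_enumeration hn
  have hden : (0 : ℚ) < r.den := by exact_mod_cast r.den_pos
  refine ⟨S2, _, σ, e, A.card, .seq hE1 hE2, fun i => ?_, ?_,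
    hR.last.imp_right fun hlast => ?_, ?_, ?_⟩
  · rw [hσ]; exact hout i
  · have hsc : (0 : ℚ) < scale I r := by exact_mod_cast scale_pos I r
    have h1 : (permCost (scaledDist I r) G : ℚ) ≤ (e + 1) * permCost (scaledDist I r) h := by
      exact_mod_cast hlen
    rw [permCost_scaledDist I r G σ hrot, hopt, mul_left_comm] at h1
    exact le_of_mul_le_mul_left h1 hsc
  · have h1 : (c * 2 ^ (e - 1) * r.den : ℚ) < r * r.den := by
      rw [Rat.mul_den_eq_num]
      exact_mod_cast hlast
    exact lt_of_mul_lt_mul_right h1 hden.le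
  · have h1 : (A.card * r.num : ℚ) ≤ c * (I.n * r.den) := by exact_mod_cast hcard
    rw [← Rat.mul_den_eq_num r, ← mul_assoc, ← mul_assoc] at h1
    exact le_of_mul_le_mul_right h1 hden
  · have hsq := square_le I r
    set L := inputSize (I.encode r)
    set X := I.n * I.n
    have hX : 1 ≤ X := Nat.mul_pos hn hn
    have hL : 1 ≤ L := by omega
    have hM : 1 ≤ 2 ^ A.card := Nat.one_le_two_pow
    have hβ (x : Var) : loopBound X 1 x ≤ L := by
      unfold loopBound; split <;> omega
    have c1 := (contract c).cost_le (loopBound X 1) L hL hβ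
    have c2 := finish.cost_le (loopBound X 1) L hL hβ
    have c3 := cost_finish_le X hM
    set D1 := (contract c).depth
    set D2 := finish.depth
    have p1 : L ^ D1 ≤ L ^ (D1 + D2) := Nat.pow_le_pow_right hL (by omega)
    have p2 : L ^ D2 ≤ L ^ (D1 + D2) := Nat.pow_le_pow_right hL (by omega)
    have hu : unit (wordBound L) ≤ 35 * L ^ 2 := by rw [unit_wordBound]; nlinarith
    calc t1 + t2 ≤ (contract c).cost (loopBound X 1) * unit (wordBound L) +
          finish.cost (loopBound X (2 ^ A.card)) * unit (wordBound L) := Nat.add_le_add ht1 ht2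
      _ ≤ ((contract c).coeff * L ^ (D1 + D2) * 2 ^ A.card) * unit (wordBound L) +
          (2 ^ A.card * (finish.coeff * L ^ (D1 + D2))) * unit (wordBound L) := by
        gcongr
        · calc _ ≤ (contract c).coeff * L ^ D1 := c1
            _ ≤ (contract c).coeff * L ^ (D1 + D2) := by gcongr
            _ ≤ _ := Nat.le_mul_of_pos_right _ hM
        · exact c3.trans (by gcongr; exact c2.trans (by gcongr))
      _ = ((contract c).coeff + finish.coeff) * L ^ (D1 + D2) * 2 ^ A.card *
          unit (wordBound L) := by ring
      _ ≤ ((contract c).coeff + finish.coeff) * L ^ (D1 + D2) * 2 ^ A.card * (35 * L ^ 2) := by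
        gcongr
      _ = _ := by rw [pow_add L (D1 + D2) 2]; ring

end TourProgram

theorem two_pow_le_rpow {c m n : ℕ} {r : ℚ} (hr : 0 < r) (h : m * r ≤ c * n) :
    (2 : ℝ) ^ m ≤ ((2 : ℝ) ^ c) ^ ((n : ℝ) / r) := by
  have hr' : (0 : ℝ) < r := by exact_mod_cast hr
  have h' : (m : ℝ) * r ≤ c * n := by exact_mod_cast h
  rw [← Real.rpow_natCast 2 m, ← Real.rpow_natCast 2 c, ← Real.rpow_mul (by norm_num)]
  refine Real.rpow_le_rpow_of_exponent_le (by norm_num) ?_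
  rw [← mul_div_assoc, le_div_iff₀ hr']
  exact h'

theorem mainTheorem6 :
    ATSP.ApproximableInTime 1 (fun r => (⌈Real.logb 2 (r : ℝ)⌉ : ℝ) + 1)
      (fun n r => (2 : ℝ) ^ ((n : ℝ) / (r : ℝ))) ∧
    ATSP.ApproximableInTime 2 (fun r => Real.logb 2 (r : ℝ))
      (fun n r => (16 : ℝ) ^ ((n : ℝ) / (r : ℝ))) := by
  constructor
  · obtain ⟨p, C, d, hp⟩ := TourProgram.exists_program 1 le_rfl (by norm_num)
    refine ⟨p, C, d, fun I r hr hrn => ?_⟩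
    obtain ⟨s, t, σ, e, m, hE, hout, hlen, he, hm, ht⟩ := hp I r hr hrn
    have hr0 : (0 : ℝ) < r := by exact_mod_cast zero_lt_one.trans_le hr
    refine ⟨s, t, σ, hE, hout, ?_, ?_⟩
    · have hopt : (0 : ℝ) ≤ I.opt := by exact_mod_cast TourProgram.opt_nonneg I
      have hlen' : (I.tourLength σ : ℝ) ≤ (e + 1) * I.opt := by exact_mod_cast hlen
      refine hlen'.trans (mul_le_mul_of_nonneg_right ?_ hopt)
      refine add_le_add_left ?_ 1
      rcases he with rfl | he
      · have h0 : 0 ≤ Real.logb 2 r := Real.logb_nonneg (by norm_num) (by exact_mod_cast hr)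
        simpa using Int.ceil_nonneg h0
      · have h1 : (2 : ℝ) ^ ((e : ℝ) - 1) < r := by
          rcases e with _ | e
          · have h1 : (1 : ℝ) ≤ r := by exact_mod_cast hr
            norm_num
            linarith
          · have h1 : (2 : ℝ) ^ e < r := by
              rw [Nat.cast_one, one_mul, Nat.add_sub_cancel] at he
              exact_mod_cast he
            simpa using h1
        have h2 := (Real.lt_logb_iff_rpow_lt (by norm_num) hr0).2 h1
        have h3 : ((e : ℤ) - 1 : ℤ) < ⌈Real.logb 2 (r : ℝ)⌉ := by
          rw [Int.lt_ceil]; push_cast; exact h2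
        exact_mod_cast (by omega : (e : ℤ) ≤ ⌈Real.logb 2 (r : ℝ)⌉)
    · have h1 := two_pow_le_rpow (zero_lt_one.trans_le hr) hm
      rw [pow_one] at h1
      calc (t : ℝ) ≤ C * (RAM.inputSize (I.encode r) : ℝ) ^ d * 2 ^ m := by exact_mod_cast ht
        _ ≤ _ := by gcongr
  · obtain ⟨p, C, d, hp⟩ := TourProgram.exists_program 4 (by norm_num) le_rfl
    refine ⟨p, C, d, fun I r hr hrn => ?_⟩
    have hr1 : 1 ≤ r := one_le_two.trans hr
    obtain ⟨s, t, σ, e, m, hE, hout, hlen, he, hm, ht⟩ := hp I r hr1 hrn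
    have hr0 : (0 : ℝ) < r := by exact_mod_cast zero_lt_one.trans_le hr1
    refine ⟨s, t, σ, hE, hout, ?_, ?_⟩
    · have hopt : (0 : ℝ) ≤ I.opt := by exact_mod_cast TourProgram.opt_nonneg I
      have hlen' : (I.tourLength σ : ℝ) ≤ (e + 1) * I.opt := by exact_mod_cast hlen
      refine hlen'.trans (mul_le_mul_of_nonneg_right ?_ hopt)
      rw [Real.le_logb_iff_rpow_le (by norm_num) hr0]
      rcases he with rfl | he
      · simpa using (by exact_mod_cast hr : (2 : ℝ) ≤ r)
      · rcases e with _ | e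
        · simpa using (by exact_mod_cast hr : (2 : ℝ) ≤ r)
        · -- Here `e + 1` rounds were made, and `2 ^ (e + 2) = 4 * 2 ^ e < r`.
          have h1 : ((4 : ℕ) : ℝ) * 2 ^ e < r := by
            rw [Nat.add_sub_cancel] at he
            exact_mod_cast he
          have h2 : (2 : ℝ) ^ (((e + 1 : ℕ) : ℝ) + 1) = 4 * 2 ^ e := by
            rw [← Nat.cast_succ, Real.rpow_natCast, pow_succ, pow_succ]
            ring
          rw [h2]
          exact_mod_cast h1.le
    · have h1 := two_pow_le_rpow (zero_lt_one.trans_le hr1) hm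
      norm_num at h1
      calc (t : ℝ) ≤ C * (RAM.inputSize (I.encode r) : ℝ) ^ d * 2 ^ m := by exact_mod_cast ht
        _ ≤ _ := by gcongr
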